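/- Let $\tfrac12<\mu\le 1$ and $p=\frac{1-\mu}{\mu}$. On $L^2(\mathbb R)$, with $(Qf)(x)=xf(x)$, $P=-i\,\frac{d}{dx}$ and $a=(Q+iP)/\sqrt2$, let $|k\rangle$ $(k\ge 0)$ be the number states (the Hermite functions), let $D(z)=\exp(za^*-\bar z a)$ be the displacement operators, $z\in\mathbb C$, and for ${\bf u}=(u_x,u_y)\in\mathbb R^2$ put $\alpha_{\bf u}=-u_y+iu_x$ and $$\phi^{\bf u}=D(\sqrt{2\mu-1}\,\alpha_{\bf u})\,\phi^{\bf 0}\,D(\sqrt{2\mu-1}\,\alpha_{\bf u})^*,\qquad \phi^{\bf 0}=(1-p)\sum_{k\ge0}p^k|k\rangle\langle k|.$$ For $K\subseteq\mathbb R^2$ let $\mathcal G^K=\{\phi^{\bf u}:{\bf u}\in K\}$ and $\mathcal G=\mathcal G^{\mathbb R^2}$. The minimax risk of $\mathcal G^K$ for quadratic loss is $$C(\mathcal G^K)=\inf_{M,\hat{\bf u}}\ \sup_{{\bf u}\in K}R_M({\bf u},\hat{\bf u}),\qquad R_M({\bf u},\hat{\bf u})=\int\|\hat{\bf u}(x)-{\bf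 u}\|^2\,\mathrm{Tr}\big(\phi^{\bf u}M(dx)\big),$$ where the infimum is over all measurements (positive operator valued measures) $M$ on measurable spaces and all measurable estimators $\hat{\bf u}$ with values in $\mathbb R^2$. Then: 1. $\displaystyle\lim_{a\to\infty}C(\mathcal G^{[-a,a]^2})=C(\mathcal G)$. 2. The heterodyne measurement $$H(B)=\int_B h({\bf u})\,d{\bf u},\qquad h({\bf u})=\frac{2\mu-1}{\pi}\,D(\sqrt{2\mu-1}\,\alpha_{\bf u})\,|0\rangle\langle0|\,D(\sqrt{2\mu-1}\,\alpha_{\bf u})^*$$ (weak integral) is a positive operator valued measure on $\mathbb R^2$ and, with its outcome as the estimator, it attains $C(\mathcal G)$: its worst-case risk over $\mathbb R^2$, and in fact its risk at every ${\bf u}\in\mathbb R^2$, equals $C(\mathcal G)$, and $C(\mathcal G)<\infty$. 3. $C(\mathcal G)$ equals the Holevo bound of the model $\mathcal G$, with identity weight matrix, at every point ${\bf u}\in\mathbb R^2$, that is, $$C(\mathcal G)=\inf_{X}\big\{\mathrm{Tr}\,\mathrm{Re}\,Z(X)+\mathrm{Tr}\,|\mathrm{Im}\,Z(X)|\big\},\qquad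 Z(X)_{ij}=\mathrm{Tr}(\phi^{\bf u}X_iX_j),$$ the infimum being over all pairs $X=(X_1,X_2)$ of bounded self-adjoint operators with $\mathrm{Tr}(\phi^{\bf u}X_i)=0$ and $\partial_{u_j}\mathrm{Tr}(\phi^{\bf u}X_i)=\delta_{ij}$ for $i,j\in\{1,2\}$, where $(u_1,u_2)=(u_x,u_y)$. -/

import Mathlib

open MeasureTheory
open scoped InnerProductSpace ENNReal

noncomputable section

namespace QStat

section Abstract

variable {H : Type*} [NormedAddCommGroup H] [InnerProductSpace ℂ H] [CompleteSpace H]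

/-- The index set of a fixed orthonormal (Hilbert) basis of `H`. -/
def basisIndex (H : Type*) [NormedAddCommGroup H] [InnerProductSpace ℂ H] [CompleteSpace H] :
    Set H :=
  (exists_hilbertBasis ℂ H).choose

/-- A fixed orthonormal (Hilbert) basis of `H`, used to write down traces. -/
def stdBasis (H : Type*) [NormedAddCommGroup H] [InnerProductSpace ℂ H] [CompleteSpace H] :
    HilbertBasis (basisIndex H) ℂ H :=
  (exists_hilbertBasis ℂ H).choose_spec.choose

/-- The trace `∑ⱼ ⟨bⱼ, T bⱼ⟩`. It is used for trace-class operators only, where the series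
converges absolutely and does not depend on the orthonormal basis `b`. -/
def trace (T : H →L[ℂ] H) : ℂ :=
  ∑' j, ⟪stdBasis H j, T (stdBasis H j)⟫_ℂ

/-- Density operators: positive trace-class operators of trace one. For a positive operator,
being trace class means that its diagonal is summable. -/
structure DensityOperator (H : Type*) [NormedAddCommGroup H] [InnerProductSpace ℂ H]
    [CompleteSpace H] where
  op : H →L[ℂ] H
  isPositive : op.IsPositive
  summable_diag : Summable fun j => ⟪stdBasis H j, op (stdBasis H j)⟫_ℂ
  trace_eq_one : trace op = 1

/-- Measurements with outcomes in a measurable space `X`, i.e. positive operator valued measures: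
`M B` is positive for every measurable `B`, the total mass is the identity and `M` is countably
additive in the weak sense. -/
structure POVM (X : Type*) [MeasurableSpace X] (H : Type*) [NormedAddCommGroup H]
    [InnerProductSpace ℂ H] [CompleteSpace H] where
  toFun : Set X → H →L[ℂ] H
  isPositive : ∀ B, MeasurableSet B → (toFun B).IsPositive
  map_univ : toFun Set.univ = 1
  hasSum_iUnion : ∀ B : ℕ → Set X, (∀ i, MeasurableSet (B i)) → Pairwise (Function.onFun Disjoint B) →
    ∀ ψ : H, HasSum (fun i => ⟪ψ, toFun (B i) ψ⟫_ℂ) ⟪ψ, toFun (⋃ i, B i) ψ⟫_ℂ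

theorem hasSum_norm_sq_inner (b : HilbertBasis (basisIndex H) ℂ H) (x : H) :
    HasSum (fun j => ‖⟪b j, x⟫_ℂ‖ ^ 2) (‖x‖ ^ 2) := by
  have h := b.hasSum_inner_mul_inner x x
  have h2 := h.mapL Complex.reCLM
  simp only [Complex.reCLM_apply] at h2
  convert h2 using 1
  · ext j
    rw [← inner_conj_symm x (b j), ← Complex.normSq_eq_conj_mul_self, Complex.ofReal_re,
      Complex.normSq_eq_norm_sq]
  · rw [inner_self_eq_norm_sq_to_K]
    norm_cast

/-- If `ρ = ∑ₖ |ψₖ⟩⟨ψₖ|` weakly with `∑ₖ ‖ψₖ‖² < ∞`, then `Tr (ρ A) = ∑ₖ ⟨ψₖ, A ψₖ⟩`. -/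
theorem hasSum_trace_mul {κ : Type*} (ρ : H →L[ℂ] H) (ψ : κ → H)
    (hψ : Summable fun k => ‖ψ k‖ ^ 2)
    (hρ : ∀ x y, HasSum (fun k => ⟪x, ψ k⟫_ℂ * ⟪ψ k, y⟫_ℂ) ⟪x, ρ y⟫_ℂ) (A : H →L[ℂ] H) :
    HasSum (fun k => ⟪ψ k, A (ψ k)⟫_ℂ) (trace (ρ * A)) ∧
      Summable fun j => ⟪stdBasis H j, (ρ * A) (stdBasis H j)⟫_ℂ := by
  set b := stdBasis H with hb
  have hS : ∀ (B : H →L[ℂ] H), Summable fun q : κ × basisIndex H => ‖⟪b q.2, B (ψ q.1)⟫_ℂ‖ ^ 2 := by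
    intro B
    refine (summable_prod_of_nonneg (fun _ => by positivity)).2 ⟨?_, ?_⟩
    · intro k
      exact (hasSum_norm_sq_inner b (B (ψ k))).summable
    · simp only [(hasSum_norm_sq_inner b _).tsum_eq]
      refine Summable.of_nonneg_of_le (fun _ => by positivity) (fun k => ?_) (hψ.mul_left (‖B‖ ^ 2))
      rw [← mul_pow]
      gcongr
      exact B.le_opNorm _
  have hF : Summable fun q : κ × basisIndex H =>
      ⟪b q.2, ψ q.1⟫_ℂ * ⟪ψ q.1, A (b q.2)⟫_ℂ := by
    refine Summable.of_norm_bounded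
      ((hS 1).add (hS (ContinuousLinearMap.adjoint A))) (fun q => ?_)
    rw [norm_mul, ← ContinuousLinearMap.adjoint_inner_left, norm_inner_symm _ (b q.2)]
    simp only [one_apply_eq_self]
    nlinarith [sq_nonneg (‖⟪b q.2, ψ q.1⟫_ℂ‖ - ‖⟪b q.2, (ContinuousLinearMap.adjoint A) (ψ q.1)⟫_ℂ‖),
      sq_nonneg (‖⟪b q.2, ψ q.1⟫_ℂ‖), sq_nonneg ‖⟪b q.2, (ContinuousLinearMap.adjoint A) (ψ q.1)⟫_ℂ‖]
  have h1 : ∀ k, HasSum (fun j => ⟪b j, ψ k⟫_ℂ * ⟪ψ k, A (b j)⟫_ℂ) ⟪ψ k, A (ψ k)⟫_ℂ := by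
    intro k
    have := b.hasSum_inner_mul_inner (ContinuousLinearMap.adjoint A (ψ k)) (ψ k)
    simp only [ContinuousLinearMap.adjoint_inner_left] at this
    simpa only [mul_comm] using this
  have h2 : ∀ j, HasSum (fun k => ⟪b j, ψ k⟫_ℂ * ⟪ψ k, A (b j)⟫_ℂ) ⟪b j, (ρ * A) (b j)⟫_ℂ :=
    fun j => hρ _ _
  have h3 := hF.hasSum.prod_fiberwise h1
  have h4 := ((Equiv.prodComm _ _).hasSum_iff.2 hF.hasSum).prod_fiberwise h2
  refine ⟨?_, h4.summable⟩
  rw [trace, h4.tsum_eq]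
  exact h3

theorem DensityOperator.exists_decomposition (ρ : DensityOperator H) :
    ∃ ψ : basisIndex H → H, (Summable fun k => ‖ψ k‖ ^ 2) ∧
      ∀ x y, HasSum (fun k => ⟪x, ψ k⟫_ℂ * ⟪ψ k, y⟫_ℂ) ⟪x, ρ.op y⟫_ℂ := by
  have h0 : 0 ≤ ρ.op := (ContinuousLinearMap.nonneg_iff_isPositive _).2 ρ.isPositive
  set s := CFC.sqrt ρ.op with hs
  have hsa : ContinuousLinearMap.adjoint s = s :=
    ((ContinuousLinearMap.nonneg_iff_isPositive _).1 (CFC.sqrt_nonneg ρ.op)).isSelfAdjoint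
  have hss : ∀ x, s (s x) = ρ.op x := fun x => by
    rw [← mul_apply_eq_comp, hs, CFC.sqrt_mul_sqrt_self ρ.op h0]
  have hin : ∀ x y, ⟪s x, y⟫_ℂ = ⟪x, s y⟫_ℂ := fun x y => by
    conv_lhs => rw [← hsa]
    exact ContinuousLinearMap.adjoint_inner_left s y x
  refine ⟨fun k => s (stdBasis H k), ?_, fun x y => ?_⟩
  · have := ρ.summable_diag.mapL Complex.reCLM
    refine this.congr fun k => ?_
    rw [Complex.reCLM_apply, ← hss, ← hin, inner_self_eq_norm_sq_to_K]
    norm_cast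
  · have := (stdBasis H).hasSum_inner_mul_inner (s x) (s y)
    rw [hin, hss] at this
    simpa only [hin] using this

theorem POVM.map_empty {X : Type*} [MeasurableSpace X] (M : POVM X H) (ψ : H) :
    ⟪ψ, M.toFun ∅ ψ⟫_ℂ = 0 := by
  have h := M.hasSum_iUnion (fun _ => ∅) (fun _ => .empty) (fun i j _ => by simp [Function.onFun]) ψ
  exact (summable_const_iff _).1 h.summable

/-- Born's rule: the law `B ↦ Tr (ρ M(B))` of the outcome of the measurement `M` in the
state `ρ`. -/
def outcomeMeasure {X : Type*} [MeasurableSpace X] (ρ : DensityOperator H) (M : POVM X H) :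
    Measure X :=
  Measure.ofMeasurable (fun B _ => ENNReal.ofReal (trace (ρ.op * M.toFun B)).re)
    (by
      obtain ⟨ψ, h1, h2⟩ := ρ.exists_decomposition
      have h := (hasSum_trace_mul ρ.op ψ h1 h2 (M.toFun ∅)).1
      simp only [M.map_empty] at h
      rw [h.unique hasSum_zero]
      simp)
    (by
      intro B hB hd
      obtain ⟨ψ, h1, h2⟩ := ρ.exists_decomposition
      have key : ∀ C, MeasurableSet C → ENNReal.ofReal (trace (ρ.op * M.toFun C)).re =
          ∑' k, ENNReal.ofReal (⟪ψ k, M.toFun C (ψ k)⟫_ℂ).re := by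
        intro C hC
        have h := ((hasSum_trace_mul ρ.op ψ h1 h2 (M.toFun C)).1).mapL Complex.reCLM
        simp only [Complex.reCLM_apply] at h
        rw [← h.tsum_eq, ENNReal.ofReal_tsum_of_nonneg (fun k => ?_) h.summable]
        exact (M.isPositive C hC).re_inner_nonneg_right (ψ k)
      rw [key _ (.iUnion hB)]
      simp only [key _ (hB _)]
      rw [ENNReal.tsum_comm]
      congr 1 with k
      have h := (M.hasSum_iUnion B hB hd (ψ k)).mapL Complex.reCLM
      simp only [Complex.reCLM_apply] at h
      rw [← h.tsum_eq, ENNReal.ofReal_tsum_of_nonneg (fun i => ?_) h.summable]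
      exact (M.isPositive _ (hB i)).re_inner_nonneg_right (ψ k))

variable {d : ℕ}

/-- The risk `R_M(u, û) = ⟨‖û - u‖²⟩` of the measurement-estimator pair `(M, û)` in the state
`ρ`, when the true parameter is `u`. -/
def risk {X : Type*} [MeasurableSpace X] (ρ : DensityOperator H) (M : POVM X H)
    (est : X → EuclideanSpace ℝ (Fin d)) (u : EuclideanSpace ℝ (Fin d)) : ℝ≥0∞ :=
  ∫⁻ x, ENNReal.ofReal (‖est x - u‖ ^ 2) ∂(outcomeMeasure ρ M)

/-- The worst-case risk of `(M, û)` over the parameter set `K` for the model `u ↦ ρ u`. -/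
def worstCaseRisk {X : Type*} [MeasurableSpace X]
    (ρ : EuclideanSpace ℝ (Fin d) → DensityOperator H) (K : Set (EuclideanSpace ℝ (Fin d)))
    (M : POVM X H) (est : X → EuclideanSpace ℝ (Fin d)) : ℝ≥0∞ :=
  ⨆ u ∈ K, risk (ρ u) M est u

/-- The minimax risk of the model `{ρ u : u ∈ K}`: the infimum of the worst-case risk over all
measurements, with arbitrary outcome spaces, and all estimators. -/
def minimaxRisk (ρ : EuclideanSpace ℝ (Fin d) → DensityOperator H)
    (K : Set (EuclideanSpace ℝ (Fin d))) : ℝ≥0∞ :=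
  ⨅ (X : Type) (_ : MeasurableSpace X) (M : POVM X H) (est : X → EuclideanSpace ℝ (Fin d))
    (_ : Measurable est), worstCaseRisk ρ K M est

/-- The trace norm `Tr |A|` of a complex matrix, the sum of its singular values. -/
def traceNorm (A : Matrix (Fin d) (Fin d) ℂ) : ℝ :=
  ∑ i, √((Matrix.isHermitian_conjTranspose_mul_self A).eigenvalues i)

/-- Tuples of observables that are locally unbiased at `θ` (and centred): `Tr (ρ(θ) Xᵢ) = 0` and
`∂ⱼ Tr (ρ(θ) Xᵢ) = δᵢⱼ`. -/
structure IsLocallyUnbiased (ρ : EuclideanSpace ℝ (Fin d) → DensityOperator H)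
    (θ : EuclideanSpace ℝ (Fin d)) (X : Fin d → H →L[ℂ] H) : Prop where
  isSelfAdjoint : ∀ i, IsSelfAdjoint (X i)
  centred : ∀ i, trace ((ρ θ).op * X i) = 0
  deriv : ∀ i j, HasDerivAt
    (fun t : ℝ => trace ((ρ (θ + t • EuclideanSpace.single j (1 : ℝ))).op * X i))
    (if i = j then 1 else 0) 0

/-- The matrix `Z(X)ᵢⱼ = Tr (ρ Xᵢ Xⱼ)`. -/
def covMatrix (ρ : DensityOperator H) (X : Fin d → H →L[ℂ] H) : Matrix (Fin d) (Fin d) ℂ :=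
  Matrix.of fun i j => trace (ρ.op * (X i * X j))

/-- The Holevo bound of the model `ρ` at `θ` for the identity weight matrix: the infimum of
`Tr Re Z(X) + Tr |Im Z(X)|` over the locally unbiased tuples `X`. The `Xᵢ` range over
the bounded observables; they are dense in the square-summable ones for the seminorm
`X ↦ (Tr (ρ X²))^{1/2}`, in which the objective is continuous, so that for models with
square-summable scores this is the same infimum. -/
def holevoBound (ρ : EuclideanSpace ℝ (Fin d) → DensityOperator H)
    (θ : EuclideanSpace ℝ (Fin d)) : ℝ≥0∞ :=
  ⨅ (X : Fin d → H →L[ℂ] H) (_ : IsLocallyUnbiased ρ θ X),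
    ENNReal.ofReal ((∑ i, (covMatrix (ρ θ) X i i).re) +
      traceNorm ((covMatrix (ρ θ) X).map fun z => (z.im : ℂ)))

end Abstract

/-- The Hilbert space `L²(ℝ)` of the quantum oscillator. -/
abbrev L2 : Type := Lp ℂ 2 (volume : Measure ℝ)

/-- The phase factor `x ↦ exp (i (p x - p q / 2))`. -/
def weylPhase (q p : ℝ) (x : ℝ) : ℂ :=
  Complex.exp (((p * x - p * q / 2 : ℝ) : ℂ) * Complex.I)

theorem norm_weylPhase (q p x : ℝ) : ‖weylPhase q p x‖ = 1 :=
  Complex.norm_exp_ofReal_mul_I _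

theorem continuous_weylPhase (q p : ℝ) : Continuous (weylPhase q p) := by
  unfold weylPhase
  fun_prop

theorem memLp_weyl (q p : ℝ) (f : L2) :
    MemLp (fun x => weylPhase q p x * f (x - q)) 2 volume := by
  have h : MemLp (fun x => f (x - q)) 2 volume :=
    (Lp.memLp f).comp_measurePreserving (measurePreserving_sub_right volume q)
  refine h.of_le ?_ (Filter.Eventually.of_forall fun x => ?_)
  · exact (continuous_weylPhase q p).aestronglyMeasurable.mul h.1
  · rw [norm_mul, norm_weylPhase, one_mul]

/-- The Weyl operator `exp (i (p Q - q P))` of the Schrödinger representation, where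
`(Q f)(x) = x f(x)` and `P f = -i f'`:
`(exp (i (p Q - q P)) f)(x) = exp (i (p x - p q / 2)) f(x - q)`. -/
def weyl (q p : ℝ) : L2 →ₗᵢ[ℂ] L2 where
  toFun f := (memLp_weyl q p f).toLp _
  map_add' f g := by
    have h := (measurePreserving_sub_right volume q).quasiMeasurePreserving.ae (Lp.coeFn_add f g)
    ext1
    filter_upwards [(memLp_weyl q p (f + g)).coeFn_toLp, (memLp_weyl q p f).coeFn_toLp,
      (memLp_weyl q p g).coeFn_toLp, h, Lp.coeFn_add ((memLp_weyl q p f).toLp _)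
      ((memLp_weyl q p g).toLp _)] with x h1 h2 h3 h4 h5
    rw [h1, h5, Pi.add_apply, h2, h3, h4, Pi.add_apply, mul_add]
  map_smul' c f := by
    have h := (measurePreserving_sub_right volume q).quasiMeasurePreserving.ae (Lp.coeFn_smul c f)
    ext1
    filter_upwards [(memLp_weyl q p (c • f)).coeFn_toLp, (memLp_weyl q p f).coeFn_toLp, h,
      Lp.coeFn_smul c ((memLp_weyl q p f).toLp _)] with x h1 h2 h4 h5
    rw [h1, RingHom.id_apply, h5, Pi.smul_apply, h2, h4, Pi.smul_apply, smul_eq_mul, smul_eq_mul]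
    ring
  norm_map' f := by
    change ‖(memLp_weyl q p f).toLp _‖ = ‖f‖
    rw [Lp.norm_toLp, Lp.norm_def]
    congr 1
    rw [← eLpNorm_comp_measurePreserving (Lp.aestronglyMeasurable f)
      (measurePreserving_sub_right volume q)]
    refine eLpNorm_congr_norm_ae (Filter.Eventually.of_forall fun x => ?_)
    rw [norm_mul, norm_weylPhase, one_mul, Function.comp_apply]

/-- The displacement operator `D(z) = exp (z a* - z̄ a)`, where `a = (Q + i P) / √2`: since
`z a* - z̄ a = i (√2 Im z Q - √2 Re z P)`, it is a Weyl operator. -/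
def displacement (z : ℂ) : L2 →L[ℂ] L2 :=
  (weyl (√2 * z.re) (√2 * z.im)).toContinuousLinearMap

theorem norm_displacement (z : ℂ) (f : L2) : ‖displacement z f‖ = ‖f‖ :=
  (weyl (√2 * z.re) (√2 * z.im)).norm_map f

/-- The Hermite function `ψₙ(x) = Hₙ(x) exp(-x²/2) / √(√π 2ⁿ n!)`. Here `Hₙ` is the physicists'
Hermite polynomial, `Hₙ(x) = 2^{n/2} Heₙ(√2 x)`, and `Heₙ` is Mathlib's `Polynomial.hermite n`. -/
def hermiteFun (n : ℕ) (x : ℝ) : ℝ :=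
  Polynomial.aeval (√2 * x) (Polynomial.hermite n) * Real.exp (-x ^ 2 / 2) /
    √(√Real.pi * n.factorial)

theorem integrable_aeval_mul_gaussian (P : Polynomial ℤ) :
    Integrable fun y : ℝ => Polynomial.aeval y P * Real.exp (-y ^ 2 / 2) := by
  have key : ∀ n : ℕ, Integrable fun y : ℝ => y ^ n * Real.exp (-y ^ 2 / 2) := by
    intro n
    have := integrable_rpow_mul_exp_neg_mul_sq (b := 1 / 2) (by norm_num) (s := n)
      (by have : (0 : ℝ) ≤ n := n.cast_nonneg
          linarith)
    refine this.congr (Filter.Eventually.of_forall fun y => ?_)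
    simp only [Real.rpow_natCast]
    congr 2
    ring
  simp only [Polynomial.aeval_eq_sum_range, Finset.sum_mul]
  refine integrable_finsetSum _ fun i _ => ?_
  simpa only [zsmul_eq_mul, mul_assoc] using (key i).const_mul ((P.coeff i : ℤ) : ℝ)

theorem integral_aeval_mul_hermite_succ (P : Polynomial ℤ) (n : ℕ) :
    ∫ y : ℝ, Polynomial.aeval y (P * Polynomial.hermite (n + 1)) * Real.exp (-y ^ 2 / 2) =
      ∫ y : ℝ, Polynomial.aeval y (Polynomial.derivative P * Polynomial.hermite n) *
        Real.exp (-y ^ 2 / 2) := by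
  have hv : ∀ y : ℝ, HasDerivAt
      (fun y : ℝ => Polynomial.aeval y (Polynomial.hermite n) * Real.exp (-y ^ 2 / 2))
      (-(Polynomial.aeval y (Polynomial.hermite (n + 1)) * Real.exp (-y ^ 2 / 2))) y := by
    intro y
    have h1 := (Polynomial.hermite n).hasDerivAt_aeval y
    have h2 : HasDerivAt (fun y : ℝ => Real.exp (-y ^ 2 / 2)) (Real.exp (-y ^ 2 / 2) * (-y)) y := by
      refine HasDerivAt.exp ?_
      exact (((hasDerivAt_pow 2 y).fun_neg).div_const 2).congr_deriv (by simp; ring)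
    refine (h1.fun_mul h2).congr_deriv ?_
    rw [Polynomial.hermite_succ, map_sub, map_mul, Polynomial.aeval_X]
    ring
  have h := integral_mul_deriv_eq_deriv_mul_of_integrable
    (u := fun y : ℝ => Polynomial.aeval y P)
    (u' := fun y : ℝ => Polynomial.aeval y (Polynomial.derivative P))
    (fun y _ => P.hasDerivAt_aeval y) (fun y _ => hv y) ?_ ?_ ?_
  · have e1 : ∀ y : ℝ, Polynomial.aeval y (P * Polynomial.hermite (n + 1)) * Real.exp (-y ^ 2 / 2) =
        -(Polynomial.aeval y P *
          -(Polynomial.aeval y (Polynomial.hermite (n + 1)) * Real.exp (-y ^ 2 / 2))) := by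
      intro y; rw [map_mul]; ring
    simp only [e1]
    rw [integral_neg, h, neg_neg]
    simp only [map_mul, mul_assoc]
  · refine ((integrable_aeval_mul_gaussian (P * Polynomial.hermite (n + 1))).neg).congr
      (Filter.Eventually.of_forall fun y => ?_)
    simp only [Pi.neg_apply, Pi.mul_apply, map_mul]
    ring
  · refine (integrable_aeval_mul_gaussian (Polynomial.derivative P * Polynomial.hermite n)).congr
      (Filter.Eventually.of_forall fun y => ?_)
    simp only [Pi.mul_apply, map_mul]
    ring
  · refine (integrable_aeval_mul_gaussian (P * Polynomial.hermite n)).congr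
      (Filter.Eventually.of_forall fun y => ?_)
    simp only [Pi.mul_apply, map_mul]
    ring

theorem integral_hermite_sq (n : ℕ) :
    ∫ y : ℝ, Polynomial.aeval y (Polynomial.hermite n * Polynomial.hermite n) *
      Real.exp (-y ^ 2 / 2) = n.factorial * √(2 * Real.pi) := by
  have h : ∀ (m : ℕ) (P : Polynomial ℤ),
      ∫ y : ℝ, Polynomial.aeval y (P * Polynomial.hermite m) * Real.exp (-y ^ 2 / 2) =
        ∫ y : ℝ, Polynomial.aeval y (Polynomial.derivative^[m] P) * Real.exp (-y ^ 2 / 2) := by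
    intro m
    induction m with
    | zero => intro P; simp
    | succ m ih =>
      intro P
      rw [integral_aeval_mul_hermite_succ, ih, Function.iterate_succ_apply]
  have hd : Polynomial.derivative^[n] (Polynomial.hermite n) = Polynomial.C (n.factorial : ℤ) := by
    have hdeg : (Polynomial.derivative^[n] (Polynomial.hermite n)).natDegree = 0 := by
      have := Polynomial.natDegree_iterate_derivative (Polynomial.hermite n) n
      rw [Polynomial.natDegree_hermite] at this
      omega
    rw [Polynomial.eq_C_of_natDegree_eq_zero hdeg, Polynomial.coeff_iterate_derivative]
    simp [Nat.descFactorial_self]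
  rw [h, hd]
  have hg := integral_gaussian (1 / 2)
  have e : ∀ y : ℝ, Real.exp (-y ^ 2 / 2) = Real.exp (-(1 / 2) * y ^ 2) := fun y => by
    congr 1; ring
  simp only [Polynomial.aeval_C, e]
  rw [integral_const_mul, hg]
  simp only [algebraMap_int_eq, eq_intCast, Int.cast_natCast]
  congr 2
  ring

theorem continuous_hermiteFun (n : ℕ) : Continuous (hermiteFun n) := by
  unfold hermiteFun
  have := (Polynomial.hermite n).continuous_aeval (A := ℝ)
  fun_prop

theorem hermiteFun_sq (n : ℕ) (x : ℝ) : hermiteFun n x ^ 2 =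
    (√Real.pi * n.factorial)⁻¹ *
      (Polynomial.aeval (√2 * x) (Polynomial.hermite n * Polynomial.hermite n) *
        Real.exp (-(√2 * x) ^ 2 / 2)) := by
  have e : Real.exp (-(√2 * x) ^ 2 / 2) = Real.exp (-x ^ 2 / 2) ^ 2 := by
    rw [← Real.exp_nat_mul]
    congr 1
    rw [mul_pow, Real.sq_sqrt (by norm_num)]
    push_cast
    ring
  rw [hermiteFun, e, div_pow, Real.sq_sqrt (by positivity), map_mul]
  ring

theorem integrable_hermiteFun_sq (n : ℕ) : Integrable fun x => hermiteFun n x ^ 2 := by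
  simp only [hermiteFun_sq]
  exact ((integrable_aeval_mul_gaussian _).comp_mul_left' (by positivity)).const_mul _

theorem integral_hermiteFun_sq (n : ℕ) : ∫ x, hermiteFun n x ^ 2 = 1 := by
  simp only [hermiteFun_sq]
  rw [integral_const_mul, Measure.integral_comp_mul_left
    (fun y : ℝ => Polynomial.aeval y (Polynomial.hermite n * Polynomial.hermite n) *
        Real.exp (-y ^ 2 / 2)), integral_hermite_sq, smul_eq_mul, abs_of_pos (by positivity),
    Real.sqrt_mul (by norm_num)]
  have : (n.factorial : ℝ) ≠ 0 := by positivity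
  have : √Real.pi ≠ 0 := by positivity
  field_simp

theorem memLp_hermiteFun (n : ℕ) : MemLp (fun x => (hermiteFun n x : ℂ)) 2 volume := by
  have hc : Continuous fun x => (hermiteFun n x : ℂ) :=
    Complex.continuous_ofReal.comp (continuous_hermiteFun n)
  rw [memLp_two_iff_integrable_sq_norm hc.aestronglyMeasurable]
  simpa using integrable_hermiteFun_sq n

/-- The number state `|n⟩`, the `n`-th eigenvector of the number operator `a* a`. -/
def numberState (n : ℕ) : L2 :=
  (memLp_hermiteFun n).toLp _

theorem norm_numberState (n : ℕ) : ‖numberState n‖ = 1 := by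
  have h : ‖numberState n‖ ^ 2 = 1 := by
    have h2 : ⟪numberState n, numberState n⟫_ℂ = 1 := by
      rw [L2.inner_def, ← Complex.ofReal_one, ← integral_hermiteFun_sq n, ← integral_complex_ofReal]
      refine integral_congr_ae ?_
      filter_upwards [(memLp_hermiteFun n).coeFn_toLp] with x hx
      rw [numberState, hx]
      rw [inner_self_eq_norm_sq_to_K, Complex.norm_real, Real.norm_eq_abs]
      change ((|hermiteFun n x| : ℝ) : ℂ) ^ 2 = _
      rw [← Complex.ofReal_pow, sq_abs]
    rw [inner_self_eq_norm_sq_to_K] at h2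
    exact Complex.ofReal_injective (by simpa using h2)
  nlinarith [norm_nonneg (numberState n)]

/-- The weight `(1 - p) pᵏ`, `p = (1 - μ) / μ`, of the `k`-th level in the thermal state. -/
def thermalWeight (μ : ℝ) (k : ℕ) : ℝ :=
  (1 - (1 - μ) / μ) * ((1 - μ) / μ) ^ k

/-- The thermal equilibrium operator `φ⁰ = (1 - p) ∑ₖ pᵏ |k⟩⟨k|`, `p = (1 - μ) / μ`. -/
def thermalOp (μ : ℝ) : L2 →L[ℂ] L2 :=
  ∑' k, (thermalWeight μ k : ℂ) • InnerProductSpace.rankOne ℂ (numberState k) (numberState k)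

/-- The complex number `α_u = -u_y + i u_x`. -/
def alpha (u : EuclideanSpace ℝ (Fin 2)) : ℂ :=
  -(u 1 : ℂ) + Complex.I * (u 0 : ℂ)

/-- The displaced thermal operator `φᵘ = D(√(2μ-1) α_u) φ⁰ D(√(2μ-1) α_u)*`. -/
def gaussianOp (μ : ℝ) (u : EuclideanSpace ℝ (Fin 2)) : L2 →L[ℂ] L2 :=
  displacement (√(2 * μ - 1) * alpha u) * thermalOp μ *
    ContinuousLinearMap.adjoint (displacement (√(2 * μ - 1) * alpha u))

theorem thermalWeight_nonneg {μ : ℝ} (h1 : 1 / 2 < μ) (h2 : μ ≤ 1) (k : ℕ) :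
    0 ≤ thermalWeight μ k := by
  have hp : (1 - μ) / μ ≤ 1 := by rw [div_le_one (by linarith)]; linarith
  have hp0 : 0 ≤ (1 - μ) / μ := div_nonneg (by linarith) (by linarith)
  exact mul_nonneg (by linarith) (pow_nonneg hp0 k)

theorem hasSum_thermalWeight {μ : ℝ} (h1 : 1 / 2 < μ) (h2 : μ ≤ 1) :
    HasSum (thermalWeight μ) 1 := by
  have hp : (1 - μ) / μ < 1 := by rw [div_lt_one (by linarith)]; linarith
  have hp0 : 0 ≤ (1 - μ) / μ := div_nonneg (by linarith) (by linarith)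
  have h := (hasSum_geometric_of_lt_one hp0 hp).mul_left (1 - (1 - μ) / μ)
  rwa [mul_inv_cancel₀ (by linarith)] at h

/-- The vectors `√((1 - p) pᵏ) D(√(2μ-1) α_u) |k⟩`, whose projectors add up to `φᵘ`. -/
def gaussianVec (μ : ℝ) (u : EuclideanSpace ℝ (Fin 2)) (k : ℕ) : L2 :=
  (√(thermalWeight μ k) : ℂ) • displacement (√(2 * μ - 1) * alpha u) (numberState k)

theorem norm_sq_gaussianVec {μ : ℝ} (h1 : 1 / 2 < μ) (h2 : μ ≤ 1)
    (u : EuclideanSpace ℝ (Fin 2)) (k : ℕ) : ‖gaussianVec μ u k‖ ^ 2 = thermalWeight μ k := by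
  rw [gaussianVec, norm_smul, norm_displacement, norm_numberState, mul_one, Complex.norm_real,
    Real.norm_eq_abs, sq_abs, Real.sq_sqrt (thermalWeight_nonneg h1 h2 k)]

theorem hasSum_gaussianOp {μ : ℝ} (h1 : 1 / 2 < μ) (h2 : μ ≤ 1) (u : EuclideanSpace ℝ (Fin 2))
    (x y : L2) : HasSum (fun k => ⟪x, gaussianVec μ u k⟫_ℂ * ⟪gaussianVec μ u k, y⟫_ℂ)
      ⟪x, gaussianOp μ u y⟫_ℂ := by
  have hs : Summable fun k => (thermalWeight μ k : ℂ) •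
      InnerProductSpace.rankOne ℂ (numberState k) (numberState k) := by
    refine Summable.of_norm_bounded (hasSum_thermalWeight h1 h2).summable fun k => ?_
    rw [norm_smul, InnerProductSpace.norm_rankOne, norm_numberState, Complex.norm_real,
      Real.norm_eq_abs, abs_of_nonneg (thermalWeight_nonneg h1 h2 k)]
    simp
  set D := displacement (√(2 * μ - 1) * alpha u) with hD
  have h3 := (hs.hasSum.mapL (ContinuousLinearMap.apply ℂ L2 (ContinuousLinearMap.adjoint D y))).mapL
    (innerSL ℂ (ContinuousLinearMap.adjoint D x))
  have e : ⟪x, gaussianOp μ u y⟫_ℂ = (innerSL ℂ (ContinuousLinearMap.adjoint D x))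
      ((ContinuousLinearMap.apply ℂ L2 (ContinuousLinearMap.adjoint D y)) (thermalOp μ)) := by
    simp [gaussianOp, ContinuousLinearMap.adjoint_inner_left, hD]
  rw [e]
  refine h3.congr_fun ?_
  intro k
  have hw : (√(thermalWeight μ k) : ℂ) * √(thermalWeight μ k) = thermalWeight μ k := by
    exact_mod_cast Real.mul_self_sqrt (thermalWeight_nonneg h1 h2 k)
  simp only [gaussianVec, inner_smul_left, inner_smul_right, Complex.conj_ofReal,
    ContinuousLinearMap.apply_apply, innerSL_apply_apply, smul_apply,
    InnerProductSpace.rankOne_apply, ContinuousLinearMap.adjoint_inner_left,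
    ContinuousLinearMap.adjoint_inner_right, ← hD, ← hw]
  ring

theorem gaussianOp_isPositive {μ : ℝ} (h1 : 1 / 2 < μ) (h2 : μ ≤ 1)
    (u : EuclideanSpace ℝ (Fin 2)) : (gaussianOp μ u).IsPositive := by
  rw [← ContinuousLinearMap.isPositive_toLinearMap_iff, LinearMap.isPositive_iff_complex]
  intro x
  have h := hasSum_gaussianOp h1 h2 u x x
  have e : ∀ k, ⟪x, gaussianVec μ u k⟫_ℂ * ⟪gaussianVec μ u k, x⟫_ℂ =
      ((‖⟪gaussianVec μ u k, x⟫_ℂ‖ ^ 2 : ℝ) : ℂ) := fun k => by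
    rw [← inner_conj_symm x, ← Complex.normSq_eq_conj_mul_self, Complex.normSq_eq_norm_sq]
  simp only [e] at h
  obtain ⟨r, hr⟩ : ∃ r : ℝ, HasSum (fun k => ‖⟪gaussianVec μ u k, x⟫_ℂ‖ ^ 2) r :=
    ⟨_, (Complex.summable_ofReal.1 h.summable).hasSum⟩
  have h3 := h.unique (Complex.hasSum_ofReal.2 hr)
  have h4 : ⟪gaussianOp μ u x, x⟫_ℂ = r := by
    rw [← inner_conj_symm, h3, Complex.conj_ofReal]
  rw [ContinuousLinearMap.coe_coe, h4]
  exact ⟨by simp, by simpa using hr.nonneg fun k => by positivity⟩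

/-- The Gaussian shift model: the displaced thermal states `φᵘ`, `u ∈ ℝ²`. -/
def gaussianState (μ : ℝ) (h1 : 1 / 2 < μ) (h2 : μ ≤ 1) (u : EuclideanSpace ℝ (Fin 2)) :
    DensityOperator L2 where
  op := gaussianOp μ u
  isPositive := gaussianOp_isPositive h1 h2 u
  summable_diag := by
    have hs : Summable fun k => ‖gaussianVec μ u k‖ ^ 2 := by
      simpa only [norm_sq_gaussianVec h1 h2] using (hasSum_thermalWeight h1 h2).summable
    simpa using (hasSum_trace_mul _ _ hs (hasSum_gaussianOp h1 h2 u) 1).2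
  trace_eq_one := by
    have hs : Summable fun k => ‖gaussianVec μ u k‖ ^ 2 := by
      simpa only [norm_sq_gaussianVec h1 h2] using (hasSum_thermalWeight h1 h2).summable
    have h := (hasSum_trace_mul _ _ hs (hasSum_gaussianOp h1 h2 u) 1).1
    rw [mul_one] at h
    refine h.unique ?_
    simp only [one_apply_eq_self, inner_self_eq_norm_sq_to_K]
    have h' := Complex.hasSum_ofReal.2 (hasSum_thermalWeight h1 h2)
    rw [Complex.ofReal_one] at h'
    refine h'.congr_fun fun k => ?_
    rw [← norm_sq_gaussianVec h1 h2 u k]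
    simp

/-- The square `[-a, a]²`. -/
def square (a : ℝ) : Set (EuclideanSpace ℝ (Fin 2)) :=
  {u | ∀ i, u i ∈ Set.Icc (-a) a}

/-- The operator density
`h(u) = (2μ-1)/π · D(√(2μ-1) α_u) |0⟩⟨0| D(√(2μ-1) α_u)*` of the heterodyne measurement. -/
def heterodyneDensity (μ : ℝ) (u : EuclideanSpace ℝ (Fin 2)) : L2 →L[ℂ] L2 :=
  (((2 * μ - 1) / Real.pi : ℝ) : ℂ) •
    (displacement (√(2 * μ - 1) * alpha u) *
      InnerProductSpace.rankOne ℂ (numberState 0) (numberState 0) *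
      ContinuousLinearMap.adjoint (displacement (√(2 * μ - 1) * alpha u)))

/-- `M` is the heterodyne measurement `M(B) = ∫_B h(u) du`, the integral being a weak one. -/
def IsHeterodyne (μ : ℝ) (M : POVM (EuclideanSpace ℝ (Fin 2)) L2) : Prop :=
  ∀ B, MeasurableSet B → ∀ ψ : L2,
    IntegrableOn (fun u => ⟪ψ, heterodyneDensity μ u ψ⟫_ℂ) B ∧
      ⟪ψ, M.toFun B ψ⟫_ℂ = ∫ u in B, ⟪ψ, heterodyneDensity μ u ψ⟫_ℂ

end QStat

end

/-! Write p = `thermalRatio μ`, s = √(2μ-1), z = s α_u, and let φ be the state displaced by z, with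
a, a* the ladder operators displaced along with it. Every quantity in the theorem equals
`optimalRisk μ` = C = 1/(s²(1-p)).

Two facts drive both lower bounds. From φ a* = p a* φ, the function z ↦ Tr(φX) has differential ζ ↦
(1-p)(ζ Tr(φXa*) + ζ̄ Tr(φaX)) for bounded X (`exists_hasFDerivAt_thermalMean`). From Tr(φaa*) =
1/(1-p), Cauchy-Schwarz gives |Tr(φYa*)|² ≤ Tr(φYY*)/(1-p) (`norm_sq_creationMean_le`).

Holevo bound: with Y = X₀ + iX₁ the objective is max(Tr φYY*, Tr φY*Y) (`holevo_objective_eq`).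
Local unbiasedness fixes Tr(φYa*) = -i/(s(1-p)), so the objective is at least C. Equality would need
Y proportional to a, which is unbounded; truncations of a approach the value
(`holevoBound_eq_optimalRisk`).

Minimax lower bound: a measurement whose risk is at most r on [-a, a]², with a finitely valued
estimator, yields a bounded operator F = ∑ s α_v M_v with Tr φ(F-z)(F-z)* ≤ s²r
(`secondMoment_le_risk`). Hence G(z) = Tr(φF) is within s√r of z, and since Tr(φa*) = 0, |∂G/∂z| ≤
√(s²(1-p)r). No unbiasedness is available, but a function near the identity on a large square has
average z-derivative near 1 by Green's theorem (`one_le_of_norm_sub_id_le`). This gives 1 ≤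
√(s²(1-p)r) + √r/a, hence r ≥ C in the limit a → ∞. General estimators are clamped and rounded first
(`one_le_of_risk_le`).

Upper bound: Plancherel's theorem gives the coherent-state resolution of the identity
(`lintegral_coherent`), so heterodyne is a measurement. Its outcome in the state φᵘ is Gaussian with
mean u and total variance C, because |⟨k|D(z)|0⟩|² is a Poisson weight and the thermal weights are
geometric (`outcomeMeasure_heterodyne`, `risk_heterodyne`). -/

noncomputable section

namespace QStat

/-! ### Hermite functions: ladder relations, orthonormality and decay. -/

section Hermite

theorem derivative_hermite_succ (n : ℕ) :
    Polynomial.derivative (Polynomial.hermite (n + 1)) = (n + 1 : ℕ) • Polynomial.hermite n := by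
  induction n with
  | zero => simp
  | succ n ih =>
    rw [Polynomial.hermite_succ (n + 1), ih]
    simp only [Polynomial.derivative_sub, Polynomial.derivative_mul, Polynomial.derivative_X, ih,
      Polynomial.derivative_smul, one_mul]
    rw [Polynomial.hermite_succ n]
    simp only [nsmul_eq_mul]
    push_cast
    ring

/-- The normalisation `√(√π n!)` of the Hermite functions. -/
def hermiteNorm (n : ℕ) : ℝ := √(√Real.pi * n.factorial)

theorem hermiteNorm_pos (n : ℕ) : 0 < hermiteNorm n := by
  unfold hermiteNorm; positivity

theorem hermiteNorm_succ (n : ℕ) : hermiteNorm (n + 1) = √(n + 1) * hermiteNorm n := by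
  rw [hermiteNorm, hermiteNorm, ← Real.sqrt_mul (by positivity), Nat.factorial_succ]
  congr 1
  push_cast
  ring

theorem hermiteFun_eq (n : ℕ) (x : ℝ) : hermiteFun n x =
    Polynomial.aeval (√2 * x) (Polynomial.hermite n) * Real.exp (-x ^ 2 / 2) / hermiteNorm n :=
  rfl

/-- This is Heₙ' = n Heₙ₋₁ after normalisation. At n = 0 the truncated index `n - 1` is harmless
because its coefficient √0 vanishes; the same convention is used throughout. -/
theorem aeval_derivative_hermite (n : ℕ) (x : ℝ) :
    Polynomial.aeval (√2 * x) (Polynomial.derivative (Polynomial.hermite n)) *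
      Real.exp (-x ^ 2 / 2) / hermiteNorm n = √n * hermiteFun (n - 1) x := by
  cases n with
  | zero => simp
  | succ n =>
    rw [derivative_hermite_succ, hermiteNorm_succ]
    simp only [Nat.add_sub_cancel, hermiteFun_eq, nsmul_eq_mul]
    have := hermiteNorm_pos n
    have h : √((n : ℝ) + 1) ≠ 0 := by positivity
    have h2 : √((n : ℝ) + 1) ^ 2 = n + 1 := Real.sq_sqrt (by positivity)
    push_cast
    field_simp
    rw [h2]
    simp

/-- The three-term recurrence `√2 x ψₙ = √(n+1) ψₙ₊₁ + √n ψₙ₋₁`. -/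
theorem sqrt_two_mul_hermiteFun (n : ℕ) (x : ℝ) :
    √2 * x * hermiteFun n x = √(n + 1) * hermiteFun (n + 1) x + √n * hermiteFun (n - 1) x := by
  rw [← aeval_derivative_hermite, hermiteFun_eq, hermiteFun_eq, hermiteNorm_succ,
    Polynomial.hermite_succ]
  have := hermiteNorm_pos n
  have h : √((n : ℝ) + 1) ≠ 0 := by positivity
  simp only [map_sub, map_mul, Polynomial.aeval_X]
  field_simp
  ring

/-- The derivative of `√2 ψₙ` is `√n ψₙ₋₁ - √(n+1) ψₙ₊₁`. -/
theorem hasDerivAt_hermiteFun (n : ℕ) (x : ℝ) : HasDerivAt (hermiteFun n)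
    ((√n * hermiteFun (n - 1) x - √(n + 1) * hermiteFun (n + 1) x) / √2) x := by
  have h1 : HasDerivAt (fun x : ℝ => Polynomial.aeval (√2 * x) (Polynomial.hermite n))
      (Polynomial.aeval (√2 * x) (Polynomial.derivative (Polynomial.hermite n)) * √2) x := by
    refine HasDerivAt.comp x ((Polynomial.hermite n).hasDerivAt_aeval (√2 * x)) ?_
    simpa using (hasDerivAt_id x).const_mul √2
  have h2 : HasDerivAt (fun y : ℝ => Real.exp (-y ^ 2 / 2)) (Real.exp (-x ^ 2 / 2) * (-x)) x := by
    refine HasDerivAt.exp ?_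
    exact (((hasDerivAt_pow 2 x).fun_neg).div_const 2).congr_deriv (by simp; ring)
  refine ((h1.fun_mul h2).div_const (hermiteNorm n)).congr_deriv ?_
  have e1 := sqrt_two_mul_hermiteFun n x
  have e2 := aeval_derivative_hermite n x
  have e3 := hermiteFun_eq n x
  have := hermiteNorm_pos n
  have h4 : √2 ^ 2 = (2 : ℝ) := Real.sq_sqrt (by norm_num)
  have e4 : √(n + 1 : ℝ) * hermiteFun (n + 1) x =
    √2 * x * hermiteFun n x - √n * hermiteFun (n - 1) x := by linarith
  rw [e4, e3, ← e2, eq_div_iff (by positivity)]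
  field_simp
  linear_combination
    (Polynomial.aeval (√2 * x) (Polynomial.derivative (Polynomial.hermite n))) * h4

theorem inner_numberState_eq_integral (m n : ℕ) :
    ⟪numberState m, numberState n⟫_ℂ = ((∫ x, hermiteFun m x * hermiteFun n x : ℝ) : ℂ) := by
  rw [L2.inner_def, ← integral_complex_ofReal]
  refine integral_congr_ae ?_
  filter_upwards [(memLp_hermiteFun n).coeFn_toLp, (memLp_hermiteFun m).coeFn_toLp] with x h1 h2
  rw [numberState, numberState, h1, h2]
  simp [mul_comm]

/-- Integrating by parts n times moves n derivatives onto Heₘ, whose degree m is too small to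
survive. -/
theorem integral_hermite_mul_of_lt {m n : ℕ} (h : m < n) :
    ∫ y : ℝ, Polynomial.aeval y (Polynomial.hermite m * Polynomial.hermite n) *
      Real.exp (-y ^ 2 / 2) = 0 := by
  have key : ∀ (n : ℕ) (P : Polynomial ℤ),
      ∫ y : ℝ, Polynomial.aeval y (P * Polynomial.hermite n) * Real.exp (-y ^ 2 / 2) =
        ∫ y : ℝ, Polynomial.aeval y (Polynomial.derivative^[n] P) * Real.exp (-y ^ 2 / 2) := by
    intro n
    induction n with
    | zero => intro P; simp
    | succ n ih =>
      intro P
      rw [integral_aeval_mul_hermite_succ, ih, Function.iterate_succ_apply]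
  rw [key, Polynomial.iterate_derivative_eq_zero (by simpa using h)]
  simp

theorem orthonormal_numberState : Orthonormal ℂ numberState := by
  refine ⟨norm_numberState, ?_⟩
  have key : ∀ m n : ℕ, m < n → ⟪numberState m, numberState n⟫_ℂ = 0 := by
    intro m n h
    rw [inner_numberState_eq_integral]
    have e : ∀ x : ℝ, hermiteFun m x * hermiteFun n x = (hermiteNorm m * hermiteNorm n)⁻¹ *
        (Polynomial.aeval (√2 * x) (Polynomial.hermite m * Polynomial.hermite n) *
          Real.exp (-(√2 * x) ^ 2 / 2)) := by
      intro x
      have e : Real.exp (-(√2 * x) ^ 2 / 2) = Real.exp (-x ^ 2 / 2) ^ 2 := by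
        rw [← Real.exp_nat_mul]
        congr 1
        rw [mul_pow, Real.sq_sqrt (by norm_num)]
        push_cast
        ring
      rw [hermiteFun_eq, hermiteFun_eq, e, map_mul]
      have := hermiteNorm_pos n
      have := hermiteNorm_pos m
      field_simp
    simp only [e]
    rw [integral_const_mul, Measure.integral_comp_mul_left
      (fun y : ℝ => Polynomial.aeval y (Polynomial.hermite m * Polynomial.hermite n) *
        Real.exp (-y ^ 2 / 2)), integral_hermite_mul_of_lt h]
    simp
  intro m n h
  rcases lt_or_gt_of_ne h with h | h
  · exact key m n h
  · change ⟪numberState m, numberState n⟫_ℂ = 0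
    rw [← inner_conj_symm, key n m h, map_zero]

/-- Half of the Gaussian exponent absorbs any polynomial: |y|ⁿ ≤ n! exp |y| and |y| - y²/4 ≤ 1. The
other half is left for later use. -/
theorem exists_abs_aeval_mul_exp_le (P : Polynomial ℤ) :
    ∃ C : ℝ, ∀ y : ℝ, |Polynomial.aeval y P| * Real.exp (-y ^ 2 / 4) ≤ C := by
  induction P using Polynomial.induction_on' with
  | add P Q hP hQ =>
    obtain ⟨C, hC⟩ := hP
    obtain ⟨C', hC'⟩ := hQ
    refine ⟨C + C', fun y => ?_⟩
    rw [map_add]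
    nlinarith [hC y, hC' y, abs_add_le (Polynomial.aeval y P) (Polynomial.aeval y Q),
      Real.exp_pos (-y ^ 2 / 4)]
  | monomial n c =>
    refine ⟨|(c : ℝ)| * (n.factorial * Real.exp 1), fun y => ?_⟩
    have h := Real.pow_div_factorial_le_exp |y| (abs_nonneg y) n
    rw [div_le_iff₀ (by positivity)] at h
    rw [Polynomial.aeval_monomial, abs_mul, abs_pow, mul_assoc]
    simp only [algebraMap_int_eq, eq_intCast]
    refine mul_le_mul_of_nonneg_left ?_ (abs_nonneg _)
    calc |y| ^ n * Real.exp (-y ^ 2 / 4) ≤ Real.exp |y| * n.factorial * Real.exp (-y ^ 2 / 4) := by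
          gcongr
      _ = n.factorial * Real.exp (|y| + -y ^ 2 / 4) := by rw [Real.exp_add]; ring
      _ ≤ n.factorial * Real.exp 1 := by
          gcongr
          nlinarith [sq_nonneg (|y| - 2), sq_abs y]

/-- Cubic decay in `1 + x²`. -/
def DecaysFast (f : ℝ → ℝ) : Prop := ∃ C : ℝ, 0 ≤ C ∧ ∀ x, |f x| * (1 + x ^ 2) ^ 3 ≤ C

theorem DecaysFast.linearCombination {f g : ℝ → ℝ} (hf : DecaysFast f) (hg : DecaysFast g)
    (a b : ℝ) : DecaysFast fun x => a * f x + b * g x := by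
  obtain ⟨C, h0, hC⟩ := hf
  obtain ⟨C', h0', hC'⟩ := hg
  refine ⟨|a| * C + |b| * C', by positivity, fun x => ?_⟩
  calc |a * f x + b * g x| * (1 + x ^ 2) ^ 3
      ≤ (|a| * |f x| + |b| * |g x|) * (1 + x ^ 2) ^ 3 := by
        gcongr
        simpa only [abs_mul] using abs_add_le (a * f x) (b * g x)
    _ = |a| * (|f x| * (1 + x ^ 2) ^ 3) + |b| * (|g x| * (1 + x ^ 2) ^ 3) := by ring
    _ ≤ _ := by gcongr <;> [exact hC x; exact hC' x]

/-- At y = √2 x the factor exp(-y²/4) is the Gaussian of the Hermite function, so the preceding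
bound applies to Heₙ multiplied by (1 + y²)³. -/
theorem decaysFast_hermiteFun (n : ℕ) : DecaysFast (hermiteFun n) := by
  obtain ⟨C, hC⟩ := exists_abs_aeval_mul_exp_le
    (Polynomial.hermite n * (1 + Polynomial.X ^ 2) ^ 3)
  refine ⟨C / hermiteNorm n, ?_, fun x => ?_⟩
  · have := hermiteNorm_pos n
    exact div_nonneg ((by positivity : (0 : ℝ) ≤ _).trans (hC 0)) this.le
  · have h := hC (√2 * x)
    have e : (√2 * x) ^ 2 = 2 * x ^ 2 := by rw [mul_pow, Real.sq_sqrt (by norm_num)]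
    have hn := hermiteNorm_pos n
    rw [hermiteFun_eq, le_div_iff₀ hn, abs_div, abs_of_pos hn, div_mul_eq_mul_div,
      div_mul_cancel₀ _ hn.ne', abs_mul, Real.abs_exp]
    refine le_trans ?_ h
    simp only [map_mul, map_pow, map_add, map_one, Polynomial.aeval_X, abs_mul, e]
    rw [show -(2 * x ^ 2) / 4 = -x ^ 2 / 2 by ring, mul_right_comm]
    gcongr
    rw [abs_of_nonneg (by positivity)]
    gcongr
    nlinarith [sq_nonneg x]

/-- The derivative of the `n`-th Hermite function. -/
def hermiteFunDeriv (n : ℕ) (x : ℝ) : ℝ :=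
  (√n * hermiteFun (n - 1) x - √(n + 1) * hermiteFun (n + 1) x) / √2

theorem hermiteFunDeriv_eq (n : ℕ) (x : ℝ) : hermiteFunDeriv n x =
    (√n / √2) * hermiteFun (n - 1) x + (-(√(n + 1) / √2)) * hermiteFun (n + 1) x := by
  rw [hermiteFunDeriv]; ring

theorem decaysFast_hermiteFunDeriv (n : ℕ) : DecaysFast (hermiteFunDeriv n) := by
  simpa only [← hermiteFunDeriv_eq] using (decaysFast_hermiteFun (n - 1)).linearCombination
    (decaysFast_hermiteFun (n + 1)) (√n / √2) (-(√(n + 1) / √2))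

/-- The derivative is a combination of two Hermite functions, so one more differentiation stays in
the same class. The second derivative controls the Taylor remainder of a translate. -/
theorem exists_hasDerivAt_hermiteFunDeriv (n : ℕ) : ∃ g : ℝ → ℝ, DecaysFast g ∧
    ∀ x, HasDerivAt (hermiteFunDeriv n) (g x) x := by
  refine ⟨_, (decaysFast_hermiteFunDeriv (n - 1)).linearCombination
    (decaysFast_hermiteFunDeriv (n + 1)) (√n / √2) (-(√(n + 1) / √2)), fun x => ?_⟩
  have h := ((hasDerivAt_hermiteFun (n - 1) x).const_mul (√n / √2)).fun_add
    ((hasDerivAt_hermiteFun (n + 1) x).const_mul (-(√(n + 1) / √2)))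
  simp only [← hermiteFunDeriv_eq] at h
  exact h

end Hermite

/-! ### Pointwise second order expansion of Weyl translates. -/

section Taylor

/-- The bound has to hold for every θ, since the phase of a Weyl translate is unbounded in the
position variable. For |θ| > 1 the left side is at most 2|θ| ≤ 2θ². -/
theorem norm_exp_mul_I_sub_one_sub_le (θ : ℝ) :
    ‖Complex.exp (θ * Complex.I) - 1 - θ * Complex.I‖ ≤ 2 * θ ^ 2 := by
  have hn : ‖(θ * Complex.I : ℂ)‖ = |θ| := by simp
  rcases le_or_gt |θ| 1 with h | h
  · have := Complex.norm_exp_sub_one_sub_id_le (x := θ * Complex.I) (by rwa [hn])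
    rw [hn, sq_abs] at this
    nlinarith [sq_nonneg θ]
  · have h1 : ‖Complex.exp (θ * Complex.I) - 1‖ ≤ |θ| := by
      rw [mul_comm]; exact Real.norm_exp_I_mul_ofReal_sub_one_le
    have := norm_sub_le (Complex.exp (θ * Complex.I) - 1) (θ * Complex.I)
    rw [hn] at this
    nlinarith [sq_abs θ]

/-- Moving by at most one unit changes 1 + t² by a factor of at most 3, and 27 = 3³. Suprema over
short intervals are thus controlled by the decay at their centre. -/
theorem DecaysFast.exists_bound_near {f : ℝ → ℝ} (hf : DecaysFast f) :
    ∃ C : ℝ, 0 ≤ C ∧ ∀ t s, |s - t| ≤ 1 → |f s| ≤ C * ((1 + t ^ 2) ^ 3)⁻¹ := by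
  obtain ⟨C, h0, hC⟩ := hf
  refine ⟨27 * C, by positivity, fun t s hts => ?_⟩
  have h1 : 1 + t ^ 2 ≤ 3 * (1 + s ^ 2) := by
    have := sq_le_one_iff_abs_le_one _ |>.2 hts
    nlinarith [sq_nonneg (t - 2 * s), sq_nonneg (s + (s - t))]
  have h2 : (1 + t ^ 2) ^ 3 ≤ 27 * (1 + s ^ 2) ^ 3 := by
    calc (1 + t ^ 2) ^ 3 ≤ (3 * (1 + s ^ 2)) ^ 3 := by gcongr
      _ = _ := by ring
  rw [← div_eq_mul_inv, le_div_iff₀ (by positivity)]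
  calc |f s| * (1 + t ^ 2) ^ 3 ≤ |f s| * (27 * (1 + s ^ 2) ^ 3) := by gcongr
    _ = 27 * (|f s| * (1 + s ^ 2) ^ 3) := by ring
    _ ≤ _ := by gcongr; exact hC s

/-- The second order Taylor estimate of the Weyl translates of a rapidly decaying function. -/
theorem exists_weyl_taylor_bound {f f' f'' : ℝ → ℝ} (h0 : DecaysFast f) (h1 : DecaysFast f')
    (h2 : DecaysFast f'') (hf : ∀ x, HasDerivAt f (f' x) x) (hf' : ∀ x, HasDerivAt f' (f'' x) x) :
    ∃ C : ℝ, ∀ q p t : ℝ, |q| ≤ 1 →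
      ‖weylPhase q p t * f (t - q) - f t - (p * t * f t * Complex.I - q * f' t)‖ ≤
        C * (|q| + |p|) ^ 2 * (1 + t ^ 2)⁻¹ := by
  obtain ⟨C0, p0, hC0⟩ := h0.exists_bound_near
  obtain ⟨C1, p1, hC1⟩ := h1.exists_bound_near
  obtain ⟨C2, p2, hC2⟩ := h2.exists_bound_near
  -- The quadratic remainder of the phase contributes 4 C0, the discarded constant phase pq/2
  -- contributes C0, phase times increment contributes 2 C1, and the second difference of f
  -- contributes C2.
  refine ⟨5 * C0 + 2 * C1 + C2, fun q p t hq => ?_⟩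
  set G := ((1 + t ^ 2) ^ 3)⁻¹ with hG
  have hG0 : 0 ≤ G := by positivity
  have hconv : Convex ℝ (Metric.closedBall t |q|) := convex_closedBall t _
  have hmem : t - q ∈ Metric.closedBall t |q| := by simp
  have hmem' : t ∈ Metric.closedBall t |q| := by simp
  have hb : ∀ s ∈ Metric.closedBall t |q|, |s - t| ≤ 1 := fun s hs => by
    rw [Metric.mem_closedBall, Real.dist_eq] at hs
    exact hs.trans hq
  have e1 : |f (t - q) - f t| ≤ C1 * G * |q| := by
    have := hconv.norm_image_sub_le_of_norm_hasDerivWithin_le (C := C1 * G)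
      (fun s _ => (hf s).hasDerivWithinAt) (fun s hs => hC1 t s (hb s hs)) hmem' hmem
    simpa using this
  have e2 : |f (t - q) - f t + q * f' t| ≤ C2 * G * |q| * |q| := by
    -- The mean value inequality is used twice: for f minus its linear part at t, and inside for f'
    -- - f'(t).
    have := hconv.norm_image_sub_le_of_norm_hasDerivWithin_le (C := C2 * G * |q|)
      (f := fun s => f s - s * f' t) (f' := fun s => f' s - f' t)
      (fun s _ => ((hf s).fun_sub (by simpa using (hasDerivAt_id s).mul_const (f' t))).hasDerivWithinAt)
      (fun s hs => ?_) hmem' hmem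
    · have e : f (t - q) - (t - q) * f' t - (f t - t * f' t) = f (t - q) - f t + q * f' t := by ring
      rw [e] at this
      simpa using this
    · have := (convex_closedBall t |q|).norm_image_sub_le_of_norm_hasDerivWithin_le (C := C2 * G)
        (fun s _ => (hf' s).hasDerivWithinAt) (fun s hs => hC2 t s (hb s hs)) hmem' hs
      refine this.trans ?_
      rw [Metric.mem_closedBall, Real.dist_eq] at hs
      gcongr
      exact hs
  have e0 : |f (t - q)| ≤ C0 * G := hC0 t _ (by simpa using hq)
  have e0' : |f t| ≤ C0 * G := hC0 t _ (by simp)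
  set θ := p * t - p * q / 2 with hθ
  have hθb : |θ| ≤ |p| * (|t| + 1) := by
    rw [hθ, show p * t - p * q / 2 = p * (t - q / 2) by ring, abs_mul]
    gcongr
    refine (abs_sub _ _).trans ?_
    rw [abs_div, abs_two]
    linarith [abs_nonneg q]
  have hdec : weylPhase q p t * f (t - q) - f t - (p * t * f t * Complex.I - q * f' t) =
      (Complex.exp (θ * Complex.I) - 1 - θ * Complex.I) * f (t - q) +
      (θ * Complex.I) * ((f (t - q) - f t : ℝ) : ℂ) + ((f (t - q) - f t + q * f' t : ℝ) : ℂ) -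
      ((p * q / 2 * f t : ℝ) : ℂ) * Complex.I := by
    rw [weylPhase, hθ]; push_cast; ring
  have hT : (|t| + 1) ^ 2 ≤ 2 * (1 + t ^ 2) := by nlinarith [sq_nonneg (|t| - 1), sq_abs t]
  have hT1 : |t| + 1 ≤ 2 * (1 + t ^ 2) := by nlinarith [sq_nonneg (|t| - 1), sq_abs t, abs_nonneg t]
  have hθ2 : θ ^ 2 ≤ |p| ^ 2 * (2 * (1 + t ^ 2)) := by
    calc θ ^ 2 = |θ| ^ 2 := (sq_abs θ).symm
      _ ≤ (|p| * (|t| + 1)) ^ 2 := by gcongr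
      _ = |p| ^ 2 * (|t| + 1) ^ 2 := by ring
      _ ≤ _ := by gcongr
  -- The growth of θ² costs one factor 1 + t²; what is left of the decay is still square integrable.
  have hGle : (1 + t ^ 2) * G ≤ (1 + t ^ 2)⁻¹ := by
    rw [hG, ← div_eq_mul_inv, div_le_iff₀ (by positivity), inv_mul_eq_div, le_div_iff₀ (by positivity)]
    nlinarith [sq_nonneg t, sq_nonneg (t ^ 2), sq_nonneg (t ^ 3)]
  have hT0 : 1 ≤ 1 + t ^ 2 := by nlinarith [sq_nonneg t]
  set W := 1 + t ^ 2 with hW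
  calc ‖weylPhase q p t * f (t - q) - f t - (p * t * f t * Complex.I - q * f' t)‖
      ≤ (2 * θ ^ 2) * |f (t - q)| + |θ| * |f (t - q) - f t| + |f (t - q) - f t + q * f' t| +
        |p * q / 2 * f t| := by
        rw [hdec]
        refine (norm_sub_le _ _).trans (add_le_add ((norm_add_le _ _).trans (add_le_add
          ((norm_add_le _ _).trans (add_le_add ?_ ?_)) ?_)) ?_)
        · rw [norm_mul, Complex.norm_real]
          exact mul_le_mul_of_nonneg_right (norm_exp_mul_I_sub_one_sub_le θ) (norm_nonneg _)
        · rw [norm_mul, Complex.norm_real, norm_mul, Complex.norm_real, Complex.norm_I, mul_one]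
          rfl
        · rw [Complex.norm_real]; rfl
        · rw [norm_mul, Complex.norm_real, Complex.norm_I, mul_one]; rfl
    _ ≤ (2 * (|p| ^ 2 * (2 * W))) * (C0 * G) + (|p| * (2 * W)) * (C1 * G * |q|) +
        C2 * G * |q| * |q| + |p| * |q| * (C0 * G) := by
        have : |p * q / 2 * f t| ≤ |p| * |q| * (C0 * G) := by
          rw [abs_mul, abs_div, abs_mul, abs_two]
          have : |p| * |q| / 2 ≤ |p| * |q| := by
            have : 0 ≤ |p| * |q| := by positivity
            linarith
          gcongr
        gcongr
        exact hθb.trans (by gcongr)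
    _ ≤ (2 * (|p| ^ 2 * (2 * W))) * (C0 * G) + (|p| * (2 * W)) * (C1 * G * |q|) +
        C2 * (W * G) * |q| * |q| + |p| * |q| * (C0 * (W * G)) := by
        have : G ≤ W * G := by nlinarith
        gcongr
    _ = (4 * C0 * |p| ^ 2 + 2 * C1 * (|p| * |q|) + C2 * |q| ^ 2 + C0 * (|p| * |q|)) * (W * G) := by
        ring
    _ ≤ ((5 * C0 + 2 * C1 + C2) * (|q| + |p|) ^ 2) * (W * G) := by
        gcongr
        have a1 : |p| ^ 2 ≤ (|q| + |p|) ^ 2 := by gcongr; linarith [abs_nonneg q]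
        have a2 : |q| ^ 2 ≤ (|q| + |p|) ^ 2 := by gcongr; linarith [abs_nonneg p]
        have a3 : |p| * |q| ≤ (|q| + |p|) ^ 2 := by
          nlinarith [abs_nonneg q, abs_nonneg p, sq_nonneg (|q|), sq_nonneg |p|]
        have := mul_le_mul_of_nonneg_left a1 p0
        have := mul_le_mul_of_nonneg_left a3 p0
        have := mul_le_mul_of_nonneg_left a3 p1
        have := mul_le_mul_of_nonneg_left a2 p2
        linarith
    _ ≤ _ := by gcongr

end Taylor

/-! ### Weyl relations and differentiability of displaced number states. -/

section Displacement

theorem coeFn_weyl (q p : ℝ) (f : L2) :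
    weyl q p f =ᵐ[volume] fun x => weylPhase q p x * f (x - q) :=
  (memLp_weyl q p f).coeFn_toLp

theorem coeFn_numberState (n : ℕ) :
    numberState n =ᵐ[volume] fun x => (hermiteFun n x : ℂ) :=
  (memLp_hermiteFun n).coeFn_toLp

/-- The Weyl form of the canonical commutation relations: displacements compose up to a phase given
by half the symplectic form. -/
theorem weyl_weyl (q p q' p' : ℝ) (f : L2) : weyl q p (weyl q' p' f) =
    Complex.exp (((p * q' - p' * q) / 2 : ℝ) * Complex.I) • weyl (q + q') (p + p') f := by
  ext1
  have h := (measurePreserving_sub_right volume q).quasiMeasurePreserving.ae (coeFn_weyl q' p' f)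
  filter_upwards [coeFn_weyl q p (weyl q' p' f), h, coeFn_weyl (q + q') (p + p') f,
    Lp.coeFn_smul (Complex.exp (((p * q' - p' * q) / 2 : ℝ) * Complex.I))
      (weyl (q + q') (p + p') f)] with x h1 h2 h3 h4
  rw [h1, h2, h4, Pi.smul_apply, h3, smul_eq_mul, ← mul_assoc, ← mul_assoc, sub_sub]
  congr 1
  rw [weylPhase, weylPhase, weylPhase, ← Complex.exp_add, ← Complex.exp_add]
  congr 1
  push_cast
  ring

theorem weyl_zero (f : L2) : weyl 0 0 f = f := by
  ext1
  filter_upwards [coeFn_weyl 0 0 f] with x h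
  rw [h]
  simp [weylPhase]

theorem displacement_apply (z : ℂ) (f : L2) :
    displacement z f = weyl (√2 * z.re) (√2 * z.im) f := rfl

theorem displacement_zero (f : L2) : displacement 0 f = f := by
  simp [displacement_apply, weyl_zero]

theorem exists_phase_displacement_add (z w : ℂ) : ∃ c : ℂ, ‖c‖ = 1 ∧
    ∀ f, displacement (z + w) f = c • displacement z (displacement w f) := by
  set θ : ℝ := (√2 * z.im * (√2 * w.re) - √2 * w.im * (√2 * z.re)) / 2 with hθ
  refine ⟨Complex.exp ((-θ : ℝ) * Complex.I), Complex.norm_exp_ofReal_mul_I _, fun f => ?_⟩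
  simp only [displacement_apply, weyl_weyl, ← hθ, Complex.add_re, Complex.add_im, mul_add, smul_smul,
    ← Complex.exp_add]
  simp

theorem inner_displacement_displacement (z : ℂ) (f g : L2) :
    ⟪displacement z f, displacement z g⟫_ℂ = ⟪f, g⟫_ℂ :=
  (weyl (√2 * z.re) (√2 * z.im)).inner_map_map f g

/-- The composition phase cancels between the two sides of a sesquilinear form. Hence
differentiating an expectation at z reduces to differentiating at 0 with X conjugated by D(z). -/
theorem inner_displacement_add (z w : ℂ) (X : L2 →L[ℂ] L2) (f g : L2) :
    ⟪displacement (z + w) f, X (displacement (z + w) g)⟫_ℂ =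
      ⟪displacement w f, (ContinuousLinearMap.adjoint (displacement z) * X * displacement z)
        (displacement w g)⟫_ℂ := by
  obtain ⟨c, hc, h⟩ := exists_phase_displacement_add z w
  rw [h, h, map_smul, inner_smul_left, inner_smul_right, ← mul_assoc, ← Complex.normSq_eq_conj_mul_self,
    Complex.normSq_eq_norm_sq, hc]
  simp [ContinuousLinearMap.adjoint_inner_right]

/-- The derivative `ζ ↦ ζ a* |k⟩ - ζ̄ a |k⟩` of `z ↦ D(z) |k⟩` at the origin. -/
def ladderDeriv (k : ℕ) : ℂ →L[ℝ] L2 :=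
  (ContinuousLinearMap.id ℝ ℂ).smulRight ((√(k + 1) : ℂ) • numberState (k + 1)) -
    (Complex.conjCLE : ℂ →L[ℝ] ℂ).smulRight ((√k : ℂ) • numberState (k - 1))

theorem ladderDeriv_apply (k : ℕ) (ζ : ℂ) : ladderDeriv k ζ =
    (ζ * √(k + 1)) • numberState (k + 1) - (starRingEnd ℂ ζ * √k) • numberState (k - 1) := by
  change ζ • ((√(k + 1) : ℂ) • numberState (k + 1)) -
    starRingEnd ℂ ζ • ((√k : ℂ) • numberState (k - 1)) = _
  rw [smul_smul, smul_smul]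

/-- The dominating function that turns the pointwise Taylor bound into an L² bound. -/
theorem memLp_inv_one_add_sq : MemLp (fun t : ℝ => (1 + t ^ 2)⁻¹) 2 volume := by
  have hc : Continuous fun t : ℝ => (1 + t ^ 2)⁻¹ :=
    Continuous.inv₀ (by fun_prop) fun t => by positivity
  rw [memLp_two_iff_integrable_sq_norm hc.aestronglyMeasurable]
  refine integrable_inv_one_add_sq.mono' (by fun_prop) (Filter.Eventually.of_forall fun t => ?_)
  have h1 : (1 + t ^ 2)⁻¹ ≤ 1 := inv_le_one_of_one_le₀ (by nlinarith [sq_nonneg t])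
  have h0 : 0 ≤ (1 + t ^ 2)⁻¹ := by positivity
  rw [Real.norm_of_nonneg h0, Real.norm_of_nonneg (by positivity)]
  nlinarith

theorem exists_displacement_taylor_bound (k : ℕ) : ∃ C : ℝ, ∀ z : ℂ, ‖z‖ ≤ 1 / 2 →
    ‖displacement z (numberState k) - numberState k - ladderDeriv k z‖ ≤ C * ‖z‖ ^ 2 := by
  obtain ⟨g, hg, hg'⟩ := exists_hasDerivAt_hermiteFunDeriv k
  obtain ⟨C, hC⟩ := exists_weyl_taylor_bound (decaysFast_hermiteFun k)
    (decaysFast_hermiteFunDeriv k) hg (hasDerivAt_hermiteFun k) hg'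
  set G : Lp ℝ 2 (volume : Measure ℝ) := memLp_inv_one_add_sq.toLp _ with hG
  refine ⟨|C| * 8 * ‖G‖, fun z hz => ?_⟩
  have hs2 : √2 ≤ 2 := by rw [Real.sqrt_le_left (by norm_num)]; norm_num
  have hs20 : 0 ≤ √2 := by positivity
  have hq : |√2 * z.re| ≤ √2 * ‖z‖ := by
    rw [abs_mul, abs_of_nonneg hs20]; gcongr; exact Complex.abs_re_le_norm z
  have hp : |√2 * z.im| ≤ √2 * ‖z‖ := by
    rw [abs_mul, abs_of_nonneg hs20]; gcongr; exact Complex.abs_im_le_norm z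
  have hq1 : |√2 * z.re| ≤ 1 := hq.trans (by nlinarith [norm_nonneg z])
  have h8 : (|√2 * z.re| + |√2 * z.im|) ^ 2 ≤ 8 * ‖z‖ ^ 2 := by
    calc (|√2 * z.re| + |√2 * z.im|) ^ 2 ≤ (√2 * ‖z‖ + √2 * ‖z‖) ^ 2 := by gcongr
      _ = 4 * √2 ^ 2 * ‖z‖ ^ 2 := by ring
      _ = _ := by rw [Real.sq_sqrt (by norm_num)]; ring
  rw [mul_right_comm]
  refine Lp.norm_le_mul_norm_of_ae_le_mul (g := G) ?_
  rw [ladderDeriv_apply]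
  have hsh := (measurePreserving_sub_right volume (√2 * z.re)).quasiMeasurePreserving.ae
    (coeFn_numberState k)
  filter_upwards [Lp.coeFn_sub (displacement z (numberState k) - numberState k)
      ((z * √(k + 1)) • numberState (k + 1) - (starRingEnd ℂ z * √k) • numberState (k - 1)),
    Lp.coeFn_sub (displacement z (numberState k)) (numberState k),
    Lp.coeFn_sub ((z * √(k + 1)) • numberState (k + 1))
      ((starRingEnd ℂ z * √k) • numberState (k - 1)),
    Lp.coeFn_smul (z * √(k + 1)) (numberState (k + 1)),
    Lp.coeFn_smul (starRingEnd ℂ z * √k) (numberState (k - 1)),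
    coeFn_numberState k, coeFn_numberState (k + 1), coeFn_numberState (k - 1), hsh,
    coeFn_weyl (√2 * z.re) (√2 * z.im) (numberState k), memLp_inv_one_add_sq.coeFn_toLp]
    with t h1 h2 h3 h4 h5 h6 h7 h8' h9 h10 h11
  have hb := hC (√2 * z.re) (√2 * z.im) t hq1
  rw [h1, Pi.sub_apply, h2, Pi.sub_apply, h3, Pi.sub_apply, h4, h5, Pi.smul_apply, Pi.smul_apply,
    displacement_apply, h10, h9, h6, h7, h8', hG, h11, smul_eq_mul, smul_eq_mul,
    Real.norm_of_nonneg (by positivity : (0 : ℝ) ≤ (1 + t ^ 2)⁻¹)]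
  -- The generator i(√2 Im z Q - √2 Re z P) acts as z a* - z̄ a: the recurrence handles
  -- multiplication by t and the derivative formula handles P.
  have e : ((√2 * z.im : ℝ) * t * hermiteFun k t * Complex.I - (√2 * z.re : ℝ) *
      hermiteFunDeriv k t : ℂ) = z * √(k + 1) * hermiteFun (k + 1) t -
        starRingEnd ℂ z * √k * hermiteFun (k - 1) t := by
    have e1 : ((√2 * z.im : ℝ) * t * hermiteFun k t : ℂ) =
        z.im * ((√(k + 1) * hermiteFun (k + 1) t + √k * hermiteFun (k - 1) t : ℝ) : ℂ) := by
      rw [← sqrt_two_mul_hermiteFun]; push_cast; ring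
    have e2 : ((√2 * z.re : ℝ) * hermiteFunDeriv k t : ℂ) =
        z.re * ((√k * hermiteFun (k - 1) t - √(k + 1) * hermiteFun (k + 1) t : ℝ) : ℂ) := by
      have : √k * hermiteFun (k - 1) t - √(k + 1) * hermiteFun (k + 1) t =
          √2 * hermiteFunDeriv k t := by
        rw [hermiteFunDeriv]; field_simp
      rw [this]; push_cast; ring
    rw [e1, e2]
    have hz1 : z = z.re + z.im * Complex.I := (Complex.re_add_im z).symm
    have hz2 : starRingEnd ℂ z = z.re - z.im * Complex.I := by
      apply Complex.ext <;> simp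
    rw [hz2]
    nth_rw 3 [hz1]
    push_cast
    ring
  rw [← e]
  refine hb.trans ?_
  rw [mul_assoc |C|]
  gcongr
  exact le_abs_self C

theorem hasFDerivAt_displacement_zero (k : ℕ) :
    HasFDerivAt (fun z => displacement z (numberState k)) (ladderDeriv k) 0 := by
  obtain ⟨C, hC⟩ := exists_displacement_taylor_bound k
  have h1 : HasFDerivAt (fun z => displacement z (numberState k) - numberState k - ladderDeriv k z)
      (0 : ℂ →L[ℝ] L2) 0 := by
    refine Asymptotics.IsBigO.hasFDerivAt (n := 2) ?_ (by norm_num)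
    refine Asymptotics.IsBigO.of_bound C ?_
    filter_upwards [Metric.closedBall_mem_nhds (0 : ℂ) (by norm_num : (0 : ℝ) < 1 / 2)] with z hz
    simpa using hC z (by simpa using hz)
  have h2 := (h1.fun_add (ladderDeriv k).hasFDerivAt).fun_add (hasFDerivAt_const (numberState k) 0)
  simpa using h2

/-- Continuity at 0 is transported to every z by the group law. The phase is written out because its
continuity in w is needed, which the existential form in `exists_phase_displacement_add` does not
provide. -/
theorem continuous_displacement_numberState (k : ℕ) :
    Continuous fun z => displacement z (numberState k) := by
  have h0 : Filter.Tendsto (fun w => displacement w (numberState k)) (nhds 0)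
      (nhds (numberState k)) := by
    have := (hasFDerivAt_displacement_zero k).continuousAt.tendsto
    rwa [displacement_zero] at this
  have hw : ∀ z w : ℂ, displacement (z + w) (numberState k) =
      Complex.exp ((-((√2 * z.im * (√2 * w.re) - √2 * w.im * (√2 * z.re)) / 2) : ℝ) * Complex.I) •
        displacement z (displacement w (numberState k)) := by
    intro z w
    simp only [displacement_apply, weyl_weyl, Complex.add_re, Complex.add_im, mul_add, smul_smul,
      ← Complex.exp_add]
    simp
  refine continuous_iff_continuousAt.2 fun z => ?_
  have h1 : Filter.Tendsto (fun w : ℂ => displacement (z + w) (numberState k)) (nhds 0)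
      (nhds (displacement z (numberState k))) := by
    simp only [hw]
    have hc : Continuous fun w : ℂ => Complex.exp
        ((-((√2 * z.im * (√2 * w.re) - √2 * w.im * (√2 * z.re)) / 2) : ℝ) * Complex.I) := by
      fun_prop
    have := (hc.tendsto 0).smul (((displacement z).continuous.tendsto _).comp h0)
    simpa using this
  have h2 : Filter.Tendsto (fun w => w - z) (nhds z) (nhds 0) := by
    simpa using (continuous_id.sub continuous_const).tendsto (x := z) (f := fun w : ℂ => w - z)
  simpa [ContinuousAt, Function.comp_def] using h1.comp h2

end Displacement

/-! ### Expectations in displaced thermal states and their derivatives. -/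

section ThermalMean

/-- The ratio `p = (1 - μ) / μ` of consecutive thermal weights. -/
def thermalRatio (μ : ℝ) : ℝ := (1 - μ) / μ

theorem thermalRatio_nonneg {μ : ℝ} (h1 : 1 / 2 < μ) (h2 : μ ≤ 1) : 0 ≤ thermalRatio μ :=
  div_nonneg (by linarith) (by linarith)

theorem thermalRatio_lt_one {μ : ℝ} (h1 : 1 / 2 < μ) : thermalRatio μ < 1 := by
  rw [thermalRatio, div_lt_one (by linarith)]; linarith

theorem thermalWeight_succ (μ : ℝ) (k : ℕ) :
    thermalWeight μ (k + 1) = thermalRatio μ * thermalWeight μ k := by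
  rw [thermalWeight, thermalWeight, thermalRatio, pow_succ]; ring

/-- This is Tr(φ⁰ a a*), the second moment that enters every Cauchy-Schwarz estimate below. -/
theorem hasSum_thermalWeight_mul_succ {μ : ℝ} (h1 : 1 / 2 < μ) (h2 : μ ≤ 1) :
    HasSum (fun k : ℕ => thermalWeight μ k * (k + 1)) (1 - thermalRatio μ)⁻¹ := by
  have hp0 := thermalRatio_nonneg h1 h2
  have hp1 := thermalRatio_lt_one h1
  have hs := (hasSum_coe_mul_geometric_of_norm_lt_one (𝕜 := ℝ) (r := thermalRatio μ)
    (by rwa [Real.norm_of_nonneg hp0])).mul_left (1 - thermalRatio μ)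
  have e : (1 - thermalRatio μ) * (thermalRatio μ / (1 - thermalRatio μ) ^ 2) + 1 =
      (1 - thermalRatio μ)⁻¹ := by
    have : 1 - thermalRatio μ ≠ 0 := by linarith
    field_simp
    ring
  rw [← e]
  refine (hs.add (hasSum_thermalWeight h1 h2)).congr_fun fun k => ?_
  rw [thermalWeight, thermalRatio]
  ring

theorem hasSum_trace_gaussianOp {μ : ℝ} (h1 : 1 / 2 < μ) (h2 : μ ≤ 1)
    (u : EuclideanSpace ℝ (Fin 2)) (X : L2 →L[ℂ] L2) :
    HasSum (fun k => (thermalWeight μ k : ℂ) *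
      ⟪displacement (√(2 * μ - 1) * alpha u) (numberState k),
        X (displacement (√(2 * μ - 1) * alpha u) (numberState k))⟫_ℂ)
      (trace (gaussianOp μ u * X)) := by
  have hs : Summable fun k => ‖gaussianVec μ u k‖ ^ 2 := by
    simpa only [norm_sq_gaussianVec h1 h2] using (hasSum_thermalWeight h1 h2).summable
  refine (hasSum_trace_mul _ _ hs (hasSum_gaussianOp h1 h2 u) X).1.congr_fun fun k => ?_
  have hw : (√(thermalWeight μ k) : ℂ) * √(thermalWeight μ k) = thermalWeight μ k := by
    exact_mod_cast Real.mul_self_sqrt (thermalWeight_nonneg h1 h2 k)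
  rw [gaussianVec, map_smul, inner_smul_left, inner_smul_right, Complex.conj_ofReal, ← mul_assoc, hw]

/-- The expectation `Tr (D(z) φ⁰ D(z)* X)` of a bounded operator in a displaced thermal state. -/
def thermalMean (μ : ℝ) (X : L2 →L[ℂ] L2) (z : ℂ) : ℂ :=
  ∑' k, (thermalWeight μ k : ℂ) *
    ⟪displacement z (numberState k), X (displacement z (numberState k))⟫_ℂ

/-- The expectation `Tr (φ X a*)` for the displaced thermal state `φ` and the displaced creation
operator `a*`. -/
def creationMean (μ : ℝ) (X : L2 →L[ℂ] L2) (z : ℂ) : ℂ :=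
  ∑' k : ℕ, (thermalWeight μ k : ℂ) * √(k + 1) *
    ⟪displacement z (numberState k), X (displacement z (numberState (k + 1)))⟫_ℂ

/-- The expectation `Tr (φ a X)` for the displaced thermal state `φ` and the displaced annihilation
operator `a`. -/
def annihilationMean (μ : ℝ) (X : L2 →L[ℂ] L2) (z : ℂ) : ℂ :=
  ∑' k : ℕ, (thermalWeight μ k : ℂ) * √(k + 1) *
    ⟪displacement z (numberState (k + 1)), X (displacement z (numberState k))⟫_ℂ

theorem trace_gaussianOp_mul {μ : ℝ} (h1 : 1 / 2 < μ) (h2 : μ ≤ 1)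
    (u : EuclideanSpace ℝ (Fin 2)) (X : L2 →L[ℂ] L2) :
    trace (gaussianOp μ u * X) = thermalMean μ X (√(2 * μ - 1) * alpha u) :=
  (hasSum_trace_gaussianOp h1 h2 u X).tsum_eq.symm

theorem norm_inner_displacement_le (X : L2 →L[ℂ] L2) (z : ℂ) (j k : ℕ) :
    ‖⟪displacement z (numberState j), X (displacement z (numberState k))⟫_ℂ‖ ≤ ‖X‖ := by
  refine (norm_inner_le_norm _ _).trans ?_
  rw [norm_displacement, norm_numberState, one_mul]
  refine (X.le_opNorm _).trans ?_
  rw [norm_displacement, norm_numberState, mul_one]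

theorem sqrt_succ_le (k : ℕ) : √((k : ℝ) + 1) ≤ k + 1 := by
  have : (0 : ℝ) ≤ k := k.cast_nonneg
  rw [Real.sqrt_le_left (by positivity)]
  nlinarith

theorem norm_thermalWeight {μ : ℝ} (h1 : 1 / 2 < μ) (h2 : μ ≤ 1) (k : ℕ) :
    ‖(thermalWeight μ k : ℂ)‖ = thermalWeight μ k := by
  rw [Complex.norm_real, Real.norm_of_nonneg (thermalWeight_nonneg h1 h2 k)]

theorem summable_thermalWeight_mul {μ : ℝ} (h1 : 1 / 2 < μ) (h2 : μ ≤ 1) {c : ℕ → ℂ} {C : ℝ}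
    (hc : ∀ k, ‖c k‖ ≤ C) : Summable fun k => (thermalWeight μ k : ℂ) * c k := by
  refine Summable.of_norm_bounded ((hasSum_thermalWeight h1 h2).summable.mul_right C) fun k => ?_
  rw [norm_mul, norm_thermalWeight h1 h2]
  exact mul_le_mul_of_nonneg_left (hc k) (thermalWeight_nonneg h1 h2 k)

theorem summable_thermalWeight_mul_sqrt {μ : ℝ} (h1 : 1 / 2 < μ) (h2 : μ ≤ 1) {c : ℕ → ℂ} {C : ℝ}
    (hc : ∀ k, ‖c k‖ ≤ C) : Summable fun k : ℕ => (thermalWeight μ k : ℂ) * √(k + 1) * c k := by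
  refine Summable.of_norm_bounded ((hasSum_thermalWeight_mul_succ h1 h2).summable.mul_right C)
    fun k => ?_
  rw [norm_mul, norm_mul, norm_thermalWeight h1 h2, Complex.norm_real,
    Real.norm_of_nonneg (by positivity)]
  have := thermalWeight_nonneg h1 h2 k
  gcongr
  · exact sqrt_succ_le k
  · exact hc k

theorem hasSum_thermalMean {μ : ℝ} (h1 : 1 / 2 < μ) (h2 : μ ≤ 1) (X : L2 →L[ℂ] L2) (z : ℂ) :
    HasSum (fun k => (thermalWeight μ k : ℂ) *
      ⟪displacement z (numberState k), X (displacement z (numberState k))⟫_ℂ)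
      (thermalMean μ X z) :=
  (summable_thermalWeight_mul h1 h2 fun k => norm_inner_displacement_le X z k k).hasSum

theorem hasSum_creationMean {μ : ℝ} (h1 : 1 / 2 < μ) (h2 : μ ≤ 1) (X : L2 →L[ℂ] L2) (z : ℂ) :
    HasSum (fun k : ℕ => (thermalWeight μ k : ℂ) * √(k + 1) *
      ⟪displacement z (numberState k), X (displacement z (numberState (k + 1)))⟫_ℂ)
      (creationMean μ X z) :=
  (summable_thermalWeight_mul_sqrt h1 h2 fun k => norm_inner_displacement_le X z k (k + 1)).hasSum

theorem hasSum_annihilationMean {μ : ℝ} (h1 : 1 / 2 < μ) (h2 : μ ≤ 1) (X : L2 →L[ℂ] L2) (z : ℂ) :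
    HasSum (fun k : ℕ => (thermalWeight μ k : ℂ) * √(k + 1) *
      ⟪displacement z (numberState (k + 1)), X (displacement z (numberState k))⟫_ℂ)
      (annihilationMean μ X z) :=
  (summable_thermalWeight_mul_sqrt h1 h2 fun k => norm_inner_displacement_le X z (k + 1) k).hasSum

theorem hasSum_of_hasSum_succ {E : Type*} [NormedAddCommGroup E] {f : ℕ → E} {a : E} (h0 : f 0 = 0)
    (h : HasSum (fun k => f (k + 1)) a) : HasSum f a := by
  rw [← hasSum_nat_add_iff' 1]
  simpa [h0] using h

/-- The derivative of `⟨D(z) k, X D(z) k⟩` in the direction `ζ`, weighted by `c`. -/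
def levelDeriv (X : L2 →L[ℂ] L2) (z c : ℂ) (k : ℕ) : ℂ →L[ℝ] ℂ :=
  c • (fderivInnerCLM ℂ (numberState k,
    (ContinuousLinearMap.adjoint (displacement z) * X * displacement z) (numberState k))).comp
    ((ladderDeriv k).prod (((ContinuousLinearMap.adjoint (displacement z) * X *
      displacement z).restrictScalars ℝ).comp (ladderDeriv k)))

theorem levelDeriv_apply (X : L2 →L[ℂ] L2) (z c : ℂ) (k : ℕ) (ζ : ℂ) : levelDeriv X z c k ζ =
    c * (⟪displacement z (numberState k), X (displacement z (ladderDeriv k ζ))⟫_ℂ +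
      ⟪displacement z (ladderDeriv k ζ), X (displacement z (numberState k))⟫_ℂ) := by
  change c • (fderivInnerCLM ℂ _) (_, _) = _
  simp [fderivInnerCLM_apply, ContinuousLinearMap.adjoint_inner_right]

/-- `inner_displacement_add` recentres the map at the origin, where the derivative of the displaced
vector is `ladderDeriv`; the product rule for the inner product then applies. -/
theorem hasFDerivAt_level (X : L2 →L[ℂ] L2) (z c : ℂ) (k : ℕ) :
    HasFDerivAt (fun y => c * ⟪displacement y (numberState k),
      X (displacement y (numberState k))⟫_ℂ) (levelDeriv X z c k) z := by
  set Y := ContinuousLinearMap.adjoint (displacement z) * X * displacement z with hY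
  have h0 := hasFDerivAt_displacement_zero k
  have h1 : HasFDerivAt (fun w => Y (displacement w (numberState k)))
      ((Y.restrictScalars ℝ).comp (ladderDeriv k)) 0 :=
    (Y.restrictScalars ℝ).hasFDerivAt.comp 0 h0
  have h2 := (h0.inner ℂ h1).const_smul c
  rw [displacement_zero] at h2
  have h3 : HasFDerivAt (fun y : ℂ => y - z) (ContinuousLinearMap.id ℝ ℂ) z :=
    (hasFDerivAt_id z).sub_const z
  have h4 := HasFDerivAt.comp z (g := fun w => c • ⟪displacement w (numberState k),
    Y (displacement w (numberState k))⟫_ℂ) (by rw [sub_self]; exact h2) h3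
  rw [ContinuousLinearMap.comp_id] at h4
  refine h4.congr_of_eventuallyEq (Filter.Eventually.of_forall fun y => ?_)
  have := inner_displacement_add z (y - z) X (numberState k) (numberState k)
  rw [add_sub_cancel] at this
  simp only [Function.comp_apply, smul_eq_mul, this, hY]

theorem norm_ladderDeriv_apply_le (k : ℕ) (ζ : ℂ) : ‖ladderDeriv k ζ‖ ≤ 2 * (k + 1) * ‖ζ‖ := by
  rw [ladderDeriv_apply]
  refine (norm_sub_le _ _).trans ?_
  rw [norm_smul, norm_smul, norm_numberState, norm_numberState, norm_mul, norm_mul, Complex.norm_real,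
    Complex.norm_real, RCLike.norm_conj, Real.norm_of_nonneg (by positivity),
    Real.norm_of_nonneg (by positivity)]
  have h1 := sqrt_succ_le k
  have h2 : √(k : ℝ) ≤ √((k : ℝ) + 1) := Real.sqrt_le_sqrt (by linarith)
  nlinarith [norm_nonneg ζ]

/-- The bound is uniform in z and grows only linearly in k, so the geometric weights make the series
of derivatives normally convergent and allow termwise differentiation. -/
theorem norm_levelDeriv_le (X : L2 →L[ℂ] L2) (z c : ℂ) (k : ℕ) :
    ‖levelDeriv X z c k‖ ≤ ‖c‖ * (k + 1) * (4 * ‖X‖) := by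
  refine ContinuousLinearMap.opNorm_le_bound _ (by positivity) fun ζ => ?_
  rw [levelDeriv_apply, norm_mul]
  have hX : ∀ f, ‖X (displacement z f)‖ ≤ ‖X‖ * ‖f‖ := fun f => by
    simpa only [norm_displacement] using X.le_opNorm (displacement z f)
  have hL := norm_ladderDeriv_apply_le k ζ
  have e1 : ‖⟪displacement z (numberState k), X (displacement z (ladderDeriv k ζ))⟫_ℂ‖ ≤
      ‖X‖ * (2 * (k + 1) * ‖ζ‖) := by
    refine (norm_inner_le_norm _ _).trans ?_
    rw [norm_displacement, norm_numberState, one_mul]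
    exact (hX _).trans (by gcongr)
  have e2 : ‖⟪displacement z (ladderDeriv k ζ), X (displacement z (numberState k))⟫_ℂ‖ ≤
      ‖X‖ * (2 * (k + 1) * ‖ζ‖) := by
    refine (norm_inner_le_norm _ _).trans ?_
    rw [norm_displacement, mul_comm]
    have := hX (numberState k)
    rw [norm_numberState, mul_one] at this
    gcongr
  calc ‖c‖ * _ ≤ ‖c‖ * (‖X‖ * (2 * (k + 1) * ‖ζ‖) + ‖X‖ * (2 * (k + 1) * ‖ζ‖)) := by
        gcongr
        exact (norm_add_le _ _).trans (add_le_add e1 e2)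
    _ = _ := by ring

/-- The expectation `Tr (D(z) φ⁰ D(z)* X)` is differentiable in `z`, with derivative
`ζ ↦ Tr (φ [X, ζ a* - ζ̄ a])`, rewritten by the commutation `φ a* = p a* φ`. -/
theorem exists_hasFDerivAt_thermalMean {μ : ℝ} (h1 : 1 / 2 < μ) (h2 : μ ≤ 1) (X : L2 →L[ℂ] L2)
    (z : ℂ) : ∃ L : ℂ →L[ℝ] ℂ, HasFDerivAt (thermalMean μ X) L z ∧ ∀ ζ, L ζ =
      (1 - thermalRatio μ) *
        (ζ * creationMean μ X z + starRingEnd ℂ ζ * annihilationMean μ X z) := by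
  have hbd : Summable fun k : ℕ => thermalWeight μ k * (k + 1) * (4 * ‖X‖) :=
    (hasSum_thermalWeight_mul_succ h1 h2).summable.mul_right _
  have hle : ∀ (k : ℕ) (z : ℂ), ‖levelDeriv X z (thermalWeight μ k) k‖ ≤
      thermalWeight μ k * (k + 1) * (4 * ‖X‖) := fun k z => by
    simpa only [norm_thermalWeight h1 h2] using norm_levelDeriv_le X z (thermalWeight μ k) k
  refine ⟨∑' k, levelDeriv X z (thermalWeight μ k) k, ?_, fun ζ => ?_⟩
  · exact hasFDerivAt_tsum (x₀ := z) hbd (fun k y => hasFDerivAt_level X y (thermalWeight μ k) k) hle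
      (hasSum_thermalMean h1 h2 X z).summable z
  · have hs : Summable fun k => levelDeriv X z (thermalWeight μ k) k :=
      Summable.of_norm_bounded hbd fun k => hle k z
    have hL := hs.hasSum.mapL (ContinuousLinearMap.apply ℝ ℂ ζ)
    simp only [ContinuousLinearMap.apply_apply] at hL
    have hA := hasSum_creationMean h1 h2 X z
    have hB := hasSum_annihilationMean h1 h2 X z
    -- The shift k → k + 1 multiplies the weight by p; this is the relation φ a* = p a* φ at the
    -- level of series. The k = 0 term vanishes through √0.
    have hA' : HasSum (fun k : ℕ => (thermalWeight μ k : ℂ) * √k *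
        ⟪displacement z (numberState (k - 1)), X (displacement z (numberState k))⟫_ℂ)
        (thermalRatio μ * creationMean μ X z) := by
      refine hasSum_of_hasSum_succ (by simp) ((hA.mul_left _).congr_fun fun k => ?_)
      rw [thermalWeight_succ]
      push_cast
      ring
    have hB' : HasSum (fun k : ℕ => (thermalWeight μ k : ℂ) * √k *
        ⟪displacement z (numberState k), X (displacement z (numberState (k - 1)))⟫_ℂ)
        (thermalRatio μ * annihilationMean μ X z) := by
      refine hasSum_of_hasSum_succ (by simp) ((hB.mul_left _).congr_fun fun k => ?_)
      rw [thermalWeight_succ]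
      push_cast
      ring
    have hsum := ((hA.mul_left ζ).sub (hB'.mul_left (starRingEnd ℂ ζ))).add
      ((hB.mul_left (starRingEnd ℂ ζ)).sub (hA'.mul_left ζ))
    refine (hL.unique (hsum.congr_fun fun k => ?_)).trans ?_
    · rw [levelDeriv_apply, ladderDeriv_apply]
      simp only [map_sub, map_smul, inner_sub_left, inner_sub_right, inner_smul_left,
        inner_smul_right, map_mul, Complex.conj_conj, Complex.conj_ofReal]
      ring
    · ring

end ThermalMean

/-! ### Second moments and Cauchy-Schwarz inequalities. -/

section Variance

/-- The Cauchy-Schwarz inequality for series. -/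
theorem norm_sq_le_of_hasSum {ι : Type*} {c : ι → ℂ} {a b : ι → ℝ} {s : ℂ} {A B : ℝ}
    (hc : HasSum c s) (hab : ∀ k, ‖c k‖ ≤ a k * b k) (ha : HasSum (fun k => a k ^ 2) A)
    (hb : HasSum (fun k => b k ^ 2) B) : ‖s‖ ^ 2 ≤ A * B := by
  refine le_of_tendsto ((hc.norm).pow 2) (Filter.Eventually.of_forall fun F => ?_)
  have h1 : ‖∑ k ∈ F, c k‖ ≤ ∑ k ∈ F, a k * b k :=
    (norm_sum_le _ _).trans (Finset.sum_le_sum fun k _ => hab k)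
  calc ‖∑ k ∈ F, c k‖ ^ 2 ≤ (∑ k ∈ F, a k * b k) ^ 2 := by gcongr
    _ ≤ (∑ k ∈ F, a k ^ 2) * ∑ k ∈ F, b k ^ 2 := Finset.sum_mul_sq_le_sq_mul_sq F a b
    _ ≤ A * B := by
      gcongr
      · exact ha.nonneg fun k => sq_nonneg _
      · exact sum_le_hasSum F (fun k _ => sq_nonneg _) ha
      · exact sum_le_hasSum F (fun k _ => sq_nonneg _) hb

variable {μ : ℝ}

theorem thermalMean_add (h1 : 1 / 2 < μ) (h2 : μ ≤ 1) (X Y : L2 →L[ℂ] L2) (z : ℂ) :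
    thermalMean μ (X + Y) z = thermalMean μ X z + thermalMean μ Y z := by
  refine (hasSum_thermalMean h1 h2 (X + Y) z).unique (((hasSum_thermalMean h1 h2 X z).add
    (hasSum_thermalMean h1 h2 Y z)).congr_fun fun k => ?_)
  rw [add_apply, inner_add_right, mul_add]

theorem thermalMean_smul (h1 : 1 / 2 < μ) (h2 : μ ≤ 1) (c : ℂ) (X : L2 →L[ℂ] L2) (z : ℂ) :
    thermalMean μ (c • X) z = c * thermalMean μ X z := by
  refine (hasSum_thermalMean h1 h2 (c • X) z).unique (((hasSum_thermalMean h1 h2 X z).mul_left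
    c).congr_fun fun k => ?_)
  rw [smul_apply, inner_smul_right]
  ring

theorem thermalMean_one (h1 : 1 / 2 < μ) (h2 : μ ≤ 1) (z : ℂ) : thermalMean μ 1 z = 1 := by
  have h := Complex.hasSum_ofReal.2 (hasSum_thermalWeight h1 h2)
  rw [Complex.ofReal_one] at h
  refine (hasSum_thermalMean h1 h2 1 z).unique (h.congr_fun fun k => ?_)
  rw [one_apply_eq_self, inner_self_eq_norm_sq_to_K, norm_displacement, norm_numberState]
  simp

theorem creationMean_add (h1 : 1 / 2 < μ) (h2 : μ ≤ 1) (X Y : L2 →L[ℂ] L2) (z : ℂ) :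
    creationMean μ (X + Y) z = creationMean μ X z + creationMean μ Y z := by
  refine (hasSum_creationMean h1 h2 (X + Y) z).unique (((hasSum_creationMean h1 h2 X z).add
    (hasSum_creationMean h1 h2 Y z)).congr_fun fun k => ?_)
  rw [add_apply, inner_add_right, mul_add]

theorem creationMean_smul (h1 : 1 / 2 < μ) (h2 : μ ≤ 1) (c : ℂ) (X : L2 →L[ℂ] L2) (z : ℂ) :
    creationMean μ (c • X) z = c * creationMean μ X z := by
  refine (hasSum_creationMean h1 h2 (c • X) z).unique (((hasSum_creationMean h1 h2 X z).mul_left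
    c).congr_fun fun k => ?_)
  rw [smul_apply, inner_smul_right]
  ring

/-- Tr(φa*) = 0 because neighbouring levels are orthogonal. Scalars can therefore be subtracted from
an operator without changing its creation mean. -/
theorem creationMean_one (z : ℂ) : creationMean μ 1 z = 0 := by
  rw [creationMean]
  convert tsum_zero with k
  rw [one_apply_eq_self, inner_displacement_displacement,
    orthonormal_numberState.2 (by simp), mul_zero]

theorem thermalMean_adjoint (X : L2 →L[ℂ] L2) (z : ℂ) :
    thermalMean μ (ContinuousLinearMap.adjoint X) z = starRingEnd ℂ (thermalMean μ X z) := by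
  rw [thermalMean, thermalMean, Complex.conj_tsum]
  refine tsum_congr fun k => ?_
  rw [map_mul, Complex.conj_ofReal, inner_conj_symm, ContinuousLinearMap.adjoint_inner_right]

theorem annihilationMean_eq_conj (X : L2 →L[ℂ] L2) (z : ℂ) :
    annihilationMean μ X z =
      starRingEnd ℂ (creationMean μ (ContinuousLinearMap.adjoint X) z) := by
  rw [annihilationMean, creationMean, Complex.conj_tsum]
  refine tsum_congr fun k => ?_
  rw [map_mul, map_mul, Complex.conj_ofReal, Complex.conj_ofReal, inner_conj_symm,
    ContinuousLinearMap.adjoint_inner_left]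

/-- The second moment `Tr (φ Y Y*)` in a displaced thermal state `φ`. -/
def secondMoment (μ : ℝ) (Y : L2 →L[ℂ] L2) (z : ℂ) : ℝ :=
  ∑' k, thermalWeight μ k *
    ‖ContinuousLinearMap.adjoint Y (displacement z (numberState k))‖ ^ 2

theorem hasSum_secondMoment (h1 : 1 / 2 < μ) (h2 : μ ≤ 1) (Y : L2 →L[ℂ] L2) (z : ℂ) :
    HasSum (fun k => thermalWeight μ k *
      ‖ContinuousLinearMap.adjoint Y (displacement z (numberState k))‖ ^ 2)
      (secondMoment μ Y z) := by
  refine Summable.hasSum (Summable.of_nonneg_of_le (fun k => ?_) (fun k => ?_)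
    ((hasSum_thermalWeight h1 h2).summable.mul_right (‖ContinuousLinearMap.adjoint Y‖ ^ 2)))
  · exact mul_nonneg (thermalWeight_nonneg h1 h2 k) (sq_nonneg _)
  · refine mul_le_mul_of_nonneg_left ?_ (thermalWeight_nonneg h1 h2 k)
    gcongr
    simpa [norm_displacement, norm_numberState] using
      (ContinuousLinearMap.adjoint Y).le_opNorm (displacement z (numberState k))

theorem thermalMean_mul_adjoint (Y : L2 →L[ℂ] L2) (z : ℂ) :
    thermalMean μ (Y * ContinuousLinearMap.adjoint Y) z = secondMoment μ Y z := by
  rw [thermalMean, secondMoment, Complex.ofReal_tsum]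
  refine tsum_congr fun k => ?_
  rw [mul_apply_eq_comp, ← ContinuousLinearMap.adjoint_inner_left, inner_self_eq_norm_sq_to_K]
  push_cast
  rfl

theorem hasSum_sq_sqrt_mul_norm (h1 : 1 / 2 < μ) (h2 : μ ≤ 1) (Y : L2 →L[ℂ] L2) (z : ℂ) :
    HasSum (fun k => (√(thermalWeight μ k) *
      ‖ContinuousLinearMap.adjoint Y (displacement z (numberState k))‖) ^ 2)
      (secondMoment μ Y z) :=
  (hasSum_secondMoment h1 h2 Y z).congr_fun fun k => by
    rw [mul_pow, Real.sq_sqrt (thermalWeight_nonneg h1 h2 k)]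

/-- Moving Y to the left vector is what makes the ordering Tr(φYY*), and not Tr(φY*Y), appear in the
estimates. -/
theorem norm_inner_displacement_le_norm_adjoint (Y : L2 →L[ℂ] L2) (z : ℂ) (j k : ℕ) :
    ‖⟪displacement z (numberState j), Y (displacement z (numberState k))⟫_ℂ‖ ≤
      ‖ContinuousLinearMap.adjoint Y (displacement z (numberState j))‖ := by
  rw [← ContinuousLinearMap.adjoint_inner_left]
  refine (norm_inner_le_norm _ _).trans ?_
  rw [norm_displacement, norm_numberState, mul_one]

theorem norm_sq_thermalMean_le (h1 : 1 / 2 < μ) (h2 : μ ≤ 1) (Y : L2 →L[ℂ] L2) (z : ℂ) :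
    ‖thermalMean μ Y z‖ ^ 2 ≤ secondMoment μ Y z := by
  have hw : HasSum (fun k => √(thermalWeight μ k) ^ 2) 1 :=
    (hasSum_thermalWeight h1 h2).congr_fun fun k => Real.sq_sqrt (thermalWeight_nonneg h1 h2 k)
  have := norm_sq_le_of_hasSum (hasSum_thermalMean h1 h2 Y z) (fun k => ?_)
    (hasSum_sq_sqrt_mul_norm h1 h2 Y z) hw
  · rwa [mul_one] at this
  · rw [norm_mul, norm_thermalWeight h1 h2, mul_right_comm,
      Real.mul_self_sqrt (thermalWeight_nonneg h1 h2 k)]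
    exact mul_le_mul_of_nonneg_left (norm_inner_displacement_le_norm_adjoint Y z k k)
      (thermalWeight_nonneg h1 h2 k)

/-- Cauchy-Schwarz for Tr(φYa*), with √w_k times the norm of Y* on level k as one factor and
√(w_k(k+1)) as the other. Formally it is an equality for Y = a, which is why the constants below are
sharp. -/
theorem norm_sq_creationMean_le (h1 : 1 / 2 < μ) (h2 : μ ≤ 1) (Y : L2 →L[ℂ] L2) (z : ℂ) :
    ‖creationMean μ Y z‖ ^ 2 ≤ secondMoment μ Y z * (1 - thermalRatio μ)⁻¹ := by
  have hw : HasSum (fun k : ℕ => (√(thermalWeight μ k) * √(k + 1)) ^ 2)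
      (1 - thermalRatio μ)⁻¹ :=
    (hasSum_thermalWeight_mul_succ h1 h2).congr_fun fun k => by
      rw [mul_pow, Real.sq_sqrt (thermalWeight_nonneg h1 h2 k), Real.sq_sqrt (by positivity)]
  refine norm_sq_le_of_hasSum (hasSum_creationMean h1 h2 Y z) (fun k => ?_)
    (hasSum_sq_sqrt_mul_norm h1 h2 Y z) hw
  have e := Real.mul_self_sqrt (thermalWeight_nonneg h1 h2 k)
  calc _ = thermalWeight μ k * √(k + 1) *
        ‖⟪displacement z (numberState k), Y (displacement z (numberState (k + 1)))⟫_ℂ‖ := by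
        rw [norm_mul, norm_mul, norm_thermalWeight h1 h2, Complex.norm_real,
          Real.norm_of_nonneg (by positivity)]
    _ ≤ thermalWeight μ k * √(k + 1) *
        ‖ContinuousLinearMap.adjoint Y (displacement z (numberState k))‖ :=
        mul_le_mul_of_nonneg_left (norm_inner_displacement_le_norm_adjoint Y z k (k + 1))
          (mul_nonneg (thermalWeight_nonneg h1 h2 k) (Real.sqrt_nonneg _))
    _ = _ := by nth_rw 1 [← e]; ring

end Variance

/-! ### The Holevo bound of the Gaussian shift model. -/

section Holevo

/-- A*A is the scalar matrix b², so both singular values are |b|. -/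
theorem traceNorm_skew (A : Matrix (Fin 2) (Fin 2) ℂ) (b : ℝ) (h00 : A 0 0 = 0) (h11 : A 1 1 = 0)
    (h01 : A 0 1 = b) (h10 : A 1 0 = -b) : traceNorm A = 2 * |b| := by
  have hA : A.conjTranspose * A = ((b ^ 2 : ℝ) : ℂ) • (1 : Matrix (Fin 2) (Fin 2) ℂ) := by
    ext i j
    fin_cases i <;> fin_cases j <;>
      simp [Matrix.mul_apply, Fin.sum_univ_two, h00, h11, h01, h10, sq]
  have he : ∀ i, (Matrix.isHermitian_conjTranspose_mul_self A).eigenvalues i = b ^ 2 := by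
    intro i
    set hH := Matrix.isHermitian_conjTranspose_mul_self A
    have h := hH.mulVec_eigenvectorBasis i
    have hne : (hH.eigenvectorBasis i).ofLp ≠ 0 := by
      intro h0
      have := hH.eigenvectorBasis.orthonormal.ne_zero i
      exact this (by ext j; simpa using congrFun h0 j)
    obtain ⟨j, hj⟩ := Function.ne_iff.1 hne
    have h' := congrFun h j
    have hv : ∀ v, (A.conjTranspose * A).mulVec v = ((b ^ 2 : ℝ) : ℂ) • v := fun v => by
      rw [hA, Matrix.smul_mulVec, Matrix.one_mulVec]
    rw [hv] at h'
    simp only [Pi.smul_apply, smul_eq_mul,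
      Complex.real_smul] at h'
    have := mul_right_cancel₀ hj h'
    exact_mod_cast this.symm
  simp only [traceNorm, he, Real.sqrt_sq_eq_abs, Fin.sum_univ_two]
  ring

variable {μ : ℝ}

/-- The objective function of the Holevo bound of the Gaussian shift model is
`max (Tr φ Y Y*) (Tr φ Y* Y)`, where `Y = X₀ + i X₁`. -/
theorem holevo_objective_eq (h1 : 1 / 2 < μ) (h2 : μ ≤ 1) (θ : EuclideanSpace ℝ (Fin 2))
    (X : Fin 2 → L2 →L[ℂ] L2) (hX : ∀ i, IsSelfAdjoint (X i)) :
    (∑ i, (covMatrix (gaussianState μ h1 h2 θ) X i i).re) +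
      traceNorm ((covMatrix (gaussianState μ h1 h2 θ) X).map fun z => (z.im : ℂ)) =
    max (secondMoment μ (X 0 + Complex.I • X 1) (√(2 * μ - 1) * alpha θ))
      (secondMoment μ (X 0 + (-Complex.I) • X 1) (√(2 * μ - 1) * alpha θ)) := by
  set z : ℂ := √(2 * μ - 1) * alpha θ with hz
  have ha : ∀ i, ContinuousLinearMap.adjoint (X i) = X i := fun i => (hX i)
  have hZ : ∀ i j, covMatrix (gaussianState μ h1 h2 θ) X i j = thermalMean μ (X i * X j) z :=
    fun i j => trace_gaussianOp_mul h1 h2 θ _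
  have hsym : ∀ i j, thermalMean μ (X j * X i) z = starRingEnd ℂ (thermalMean μ (X i * X j) z) := by
    intro i j
    rw [← thermalMean_adjoint]
    congr 1
    rw [← ContinuousLinearMap.star_eq_adjoint, star_mul, ContinuousLinearMap.star_eq_adjoint,
      ContinuousLinearMap.star_eq_adjoint, ha, ha]
  have him : ∀ i, (thermalMean μ (X i * X i) z).im = 0 := fun i =>
    Complex.conj_eq_iff_im.1 (hsym i i).symm
  -- Only these two properties of ±i enter, so one computation covers both orderings. The cross
  -- terms contribute ±2 Im Z₀₁, and the maximum over the sign produces the trace norm.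
  have hY : ∀ c : ℂ, starRingEnd ℂ c = -c → c * c = -1 →
      (secondMoment μ (X 0 + c • X 1) z : ℂ) = thermalMean μ (X 0 * X 0) z +
        thermalMean μ (X 1 * X 1) z - c * (thermalMean μ (X 0 * X 1) z -
          starRingEnd ℂ (thermalMean μ (X 0 * X 1) z)) := by
    intro c hc hcc
    have e : (X 0 + c • X 1) * ContinuousLinearMap.adjoint (X 0 + c • X 1) =
        X 0 * X 0 + (X 1 * X 1 + ((-c) • (X 0 * X 1) + c • (X 1 * X 0))) := by
      rw [map_add, map_smulₛₗ, ha, ha, hc]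
      simp only [add_mul, mul_add, smul_mul_assoc, mul_smul_comm, smul_add, smul_smul]
      rw [show -c * c = 1 by linear_combination -hcc, one_smul]
      abel
    rw [← thermalMean_mul_adjoint, e, thermalMean_add h1 h2, thermalMean_add h1 h2,
      thermalMean_add h1 h2, thermalMean_smul h1 h2, thermalMean_smul h1 h2, hsym 0 1]
    ring
  have hp := congrArg Complex.re (hY Complex.I Complex.conj_I Complex.I_mul_I)
  have hm := congrArg Complex.re (hY (-Complex.I) (by simp) (by simp))
  simp only [Complex.ofReal_re, Complex.sub_re, Complex.add_re, Complex.mul_re, Complex.I_re,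
    Complex.I_im, Complex.neg_re, Complex.neg_im, Complex.sub_im, Complex.conj_re,
    Complex.conj_im] at hp hm
  rw [traceNorm_skew _ (thermalMean μ (X 0 * X 1) z).im (by simp [hZ, him]) (by simp [hZ, him])
    (by simp [hZ]) (by simp [hZ, hsym 0 1]), Fin.sum_univ_two, hZ, hZ, hp, hm]
  rcases le_total 0 (thermalMean μ (X 0 * X 1) z).im with h | h
  · rw [abs_of_nonneg h, max_eq_left (by linarith)]; ring
  · rw [abs_of_nonpos h, max_eq_right (by linarith)]; ring

theorem alpha_add_smul_single_zero (θ : EuclideanSpace ℝ (Fin 2)) (t : ℝ) :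
    alpha (θ + t • EuclideanSpace.single 0 (1 : ℝ)) = alpha θ + t * Complex.I := by
  simp [alpha]
  ring

theorem alpha_add_smul_single_one (θ : EuclideanSpace ℝ (Fin 2)) (t : ℝ) :
    alpha (θ + t • EuclideanSpace.single 1 (1 : ℝ)) = alpha θ + t * (-1) := by
  simp [alpha]
  ring

/-- The direction in which `α_u` moves with the `j`-th coordinate of `u`. -/
def alphaDir (j : Fin 2) : ℂ := if j = 0 then Complex.I else -1

theorem alpha_add_smul_single (θ : EuclideanSpace ℝ (Fin 2)) (t : ℝ) (j : Fin 2) :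
    alpha (θ + t • EuclideanSpace.single j (1 : ℝ)) = alpha θ + t * alphaDir j := by
  fin_cases j
  · simpa [alphaDir] using alpha_add_smul_single_zero θ t
  · simpa [alphaDir] using alpha_add_smul_single_one θ t

/-- For self-adjoint X the annihilation mean is the conjugate of the creation mean, so the two terms
of the differential add up to twice a real part. -/
theorem hasDerivAt_trace_gaussianState (h1 : 1 / 2 < μ) (h2 : μ ≤ 1)
    (θ : EuclideanSpace ℝ (Fin 2)) {X : L2 →L[ℂ] L2} (hX : IsSelfAdjoint X) (j : Fin 2) :
    HasDerivAt (fun t : ℝ => trace ((gaussianState μ h1 h2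
      (θ + t • EuclideanSpace.single j (1 : ℝ))).op * X))
      (((1 - thermalRatio μ) * (2 * (√(2 * μ - 1) * alphaDir j *
        creationMean μ X (√(2 * μ - 1) * alpha θ)).re) : ℝ) : ℂ) 0 := by
  set z : ℂ := √(2 * μ - 1) * alpha θ with hz
  set ζ : ℂ := √(2 * μ - 1) * alphaDir j with hζ
  obtain ⟨L, hL, hLζ⟩ := exists_hasFDerivAt_thermalMean h1 h2 X z
  have hγ : HasDerivAt (fun t : ℝ => z + t * ζ) ζ 0 := by
    have := ((Complex.ofRealCLM.hasDerivAt (x := 0)).mul_const ζ).const_add z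
    simpa using this
  have hc := HasFDerivAt.comp_hasDerivAt (0 : ℝ) (l := thermalMean μ X) (l' := L)
    (by simpa using hL) hγ
  have e : (fun t : ℝ => trace ((gaussianState μ h1 h2
      (θ + t • EuclideanSpace.single j (1 : ℝ))).op * X)) =
      thermalMean μ X ∘ fun t : ℝ => z + t * ζ := by
    funext t
    change trace (gaussianOp μ _ * X) = _
    rw [trace_gaussianOp_mul h1 h2, alpha_add_smul_single, Function.comp_apply, hz, hζ]
    congr 1
    ring
  rw [e]
  refine hc.congr_deriv ?_
  have ha : ContinuousLinearMap.adjoint X = X := hX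
  rw [hLζ, annihilationMean_eq_conj, ha, ← map_mul, Complex.add_conj]
  push_cast
  ring

/-- The value `1 / ((2μ - 1)(1 - p))` of the minimax risk. -/
def optimalRisk (μ : ℝ) : ℝ := ((2 * μ - 1) * (1 - thermalRatio μ))⁻¹

theorem optimalRisk_pos (h1 : 1 / 2 < μ) : 0 < optimalRisk μ := by
  have := thermalRatio_lt_one h1
  exact inv_pos.2 (mul_pos (by linarith) (by linarith))

/-- A Cramér-Rao argument for the single operator Y = X₀ + iX₁: the derivative constraints determine
its creation mean, and Cauchy-Schwarz then bounds Tr(φYY*) from below. -/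
theorem optimalRisk_le_holevoBound (h1 : 1 / 2 < μ) (h2 : μ ≤ 1) (θ : EuclideanSpace ℝ (Fin 2)) :
    ENNReal.ofReal (optimalRisk μ) ≤ holevoBound (gaussianState μ h1 h2) θ := by
  refine le_iInf₂ fun X hX => ENNReal.ofReal_le_ofReal ?_
  rw [holevo_objective_eq h1 h2 θ X hX.isSelfAdjoint]
  refine le_trans ?_ (le_max_left _ _)
  set z : ℂ := √(2 * μ - 1) * alpha θ with hz
  have hs : 0 < √(2 * μ - 1) := Real.sqrt_pos.2 (by linarith)
  have hss : √(2 * μ - 1) ^ 2 = 2 * μ - 1 := Real.sq_sqrt (by linarith)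
  have hp : 0 < 1 - thermalRatio μ := by linarith [thermalRatio_lt_one h1]
  have hd : ∀ i j, (1 - thermalRatio μ) * (2 * (√(2 * μ - 1) * alphaDir j *
      creationMean μ (X i) z).re) = if i = j then 1 else 0 := by
    intro i j
    have := (hasDerivAt_trace_gaussianState h1 h2 θ (hX.isSelfAdjoint i) j).unique (hX.deriv i j)
    have := congrArg Complex.re this
    rw [Complex.ofReal_re] at this
    rw [this]
    split_ifs <;> simp
  have d00 := hd 0 0
  have d01 := hd 0 1
  have d10 := hd 1 0
  have d11 := hd 1 1
  simp only [alphaDir, Fin.isValue, if_true, if_false, one_ne_zero, zero_ne_one, Complex.mul_re,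
    Complex.mul_im, Complex.ofReal_re, Complex.ofReal_im, Complex.I_re, Complex.I_im, Complex.neg_re,
    Complex.neg_im, Complex.one_re, Complex.one_im] at d00 d01 d10 d11
  -- The off-diagonal constraints make the real part vanish; the diagonal ones add up to the
  -- imaginary part.
  have hA : creationMean μ (X 0 + Complex.I • X 1) z =
      -(((√(2 * μ - 1) * (1 - thermalRatio μ))⁻¹ : ℝ) : ℂ) * Complex.I := by
    rw [creationMean_add h1 h2, creationMean_smul h1 h2]
    have hg : √(2 * μ - 1) * (1 - thermalRatio μ) ≠ 0 := by positivity
    have r0 : √(2 * μ - 1) * (1 - thermalRatio μ) *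
        ((creationMean μ (X 0) z).re - (creationMean μ (X 1) z).im) = 0 := by linarith
    have r1 : √(2 * μ - 1) * (1 - thermalRatio μ) *
        ((creationMean μ (X 0) z).im + (creationMean μ (X 1) z).re) = -1 := by linarith
    have r0' := (mul_eq_zero.1 r0).resolve_left hg
    have r1' : (creationMean μ (X 0) z).im + (creationMean μ (X 1) z).re =
        -(√(2 * μ - 1) * (1 - thermalRatio μ))⁻¹ := by
      rw [← mul_right_inj' hg, r1, mul_neg, mul_inv_cancel₀ hg]
    apply Complex.ext <;>
      simp only [Complex.add_re, Complex.add_im, Complex.mul_re, Complex.mul_im, Complex.neg_re,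
        Complex.neg_im, Complex.I_re, Complex.I_im, Complex.ofReal_re, Complex.ofReal_im] <;>
      linarith
  have hle := norm_sq_creationMean_le h1 h2 (X 0 + Complex.I • X 1) z
  have hn : ‖creationMean μ (X 0 + Complex.I • X 1) z‖ =
      (√(2 * μ - 1) * (1 - thermalRatio μ))⁻¹ := by
    rw [hA, norm_mul, norm_neg, Complex.norm_real, Complex.norm_I, mul_one,
      Real.norm_of_nonneg (by positivity)]
  rw [hn, inv_pow, mul_pow, hss, ← div_eq_mul_inv, le_div_iff₀ hp] at hle
  refine le_trans (le_of_eq ?_) hle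
  have : 2 * μ - 1 ≠ 0 := by linarith
  rw [optimalRisk]
  field_simp

/-- The annihilation operator truncated to the first levels. -/
def truncatedAnnihilation (N : ℕ) : L2 →L[ℂ] L2 :=
  ∑ k ∈ Finset.range N, (√(k + 1) : ℂ) •
    InnerProductSpace.rankOne ℂ (numberState k) (numberState (k + 1))

theorem inner_numberState (j k : ℕ) :
    ⟪numberState j, numberState k⟫_ℂ = if j = k then 1 else 0 :=
  orthonormal_iff_ite.1 orthonormal_numberState j k

theorem truncatedAnnihilation_zero (N : ℕ) : truncatedAnnihilation N (numberState 0) = 0 := by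
  simp only [truncatedAnnihilation, sum_apply, smul_apply, InnerProductSpace.rankOne_apply,
    inner_numberState]
  simp

theorem truncatedAnnihilation_succ (N k : ℕ) : truncatedAnnihilation N (numberState (k + 1)) =
    if k < N then (√(k + 1) : ℂ) • numberState k else 0 := by
  simp only [truncatedAnnihilation, sum_apply, smul_apply, InnerProductSpace.rankOne_apply,
    inner_numberState, add_left_inj, ite_smul, one_smul, zero_smul, smul_ite, smul_zero,
    Finset.sum_ite_eq', Finset.mem_range]

theorem adjoint_truncatedAnnihilation (N k : ℕ) :
    ContinuousLinearMap.adjoint (truncatedAnnihilation N) (numberState k) =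
      if k < N then (√(k + 1) : ℂ) • numberState (k + 1) else 0 := by
  simp only [truncatedAnnihilation, map_sum, map_smulₛₗ, InnerProductSpace.adjoint_rankOne,
    sum_apply, smul_apply, InnerProductSpace.rankOne_apply, inner_numberState, ite_smul, one_smul,
    zero_smul, smul_ite, smul_zero, Finset.sum_ite_eq', Finset.mem_range, Complex.conj_ofReal]

/-- The partial sums of `Tr (φ⁰ a a*)`. -/
def partialMoment (μ : ℝ) (N : ℕ) : ℝ := ∑ k ∈ Finset.range N, thermalWeight μ k * (k + 1)

/-- The truncated annihilation operator, displaced by `z`. -/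
def displacedAnnihilation (N : ℕ) (z : ℂ) : L2 →L[ℂ] L2 :=
  displacement z * truncatedAnnihilation N * ContinuousLinearMap.adjoint (displacement z)

theorem adjoint_displacement_displacement (z : ℂ) (f : L2) :
    ContinuousLinearMap.adjoint (displacement z) (displacement z f) = f := by
  refine ext_inner_left ℂ fun g => ?_
  rw [ContinuousLinearMap.adjoint_inner_right, inner_displacement_displacement]

theorem displacedAnnihilation_apply (N : ℕ) (z : ℂ) (f : L2) :
    displacedAnnihilation N z (displacement z f) = displacement z (truncatedAnnihilation N f) := by
  simp [displacedAnnihilation, adjoint_displacement_displacement]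

theorem adjoint_displacedAnnihilation_apply (N : ℕ) (z : ℂ) (f : L2) :
    ContinuousLinearMap.adjoint (displacedAnnihilation N z) (displacement z f) =
      displacement z (ContinuousLinearMap.adjoint (truncatedAnnihilation N) f) := by
  rw [← ContinuousLinearMap.star_eq_adjoint, displacedAnnihilation, star_mul, star_mul]
  simp [ContinuousLinearMap.star_eq_adjoint, adjoint_displacement_displacement]

theorem hasSum_ite_lt (f : ℕ → ℝ) (N : ℕ) :
    HasSum (fun k => if k < N then f k else 0) (∑ k ∈ Finset.range N, f k) := by
  have e : ∑ k ∈ Finset.range N, f k = ∑ k ∈ Finset.range N, if k < N then f k else 0 :=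
    Finset.sum_congr rfl fun k hk => (if_pos (Finset.mem_range.1 hk)).symm
  rw [e]
  exact hasSum_sum_of_ne_finset_zero fun k hk => if_neg fun h => hk (Finset.mem_range.2 h)

theorem secondMoment_displacedAnnihilation (μ : ℝ) (N : ℕ) (z : ℂ) :
    secondMoment μ (displacedAnnihilation N z) z = partialMoment μ N := by
  refine HasSum.tsum_eq ((hasSum_ite_lt (fun k => thermalWeight μ k * (k + 1)) N).congr_fun
    fun k => ?_)
  rw [adjoint_displacedAnnihilation_apply, norm_displacement, adjoint_truncatedAnnihilation]
  split_ifs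
  · rw [norm_smul, norm_numberState, mul_one, Complex.norm_real, Real.norm_of_nonneg (by positivity),
      Real.sq_sqrt (by positivity)]
  · simp

theorem secondMoment_adjoint_displacedAnnihilation (μ : ℝ) (N : ℕ) (z : ℂ) :
    secondMoment μ (ContinuousLinearMap.adjoint (displacedAnnihilation N z)) z =
      thermalRatio μ * partialMoment μ N := by
  refine HasSum.tsum_eq (hasSum_of_hasSum_succ ?_ ?_)
  · simp only [ContinuousLinearMap.adjoint_adjoint, displacedAnnihilation_apply, norm_displacement,
      truncatedAnnihilation_zero]
    simp
  simp only [ContinuousLinearMap.adjoint_adjoint, displacedAnnihilation_apply, norm_displacement,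
    truncatedAnnihilation_succ]
  refine ((hasSum_ite_lt (fun k => thermalWeight μ k * (k + 1)) N).mul_left
    (thermalRatio μ)).congr_fun fun k => ?_
  rw [thermalWeight_succ]
  split_ifs
  · rw [norm_smul, norm_numberState, mul_one, Complex.norm_real, Real.norm_of_nonneg (by positivity),
      Real.sq_sqrt (by positivity), mul_assoc]
  · simp

theorem thermalMean_displacedAnnihilation (μ : ℝ) (N : ℕ) (z : ℂ) :
    thermalMean μ (displacedAnnihilation N z) z = 0 := by
  rw [thermalMean]
  convert tsum_zero with k
  rw [displacedAnnihilation_apply, inner_displacement_displacement]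
  cases k with
  | zero => simp [truncatedAnnihilation_zero]
  | succ k =>
    rw [truncatedAnnihilation_succ]
    split_ifs
    · rw [inner_smul_right, inner_numberState, if_neg (by simp), mul_zero, mul_zero]
    · simp

theorem creationMean_displacedAnnihilation (μ : ℝ) (N : ℕ) (z : ℂ) :
    creationMean μ (displacedAnnihilation N z) z = partialMoment μ N := by
  have h := Complex.hasSum_ofReal.2 (hasSum_ite_lt (fun k => thermalWeight μ k * (k + 1)) N)
  refine HasSum.tsum_eq (h.congr_fun fun k => ?_)
  rw [displacedAnnihilation_apply, inner_displacement_displacement, truncatedAnnihilation_succ]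
  split_ifs
  · rw [inner_smul_right, inner_numberState, if_pos rfl, mul_one, mul_assoc, ← Complex.ofReal_mul,
      Real.mul_self_sqrt (by positivity), Complex.ofReal_mul]
  · simp

theorem creationMean_adjoint_displacedAnnihilation (μ : ℝ) (N : ℕ) (z : ℂ) :
    creationMean μ (ContinuousLinearMap.adjoint (displacedAnnihilation N z)) z = 0 := by
  rw [creationMean]
  convert tsum_zero with k
  rw [adjoint_displacedAnnihilation_apply, inner_displacement_displacement,
    adjoint_truncatedAnnihilation]
  split_ifs
  · rw [inner_smul_right, inner_numberState, if_neg (by lia), mul_zero, mul_zero]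
  · simp

theorem secondMoment_smul (h1 : 1 / 2 < μ) (h2 : μ ≤ 1) (c : ℂ) (Y : L2 →L[ℂ] L2) (z : ℂ) :
    secondMoment μ (c • Y) z = ‖c‖ ^ 2 * secondMoment μ Y z := by
  refine (hasSum_secondMoment h1 h2 (c • Y) z).unique (((hasSum_secondMoment h1 h2 Y z).mul_left
    (‖c‖ ^ 2)).congr_fun fun k => ?_)
  rw [map_smulₛₗ, smul_apply, norm_smul, RCLike.norm_conj]
  ring

/-- The witnesses are quadratures of the truncated annihilation operator A, arranged so that X₀ +
iX₁ = -icA. They are bounded, hence admissible. -/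
theorem holevoBound_le_of_partialMoment (h1 : 1 / 2 < μ) (h2 : μ ≤ 1)
    (θ : EuclideanSpace ℝ (Fin 2)) {N : ℕ} (hN : 0 < partialMoment μ N) :
    holevoBound (gaussianState μ h1 h2) θ ≤
      ENNReal.ofReal ((2 * μ - 1) * (1 - thermalRatio μ) ^ 2 * partialMoment μ N)⁻¹ := by
  set z : ℂ := √(2 * μ - 1) * alpha θ with hz
  set S := partialMoment μ N with hS
  set A := displacedAnnihilation N z with hA
  have hs : 0 < √(2 * μ - 1) := Real.sqrt_pos.2 (by linarith)
  have hss : √(2 * μ - 1) ^ 2 = 2 * μ - 1 := Real.sq_sqrt (by linarith)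
  have hp : 0 < 1 - thermalRatio μ := by linarith [thermalRatio_lt_one h1]
  -- Normalised so that the diagonal derivatives equal 1, as verified in `hcS`.
  set c : ℝ := (√(2 * μ - 1) * (1 - thermalRatio μ) * S)⁻¹ with hc
  have hc0 : 0 < c := by positivity
  set X : Fin 2 → L2 →L[ℂ] L2 := fun i => if i = 0 then
      ((-(c / 2 : ℝ) * Complex.I : ℂ) • A + ((c / 2 : ℝ) * Complex.I : ℂ) •
        ContinuousLinearMap.adjoint A)
    else (-(c / 2 : ℝ) : ℂ) • A + (-(c / 2 : ℝ) : ℂ) • ContinuousLinearMap.adjoint A with hX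
  have hX0 : X 0 = ((-(c / 2 : ℝ) * Complex.I : ℂ) • A + ((c / 2 : ℝ) * Complex.I : ℂ) •
        ContinuousLinearMap.adjoint A) := by simp [hX]
  have hX1 : X 1 = (-(c / 2 : ℝ) : ℂ) • A + (-(c / 2 : ℝ) : ℂ) • ContinuousLinearMap.adjoint A := by
    simp [hX]
  have hsa : ∀ i, IsSelfAdjoint (X i) := by
    intro i
    rw [IsSelfAdjoint, ContinuousLinearMap.star_eq_adjoint]
    fin_cases i
    · change ContinuousLinearMap.adjoint (X 0) = X 0
      rw [hX0, map_add, map_smulₛₗ, map_smulₛₗ, ContinuousLinearMap.adjoint_adjoint]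
      simp only [map_mul, map_neg, Complex.conj_ofReal, Complex.conj_I]
      rw [add_comm]
      congr 2 <;> ring
    · change ContinuousLinearMap.adjoint (X 1) = X 1
      rw [hX1, map_add, map_smulₛₗ, map_smulₛₗ, ContinuousLinearMap.adjoint_adjoint]
      simp only [map_neg, Complex.conj_ofReal]
      rw [add_comm]
  have hmean : ∀ i, thermalMean μ (X i) z = 0 := by
    intro i
    have h0 : thermalMean μ A z = 0 := thermalMean_displacedAnnihilation μ N z
    have h0' : thermalMean μ (ContinuousLinearMap.adjoint A) z = 0 := by
      rw [thermalMean_adjoint, h0, map_zero]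
    fin_cases i
    · change thermalMean μ (X 0) z = 0
      rw [hX0, thermalMean_add h1 h2, thermalMean_smul h1 h2, thermalMean_smul h1 h2, h0, h0']
      simp
    · change thermalMean μ (X 1) z = 0
      rw [hX1, thermalMean_add h1 h2, thermalMean_smul h1 h2, thermalMean_smul h1 h2, h0, h0']
      simp
  have hcr : creationMean μ A z = S := creationMean_displacedAnnihilation μ N z
  have hcr' : creationMean μ (ContinuousLinearMap.adjoint A) z = 0 :=
    creationMean_adjoint_displacedAnnihilation μ N z
  have hcr0 : creationMean μ (X 0) z = -((c / 2 * S : ℝ) : ℂ) * Complex.I := by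
    rw [hX0, creationMean_add h1 h2, creationMean_smul h1 h2, creationMean_smul h1 h2, hcr, hcr']
    push_cast
    ring
  have hcr1 : creationMean μ (X 1) z = -((c / 2 * S : ℝ) : ℂ) := by
    rw [hX1, creationMean_add h1 h2, creationMean_smul h1 h2, creationMean_smul h1 h2, hcr, hcr']
    push_cast
    ring
  have hcS : (1 - thermalRatio μ) * (2 * (√(2 * μ - 1) * (c / 2 * S))) = 1 := by
    rw [hc]; field_simp
  have hunb : IsLocallyUnbiased (gaussianState μ h1 h2) θ X := by
    refine ⟨hsa, fun i => ?_, fun i j => ?_⟩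
    · exact (trace_gaussianOp_mul h1 h2 θ (X i)).trans (hmean i)
    · refine (hasDerivAt_trace_gaussianState h1 h2 θ (hsa i) j).congr_deriv ?_
      rw [← hz]
      have : (1 - thermalRatio μ) * (2 * (√(2 * μ - 1) * alphaDir j *
          creationMean μ (X i) z).re) = if i = j then 1 else 0 := by
        fin_cases i <;> fin_cases j <;>
          simp only [Fin.zero_eta, Fin.mk_one, hcr0, hcr1, alphaDir, Fin.isValue, if_true, if_false,
            one_ne_zero, zero_ne_one, Complex.mul_re, Complex.mul_im, Complex.ofReal_re,
            Complex.ofReal_im, Complex.I_re, Complex.I_im, Complex.neg_re, Complex.neg_im,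
            Complex.one_re, Complex.one_im] <;> linarith
      rw [this]
      split_ifs <;> simp
  refine (iInf₂_le X hunb).trans (ENNReal.ofReal_le_ofReal ?_)
  rw [holevo_objective_eq h1 h2 θ X hsa, ← hz]
  have hY : X 0 + Complex.I • X 1 = (-(c : ℂ) * Complex.I) • A := by
    rw [hX0, hX1]
    push_cast
    module
  have hY' : X 0 + (-Complex.I) • X 1 = ((c : ℂ) * Complex.I) • ContinuousLinearMap.adjoint A := by
    rw [hX0, hX1]
    push_cast
    module
  rw [hY, hY', secondMoment_smul h1 h2, secondMoment_smul h1 h2,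
    secondMoment_displacedAnnihilation, secondMoment_adjoint_displacedAnnihilation, ← hS]
  have hn1 : ‖-(c : ℂ) * Complex.I‖ = c := by
    rw [norm_mul, norm_neg, Complex.norm_real, Complex.norm_I, Real.norm_of_nonneg hc0.le, mul_one]
  have hn2 : ‖(c : ℂ) * Complex.I‖ = c := by
    rw [norm_mul, Complex.norm_real, Complex.norm_I, Real.norm_of_nonneg hc0.le, mul_one]
  have hval : c ^ 2 * S = ((2 * μ - 1) * (1 - thermalRatio μ) ^ 2 * S)⁻¹ := by
    rw [hc, inv_pow, mul_pow, mul_pow, hss]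
    have : 2 * μ - 1 ≠ 0 := by linarith
    field_simp
  rw [hn1, hn2]
  -- The orderings AA* and A*A have moments S and pS with p < 1, so the first one dominates.
  refine max_le hval.le (le_trans ?_ hval.le)
  have : thermalRatio μ * S ≤ S := by nlinarith
  gcongr

/-- As the truncation is removed, the partial moments increase to 1/(1-p) and the upper bounds
converge to the lower one. -/
theorem holevoBound_eq_optimalRisk (h1 : 1 / 2 < μ) (h2 : μ ≤ 1) (θ : EuclideanSpace ℝ (Fin 2)) :
    holevoBound (gaussianState μ h1 h2) θ = ENNReal.ofReal (optimalRisk μ) := by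
  refine le_antisymm ?_ (optimalRisk_le_holevoBound h1 h2 θ)
  have hp : 0 < 1 - thermalRatio μ := by linarith [thermalRatio_lt_one h1]
  have hs : 0 < 2 * μ - 1 := by linarith
  have hS : Filter.Tendsto (partialMoment μ) Filter.atTop (nhds (1 - thermalRatio μ)⁻¹) :=
    (hasSum_thermalWeight_mul_succ h1 h2).tendsto_sum_nat
  have hlim := ENNReal.tendsto_ofReal
    ((hS.const_mul ((2 * μ - 1) * (1 - thermalRatio μ) ^ 2)).inv₀ (by positivity))
  have e : ((2 * μ - 1) * (1 - thermalRatio μ) ^ 2 * (1 - thermalRatio μ)⁻¹)⁻¹ = optimalRisk μ := by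
    rw [optimalRisk]; field_simp
  rw [e] at hlim
  refine ge_of_tendsto hlim ?_
  filter_upwards [hS.eventually (lt_mem_nhds (inv_pos.2 hp))] with N hN
  exact holevoBound_le_of_partialMoment h1 h2 θ hN

end Holevo

/-! ### Green's theorem for maps close to the identity. -/

section Rectangle

theorem norm_integral_sub_integral_le {g h : ℝ → ℂ} (hg : Continuous g) (hh : Continuous h)
    {b e : ℝ} (hb : 0 < b) (hgh : ∀ x, |x| ≤ b → ‖g x - h x‖ ≤ e) :
    ‖(∫ x in (-b)..b, g x) - ∫ x in (-b)..b, h x‖ ≤ e * (2 * b) := by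
  rw [← intervalIntegral.integral_sub (hg.intervalIntegrable _ _) (hh.intervalIntegrable _ _)]
  have := intervalIntegral.norm_integral_le_of_norm_le_const (a := -b) (b := b) (C := e)
    (f := fun x => g x - h x) fun x hx => by
      rw [Set.uIoc_of_le (by linarith)] at hx
      exact hgh x (abs_le.2 ⟨hx.1.le, hx.2⟩)
  rwa [show b - -b = 2 * b by ring, abs_of_pos (by linarith)] at this

/-- If `G` is uniformly `e`-close to the identity on the square of half-width `b`, then its
`z`-derivative cannot be uniformly small there. -/
theorem one_le_of_norm_sub_id_le {G α β : ℂ → ℂ}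
    (hG : ∀ z, ∃ L : ℂ →L[ℝ] ℂ, HasFDerivAt G L z ∧
      ∀ ζ, L ζ = α z * ζ + β z * starRingEnd ℂ ζ) {b c e : ℝ} (hb : 0 < b)
    (hα : ∀ z : ℂ, |z.re| ≤ b → |z.im| ≤ b → ‖α z‖ ≤ c)
    (he : ∀ z : ℂ, |z.re| ≤ b → |z.im| ≤ b → ‖G z - z‖ ≤ e) : 1 ≤ c + e / b := by
  -- The boundary formula for rectangles involves the z̄-derivative. Conjugating G turns its
  -- z-derivative α into the z̄-derivative of f, with area integrand 2i times the conjugate of α.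
  set f : ℂ → ℂ := fun z => starRingEnd ℂ (G z) with hf
  have hf' : ∀ z, HasFDerivAt f (fderiv ℝ f z) z ∧
      ∀ ζ, fderiv ℝ f z ζ = starRingEnd ℂ (α z * ζ + β z * starRingEnd ℂ ζ) := by
    intro z
    obtain ⟨L, hL, hL'⟩ := hG z
    have h := (Complex.conjCLE : ℂ →L[ℝ] ℂ).hasFDerivAt.comp z hL
    have h' : HasFDerivAt f ((Complex.conjCLE : ℂ →L[ℝ] ℂ).comp L) z := h
    rw [h'.fderiv]
    refine ⟨h', fun ζ => ?_⟩
    rw [← hL']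
    rfl
  have hd : ∀ z, Complex.I • fderiv ℝ f z 1 - fderiv ℝ f z Complex.I =
      2 * Complex.I * starRingEnd ℂ (α z) := by
    intro z
    rw [(hf' z).2, (hf' z).2]
    simp only [smul_eq_mul, map_add, map_mul, map_one, map_neg, Complex.conj_I, mul_one]
    ring
  have hfc : Continuous f := continuous_iff_continuousAt.2 fun z => (hf' z).1.continuousAt
  have hneg : -b ≤ b := by linarith
  have hrect : ∀ z : ℂ, z ∈ Set.uIcc (-b) b ×ℂ Set.uIcc (-b) b → |z.re| ≤ b ∧ |z.im| ≤ b := by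
    intro z hz
    rw [Complex.mem_reProdIm, Set.uIcc_of_le hneg] at hz
    exact ⟨abs_le.2 hz.1, abs_le.2 hz.2⟩
  have hmeas : Measurable fun z => Complex.I • fderiv ℝ f z 1 - fderiv ℝ f z Complex.I :=
    ((measurable_fderiv_apply_const ℝ f 1).const_smul Complex.I).sub
      (measurable_fderiv_apply_const ℝ f Complex.I)
  have hα2 : ∀ z : ℂ, |z.re| ≤ b → |z.im| ≤ b →
      ‖Complex.I • fderiv ℝ f z 1 - fderiv ℝ f z Complex.I‖ ≤ 2 * c := by
    intro z h1 h2
    rw [hd, norm_mul, norm_mul, Complex.norm_I, RCLike.norm_conj, Complex.norm_two, mul_one]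
    exact mul_le_mul_of_nonneg_left (hα z h1 h2) (by norm_num)
  have hcpt : IsCompact (Set.uIcc (-b) b ×ℂ Set.uIcc (-b) b) :=
    isCompact_uIcc.reProdIm isCompact_uIcc
  have hint : IntegrableOn (fun z => Complex.I • fderiv ℝ f z 1 - fderiv ℝ f z Complex.I)
      (Set.uIcc (-b) b ×ℂ Set.uIcc (-b) b) := by
    refine IntegrableOn.of_bound hcpt.measure_lt_top hmeas.aestronglyMeasurable (2 * c) ?_
    filter_upwards [ae_restrict_mem hcpt.measurableSet] with z hz
    exact hα2 z (hrect z hz).1 (hrect z hz).2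
  have key := Complex.integral_boundary_rect_of_differentiableOn_real f (⟨-b, -b⟩ : ℂ) ⟨b, b⟩
    (fun z _ => (hf' z).1.differentiableAt.differentiableWithinAt) hint
  simp only [smul_eq_mul] at key
  have hR : ‖∫ x : ℝ in (-b)..b, ∫ y : ℝ in (-b)..b,
      Complex.I * fderiv ℝ f (x + y * Complex.I) 1 -
        fderiv ℝ f (x + y * Complex.I) Complex.I‖ ≤ 2 * c * (2 * b) * (2 * b) := by
    have hab : |b - -b| = 2 * b := by
      rw [show b - -b = 2 * b by ring, abs_of_pos (by linarith)]
    have := intervalIntegral.norm_integral_le_of_norm_le_const (a := -b) (b := b)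
      (C := 2 * c * (2 * b)) (f := fun x : ℝ => ∫ y : ℝ in (-b)..b,
        Complex.I * fderiv ℝ f (x + y * Complex.I) 1 -
          fderiv ℝ f (x + y * Complex.I) Complex.I) fun x hx => ?_
    · rwa [hab] at this
    · have := intervalIntegral.norm_integral_le_of_norm_le_const (a := -b) (b := b)
        (C := 2 * c) (f := fun y : ℝ => Complex.I * fderiv ℝ f (x + y * Complex.I) 1 -
          fderiv ℝ f (x + y * Complex.I) Complex.I) fun y hy => ?_
      · rwa [hab] at this
      · rw [Set.uIoc_of_le hneg] at hx hy
        refine hα2 _ ?_ ?_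
        · simpa using abs_le.2 ⟨hx.1.le, hx.2⟩
        · simpa using abs_le.2 ⟨hy.1.le, hy.2⟩
  rw [← key] at hR
  have hclose : ∀ z : ℂ, |z.re| ≤ b → |z.im| ≤ b → ‖f z - starRingEnd ℂ z‖ ≤ e := by
    intro z h1 h2
    rw [hf, ← map_sub, RCLike.norm_conj]
    exact he z h1 h2
  have hbb : |b| ≤ b := (abs_of_pos hb).le
  have hbb' : |-b| ≤ b := by rw [abs_neg]; exact hbb
  have hx0 : ∫ x : ℝ in (-b)..b, (x : ℂ) = 0 := by
    rw [intervalIntegral.integral_ofReal, integral_id]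
    simp
  have hlin : ∀ c d : ℂ, ∫ x : ℝ in (-b)..b, (c + d * x) = 2 * b * c := by
    intro c d
    rw [intervalIntegral.integral_add (by simp)
      ((Complex.continuous_ofReal.const_mul d).intervalIntegrable _ _),
      intervalIntegral.integral_const_mul, hx0, intervalIntegral.integral_const,
      Complex.real_smul]
    push_cast
    ring
  have i1 := norm_integral_sub_integral_le (g := fun x : ℝ => f (x + (-b : ℝ) * Complex.I))
    (h := fun x : ℝ => b * Complex.I + 1 * x) (e := e) (by fun_prop) (by fun_prop) hb
    (fun x hx => by
      have := hclose (x + (-b : ℝ) * Complex.I) (by simpa using hx) (by simpa using hbb)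
      refine le_of_eq_of_le ?_ this
      congr 2
      simp
      ring)
  have i2 := norm_integral_sub_integral_le (g := fun x : ℝ => f (x + b * Complex.I))
    (h := fun x : ℝ => -b * Complex.I + 1 * x) (e := e) (by fun_prop) (by fun_prop) hb
    (fun x hx => by
      have := hclose (x + b * Complex.I) (by simpa using hx) (by simpa using hbb)
      refine le_of_eq_of_le ?_ this
      congr 2
      simp
      ring)
  have i3 := norm_integral_sub_integral_le (g := fun y : ℝ => f (b + y * Complex.I))
    (h := fun y : ℝ => b + -Complex.I * y) (e := e) (by fun_prop) (by fun_prop) hb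
    (fun y hy => by
      have := hclose (b + y * Complex.I) (by simpa using hbb) (by simpa using hy)
      refine le_of_eq_of_le ?_ this
      congr 2
      simp
      ring)
  have i4 := norm_integral_sub_integral_le (g := fun y : ℝ => f ((-b : ℝ) + y * Complex.I))
    (h := fun y : ℝ => -b + -Complex.I * y) (e := e) (by fun_prop) (by fun_prop) hb
    (fun y hy => by
      have := hclose ((-b : ℝ) + y * Complex.I) (by simpa using hbb) (by simpa using hy)
      refine le_of_eq_of_le ?_ this
      congr 2
      simp
      ring)
  rw [hlin] at i1 i2 i3 i4
  set J1 := ∫ x : ℝ in (-b)..b, f (x + (-b : ℝ) * Complex.I)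
  set J2 := ∫ x : ℝ in (-b)..b, f (x + b * Complex.I)
  set J3 := ∫ y : ℝ in (-b)..b, f (b + y * Complex.I)
  set J4 := ∫ y : ℝ in (-b)..b, f ((-b : ℝ) + y * Complex.I)
  -- The boundary integral of z̄ is 2i times the area 4b². Replacing z̄ by f costs at most e · 2b on
  -- each of the four sides.
  have hsum : ‖(8 * b ^ 2 : ℂ) * Complex.I‖ ≤ 2 * c * (2 * b) * (2 * b) + 4 * (e * (2 * b)) := by
    have e1 : (8 * b ^ 2 : ℂ) * Complex.I = (J1 - J2 + Complex.I * J3 - Complex.I * J4) -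
        (J1 - 2 * b * (b * Complex.I)) + (J2 - 2 * b * (-b * Complex.I)) -
        Complex.I * (J3 - 2 * b * b) + Complex.I * (J4 - 2 * b * -b) := by ring
    have n3 : ‖Complex.I * (J3 - 2 * b * b)‖ ≤ e * (2 * b) := by
      rw [norm_mul, Complex.norm_I, one_mul]; exact i3
    have n4 : ‖Complex.I * (J4 - 2 * b * -b)‖ ≤ e * (2 * b) := by
      rw [norm_mul, Complex.norm_I, one_mul]; exact i4
    rw [e1]
    refine (norm_add_le _ _).trans ?_
    refine (add_le_add_left (norm_sub_le _ _) _).trans ?_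
    refine (add_le_add_left (add_le_add_left (norm_add_le _ _) _) _).trans ?_
    refine (add_le_add_left (add_le_add_left (add_le_add_left (norm_sub_le _ _) _) _) _).trans ?_
    linarith
  have h8 : ‖(8 * b ^ 2 : ℂ) * Complex.I‖ = 8 * b ^ 2 := by
    rw [norm_mul, Complex.norm_I, mul_one, show (8 * b ^ 2 : ℂ) = ((8 * b ^ 2 : ℝ) : ℂ) by push_cast; rfl,
      Complex.norm_real, Real.norm_of_nonneg (by positivity)]
  rw [h8] at hsum
  have : b ≤ c * b + e := by nlinarith
  rw [← sub_le_iff_le_add', le_div_iff₀ hb]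
  linarith

end Rectangle

/-! ### Finite resolutions of the identity obtained from a measurement. -/

section FinitePOVM

variable {H : Type*} [NormedAddCommGroup H] [InnerProductSpace ℂ H] [CompleteSpace H]

/-- Cauchy-Schwarz for a finite resolution of the identity: `F F* ≤ ∑ |f v|² M v`
for `F = ∑ f v • M v`. -/
theorem norm_sq_adjoint_sum_smul_le {ι : Type*} (S : Finset ι) (M : ι → H →L[ℂ] H)
    (hM : ∀ v ∈ S, (M v).IsPositive) (hsum : ∀ χ : H, ∑ v ∈ S, (⟪χ, M v χ⟫_ℂ).re = ‖χ‖ ^ 2)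
    (f : ι → ℂ) (ψ : H) : ‖ContinuousLinearMap.adjoint (∑ v ∈ S, f v • M v) ψ‖ ^ 2 ≤
      ∑ v ∈ S, ‖f v‖ ^ 2 * (⟪ψ, M v ψ⟫_ℂ).re := by
  have hsqrt : ∀ v ∈ S, ∀ x y : H, ⟪x, M v y⟫_ℂ = ⟪CFC.sqrt (M v) x, CFC.sqrt (M v) y⟫_ℂ := by
    intro v hv x y
    have h0 : 0 ≤ M v := (ContinuousLinearMap.nonneg_iff_isPositive _).2 (hM v hv)
    have hsa : ContinuousLinearMap.adjoint (CFC.sqrt (M v)) = CFC.sqrt (M v) :=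
      ((ContinuousLinearMap.nonneg_iff_isPositive _).1 (CFC.sqrt_nonneg (M v))).isSelfAdjoint
    rw [← ContinuousLinearMap.adjoint_inner_right, hsa, ← mul_apply_eq_comp,
      CFC.sqrt_mul_sqrt_self (M v) h0]
  have hre : ∀ v ∈ S, ∀ x : H, (⟪x, M v x⟫_ℂ).re = ‖CFC.sqrt (M v) x‖ ^ 2 := by
    intro v hv x
    rw [hsqrt v hv, inner_self_eq_norm_sq_to_K]
    norm_cast
  set F := ∑ v ∈ S, f v • M v with hF
  set χ := ContinuousLinearMap.adjoint F ψ with hχ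
  set Q := ∑ v ∈ S, ‖f v‖ ^ 2 * (⟪ψ, M v ψ⟫_ℂ).re with hQ
  have h1 : ‖χ‖ ^ 2 ≤ ∑ v ∈ S, (‖f v‖ * ‖CFC.sqrt (M v) ψ‖) * ‖CFC.sqrt (M v) χ‖ := by
    have e : ((‖χ‖ ^ 2 : ℝ) : ℂ) = ∑ v ∈ S, f v * ⟪ψ, M v χ⟫_ℂ := by
      have : ⟪χ, χ⟫_ℂ = ⟪ψ, F χ⟫_ℂ := by rw [hχ, ContinuousLinearMap.adjoint_inner_left]
      rw [inner_self_eq_norm_sq_to_K, hF, sum_apply, inner_sum] at this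
      simp only [smul_apply, inner_smul_right] at this
      exact_mod_cast this
    have hn : ‖χ‖ ^ 2 = ‖((‖χ‖ ^ 2 : ℝ) : ℂ)‖ := by
      rw [Complex.norm_real, Real.norm_of_nonneg (by positivity)]
    rw [hn, e]
    refine (norm_sum_le _ _).trans (Finset.sum_le_sum fun v hv => ?_)
    rw [norm_mul, hsqrt v hv, mul_assoc]
    exact mul_le_mul_of_nonneg_left (norm_inner_le_norm _ _) (norm_nonneg _)
  -- With χ = F*ψ, the second Cauchy-Schwarz factor is ∑ ⟨χ, M v χ⟩ = ‖χ‖², which cancels unless it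
  -- is zero.
  have h2 : (‖χ‖ ^ 2) ^ 2 ≤ Q * ‖χ‖ ^ 2 := by
    calc (‖χ‖ ^ 2) ^ 2 ≤ (∑ v ∈ S, (‖f v‖ * ‖CFC.sqrt (M v) ψ‖) * ‖CFC.sqrt (M v) χ‖) ^ 2 := by
          gcongr
      _ ≤ (∑ v ∈ S, (‖f v‖ * ‖CFC.sqrt (M v) ψ‖) ^ 2) * ∑ v ∈ S, ‖CFC.sqrt (M v) χ‖ ^ 2 :=
          Finset.sum_mul_sq_le_sq_mul_sq _ _ _
      _ = Q * ‖χ‖ ^ 2 := by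
          congr 1
          · exact Finset.sum_congr rfl fun v hv => by rw [mul_pow, hre v hv]
          · rw [← hsum χ]
            exact Finset.sum_congr rfl fun v hv => (hre v hv χ).symm
  have hQ0 : 0 ≤ Q := Finset.sum_nonneg fun v hv => by rw [hre v hv]; positivity
  rcases eq_or_lt_of_le (sq_nonneg ‖χ‖) with h | h
  · rw [← h]; exact hQ0
  · nlinarith

variable {X : Type*} [MeasurableSpace X]

/-- Countable additivity for the sequence A, B, ∅, ∅, …, whose tail vanishes by `POVM.map_empty`. -/
theorem POVM.inner_union (M : POVM X H) {A B : Set X} (hA : MeasurableSet A) (hB : MeasurableSet B)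
    (hAB : Disjoint A B) (ψ : H) :
    ⟪ψ, M.toFun (A ∪ B) ψ⟫_ℂ = ⟪ψ, M.toFun A ψ⟫_ℂ + ⟪ψ, M.toFun B ψ⟫_ℂ := by
  set f : ℕ → Set X := fun n => if n = 0 then A else if n = 1 then B else ∅ with hf
  have h := M.hasSum_iUnion f (fun i => by simp only [hf]; split_ifs <;> simp [hA, hB])
    (fun i j hij => by
      simp only [hf, Function.onFun]
      split_ifs <;> simp_all [hAB.symm]) ψ
  have hU : ⋃ i, f i = A ∪ B := by
    ext x
    simp only [Set.mem_iUnion, Set.mem_union]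
    constructor
    · rintro ⟨i, hi⟩
      simp only [hf] at hi
      split_ifs at hi <;> simp_all
    · rintro (hx | hx)
      · exact ⟨0, by simpa [hf] using hx⟩
      · exact ⟨1, by simpa [hf] using hx⟩
  rw [hU] at h
  have h' := hasSum_sum_of_ne_finset_zero (f := fun i => ⟪ψ, M.toFun (f i) ψ⟫_ℂ)
    (s := Finset.range 2) (L := .unconditional ℕ) fun i hi => by
      have h0 : i ≠ 0 := by rintro rfl; simp at hi
      have h1 : i ≠ 1 := by rintro rfl; simp at hi
      simp only [hf, h0, h1, if_false]
      exact M.map_empty ψ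
  rw [h.unique h']
  simp [Finset.sum_range_succ, hf]

theorem POVM.inner_preimage_finset {Y : Type*} [MeasurableSpace Y] [MeasurableSingletonClass Y]
    (M : POVM X H) {g : X → Y} (hg : Measurable g) (S : Finset Y) (ψ : H) :
    ⟪ψ, M.toFun (g ⁻¹' S) ψ⟫_ℂ = ∑ v ∈ S, ⟪ψ, M.toFun (g ⁻¹' {v}) ψ⟫_ℂ := by
  classical
  induction S using Finset.induction_on with
  | empty => simpa using M.map_empty ψ
  | insert v S hv ih =>
    rw [Finset.sum_insert hv, ← ih, ← M.inner_union (hg (measurableSet_singleton v))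
      (hg S.measurableSet)]
    · rw [Finset.coe_insert, Set.insert_eq, Set.preimage_union]
    · exact Disjoint.preimage g (by simpa using hv)

/-- On a complex space the quadratic form determines the operator, so weak additivity upgrades to an
operator identity. -/
theorem POVM.sum_preimage_eq_one {Y : Type*} [MeasurableSpace Y] [MeasurableSingletonClass Y]
    (M : POVM X H) {g : X → Y} (hg : Measurable g) {S : Finset Y} (hS : ∀ x, g x ∈ S) :
    ∑ v ∈ S, M.toFun (g ⁻¹' {v}) = 1 := by
  have hu : g ⁻¹' (S : Set Y) = Set.univ := by ext x; simp [hS x]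
  have key : ∀ ψ : H, ⟪ψ, (∑ v ∈ S, M.toFun (g ⁻¹' {v})) ψ⟫_ℂ = ⟪ψ, ψ⟫_ℂ := by
    intro ψ
    rw [sum_apply, inner_sum, ← M.inner_preimage_finset hg, hu, M.map_univ, one_apply_eq_self]
  have := (ext_inner_map ((∑ v ∈ S, M.toFun (g ⁻¹' {v}) : H →L[ℂ] H) : H →ₗ[ℂ] H)
    ((1 : H →L[ℂ] H) : H →ₗ[ℂ] H)).1 fun ψ => by
      have e := congrArg (starRingEnd ℂ) (key ψ)
      rw [inner_conj_symm, inner_conj_symm] at e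
      exact e
  exact ContinuousLinearMap.coe_injective this

end FinitePOVM

/-! ### Lower bound for the minimax risk over squares. -/

section LowerBound

variable {X : Type*} [MeasurableSpace X] {μ : ℝ}

theorem outcomeMeasure_apply {H : Type*} [NormedAddCommGroup H] [InnerProductSpace ℂ H]
    [CompleteSpace H] (ρ : DensityOperator H) (M : POVM X H) {B : Set X} (hB : MeasurableSet B) :
    outcomeMeasure ρ M B = ENNReal.ofReal (trace (ρ.op * M.toFun B)).re :=
  Measure.ofMeasurable_apply B hB

theorem norm_sq_alpha_sub (u v : EuclideanSpace ℝ (Fin 2)) :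
    ‖alpha v - alpha u‖ ^ 2 = ‖v - u‖ ^ 2 := by
  rw [EuclideanSpace.norm_sq_eq, Fin.sum_univ_two, ← Complex.normSq_eq_norm_sq, Complex.normSq_apply]
  simp [alpha]
  ring

theorem norm_sq_sqrt_mul_alpha_sub (h1 : 1 / 2 < μ) (u v : EuclideanSpace ℝ (Fin 2)) :
    ‖(√(2 * μ - 1) : ℂ) * alpha v - √(2 * μ - 1) * alpha u‖ ^ 2 = (2 * μ - 1) * ‖v - u‖ ^ 2 := by
  rw [← mul_sub, norm_mul, mul_pow, norm_sq_alpha_sub, Complex.norm_real, Real.norm_eq_abs, sq_abs,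
    Real.sq_sqrt (by linarith)]

theorem lintegral_of_finite_range (ν : Measure X) {g : X → EuclideanSpace ℝ (Fin 2)}
    (hg : Measurable g) {S : Finset (EuclideanSpace ℝ (Fin 2))} (hS : ∀ x, g x ∈ S)
    (φ : EuclideanSpace ℝ (Fin 2) → ℝ≥0∞) :
    ∫⁻ x, φ (g x) ∂ν = ∑ v ∈ S, φ v * ν (g ⁻¹' {v}) := by
  classical
  have e : ∀ x, φ (g x) = ∑ v ∈ S, (g ⁻¹' {v}).indicator (fun _ => φ v) x := by
    intro x
    rw [Finset.sum_eq_single_of_mem (g x) (hS x) fun v _ hv => ?_]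
    · rw [Set.indicator_of_mem (by simp)]
    · rw [Set.indicator_of_notMem (by simpa using hv.symm)]
  simp only [e]
  rw [lintegral_finsetSum _ fun v _ =>
    measurable_const.indicator (hg (measurableSet_singleton v))]
  refine Finset.sum_congr rfl fun v _ => ?_
  rw [lintegral_indicator_const (hg (measurableSet_singleton v))]

/-- For a finitely valued estimator, `F = ∑ᵥ α_v M_v` satisfies
`Tr φᵘ (F - α_u)(F - α_u)* ≤ R(u)`, in the units of the displacements. -/
theorem secondMoment_le_risk (h1 : 1 / 2 < μ) (h2 : μ ≤ 1) (M : POVM X L2)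
    {g : X → EuclideanSpace ℝ (Fin 2)} (hg : Measurable g)
    {S : Finset (EuclideanSpace ℝ (Fin 2))} (hS : ∀ x, g x ∈ S) (u : EuclideanSpace ℝ (Fin 2))
    {r : ℝ} (hr : 0 ≤ r) (hrisk : risk (gaussianState μ h1 h2 u) M g u ≤ ENNReal.ofReal r) :
    secondMoment μ (∑ v ∈ S, ((√(2 * μ - 1) : ℂ) * alpha v - √(2 * μ - 1) * alpha u) •
      M.toFun (g ⁻¹' {v})) (√(2 * μ - 1) * alpha u) ≤ (2 * μ - 1) * r := by
  set z : ℂ := √(2 * μ - 1) * alpha u with hz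
  have hmv : ∀ v, MeasurableSet (g ⁻¹' {v}) := fun v => hg (measurableSet_singleton v)
  have hsum : ∀ χ : L2, ∑ v ∈ S, (⟪χ, M.toFun (g ⁻¹' {v}) χ⟫_ℂ).re = ‖χ‖ ^ 2 := by
    intro χ
    rw [← Complex.re_sum, ← inner_sum, ← sum_apply, M.sum_preimage_eq_one hg hS, one_apply_eq_self,
      inner_self_eq_norm_sq_to_K]
    norm_cast
  set P : EuclideanSpace ℝ (Fin 2) → ℝ :=
    fun v => (trace (gaussianOp μ u * M.toFun (g ⁻¹' {v}))).re with hP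
  have hPsum : ∀ v, HasSum (fun k => thermalWeight μ k * (⟪displacement z (numberState k),
      M.toFun (g ⁻¹' {v}) (displacement z (numberState k))⟫_ℂ).re) (P v) := by
    intro v
    have h := (hasSum_trace_gaussianOp h1 h2 u (M.toFun (g ⁻¹' {v}))).mapL Complex.reCLM
    simp only [Complex.reCLM_apply, Complex.re_ofReal_mul] at h
    exact h
  have hP0 : ∀ v, 0 ≤ P v := fun v => (hPsum v).nonneg fun k =>
    mul_nonneg (thermalWeight_nonneg h1 h2 k) ((M.isPositive _ (hmv v)).re_inner_nonneg_right _)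
  have hle : secondMoment μ (∑ v ∈ S, ((√(2 * μ - 1) : ℂ) * alpha v - z) •
      M.toFun (g ⁻¹' {v})) z ≤ ∑ v ∈ S, (2 * μ - 1) * ‖v - u‖ ^ 2 * P v := by
    refine hasSum_le (fun k => ?_) (hasSum_secondMoment h1 h2 _ z)
      (hasSum_sum fun v _ => (hPsum v).mul_left ((2 * μ - 1) * ‖v - u‖ ^ 2))
    have := norm_sq_adjoint_sum_smul_le S (fun v => M.toFun (g ⁻¹' {v}))
      (fun v _ => M.isPositive _ (hmv v)) hsum (fun v => (√(2 * μ - 1) : ℂ) * alpha v - z)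
      (displacement z (numberState k))
    refine (mul_le_mul_of_nonneg_left this (thermalWeight_nonneg h1 h2 k)).trans (le_of_eq ?_)
    rw [Finset.mul_sum]
    refine Finset.sum_congr rfl fun v _ => ?_
    rw [hz, norm_sq_sqrt_mul_alpha_sub h1]
    ring
  refine hle.trans ?_
  have hR : risk (gaussianState μ h1 h2 u) M g u =
      ENNReal.ofReal (∑ v ∈ S, ‖v - u‖ ^ 2 * P v) := by
    rw [risk, lintegral_of_finite_range _ hg hS fun v => ENNReal.ofReal (‖v - u‖ ^ 2),
      ENNReal.ofReal_sum_of_nonneg fun v _ => mul_nonneg (sq_nonneg _) (hP0 v)]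
    refine Finset.sum_congr rfl fun v _ => ?_
    rw [outcomeMeasure_apply _ _ (hmv v), ENNReal.ofReal_mul (sq_nonneg _)]
    rfl
  rw [hR, ENNReal.ofReal_le_ofReal_iff hr] at hrisk
  simp only [mul_assoc]
  rw [← Finset.mul_sum]
  exact mul_le_mul_of_nonneg_left hrisk (by linarith)

/-- The mean G of the operator-valued estimate F has bias at most √((2μ-1)r), and Cauchy-Schwarz
applied to F - z bounds its z-derivative. The rectangle estimate then weighs the derivative against
bias over side length. -/
theorem one_le_of_risk_le_of_finite_range (h1 : 1 / 2 < μ) (h2 : μ ≤ 1) (M : POVM X L2)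
    {g : X → EuclideanSpace ℝ (Fin 2)} (hg : Measurable g)
    {S : Finset (EuclideanSpace ℝ (Fin 2))} (hS : ∀ x, g x ∈ S) {a r : ℝ} (ha : 0 < a)
    (hr : 0 ≤ r)
    (hrisk : ∀ u ∈ square a, risk (gaussianState μ h1 h2 u) M g u ≤ ENNReal.ofReal r) :
    1 ≤ √((2 * μ - 1) * (1 - thermalRatio μ)) * √r + √r / a := by
  have hs : 0 < √(2 * μ - 1) := Real.sqrt_pos.2 (by linarith)
  have hp : 0 < 1 - thermalRatio μ := by linarith [thermalRatio_lt_one h1]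
  set F : L2 →L[ℂ] L2 := ∑ v ∈ S, ((√(2 * μ - 1) : ℂ) * alpha v) • M.toFun (g ⁻¹' {v}) with hF
  have hFz : ∀ z : ℂ, ∑ v ∈ S, ((√(2 * μ - 1) : ℂ) * alpha v - z) • M.toFun (g ⁻¹' {v}) =
      F + (-z) • 1 := by
    intro z
    rw [← M.sum_preimage_eq_one hg hS, Finset.smul_sum, hF, ← Finset.sum_add_distrib]
    refine Finset.sum_congr rfl fun v _ => ?_
    rw [← add_smul, sub_eq_add_neg]
  have hmom : ∀ z : ℂ, |z.re| ≤ √(2 * μ - 1) * a → |z.im| ≤ √(2 * μ - 1) * a →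
      secondMoment μ (F + (-z) • 1) z ≤ (2 * μ - 1) * r := by
    intro z hre him
    -- The inverse of u ↦ √(2μ-1) α_u; it carries the square of half-width √(2μ-1) a in ℂ to `square
    -- a`.
    set u : EuclideanSpace ℝ (Fin 2) := !₂[z.im / √(2 * μ - 1), -z.re / √(2 * μ - 1)] with hu
    have hzu : √(2 * μ - 1) * alpha u = z := by
      have : (√(2 * μ - 1) : ℂ) ≠ 0 := by exact_mod_cast hs.ne'
      simp only [alpha, hu]
      simp
      field_simp
      rw [mul_comm Complex.I, Complex.re_add_im]
    have husq : u ∈ square a := by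
      intro i
      have key : ∀ t : ℝ, |t| ≤ √(2 * μ - 1) * a → |t / √(2 * μ - 1)| ≤ a := by
        intro t ht
        rw [abs_div, abs_of_pos hs, div_le_iff₀ hs, mul_comm]
        exact ht
      fin_cases i
      · exact abs_le.1 (key _ him)
      · exact abs_le.1 (key (-z.re) (by rwa [abs_neg]))
    have := secondMoment_le_risk h1 h2 M hg hS u hr (hrisk u husq)
    rwa [hzu, hFz] at this
  have hmean : ∀ z, thermalMean μ (F + (-z) • 1) z = thermalMean μ F z - z := by
    intro z
    rw [thermalMean_add h1 h2, thermalMean_smul h1 h2, thermalMean_one h1 h2]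
    ring
  have hcre : ∀ z, creationMean μ (F + (-z) • 1) z = creationMean μ F z := by
    intro z
    rw [creationMean_add h1 h2, creationMean_smul h1 h2, creationMean_one]
    ring
  have key := one_le_of_norm_sub_id_le (G := thermalMean μ F)
    (α := fun z => (1 - thermalRatio μ) * creationMean μ F z)
    (β := fun z => (1 - thermalRatio μ) * annihilationMean μ F z)
    (b := √(2 * μ - 1) * a) (c := √((2 * μ - 1) * (1 - thermalRatio μ)) * √r)
    (e := √(2 * μ - 1) * √r) (fun z => ?_) (by positivity) (fun z hre him => ?_)
    fun z hre him => ?_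
  · rwa [mul_div_mul_left _ _ hs.ne'] at key
  · obtain ⟨L, hL, hL'⟩ := exists_hasFDerivAt_thermalMean h1 h2 F z
    exact ⟨L, hL, fun ζ => by rw [hL']; ring⟩
  · have h := norm_sq_creationMean_le h1 h2 (F + (-z) • 1) z
    rw [hcre] at h
    have h' : ‖creationMean μ F z‖ ^ 2 ≤ (2 * μ - 1) * r * (1 - thermalRatio μ)⁻¹ :=
      h.trans (mul_le_mul_of_nonneg_right (hmom z hre him) (by positivity))
    rw [← Real.sqrt_mul (mul_nonneg (by linarith) hp.le)]
    refine Real.le_sqrt_of_sq_le ?_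
    rw [norm_mul, mul_pow, ← Complex.ofReal_one, ← Complex.ofReal_sub, Complex.norm_real,
      Real.norm_of_nonneg hp.le]
    calc (1 - thermalRatio μ) ^ 2 * ‖creationMean μ F z‖ ^ 2
        ≤ (1 - thermalRatio μ) ^ 2 * ((2 * μ - 1) * r * (1 - thermalRatio μ)⁻¹) := by gcongr
      _ = (2 * μ - 1) * (1 - thermalRatio μ) * r := by field_simp
  · have h := (norm_sq_thermalMean_le h1 h2 (F + (-z) • 1) z).trans (hmom z hre him)
    rw [hmean] at h
    rw [← Real.sqrt_mul (by linarith)]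
    exact Real.le_sqrt_of_sq_le h

/-- Clamping to `[-a, a]` followed by rounding down to a multiple of `δ`. -/
def clampRound (a δ x : ℝ) : ℝ := δ * ⌊max (-a) (min a x) / δ⌋

theorem measurable_clampRound (a δ : ℝ) : Measurable (clampRound a δ) := by
  unfold clampRound
  have h : Measurable fun x : ℝ => ⌊max (-a) (min a x) / δ⌋ :=
    Int.measurable_floor.comp (by fun_prop)
  exact (measurable_from_top.comp h : Measurable fun x : ℝ =>
    ((⌊max (-a) (min a x) / δ⌋ : ℤ) : ℝ)).const_mul δ

theorem clampRound_mem {a δ : ℝ} (ha : 0 < a) (hδ : 0 < δ) (x : ℝ) : clampRound a δ x ∈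
    (Finset.Icc ⌊-a / δ⌋ ⌊a / δ⌋).image fun n : ℤ => δ * (n : ℝ) := by
  refine Finset.mem_image.2 ⟨_, Finset.mem_Icc.2 ⟨Int.floor_le_floor ?_, Int.floor_le_floor ?_⟩, rfl⟩
  · gcongr
    exact le_max_left _ _
  · gcongr
    exact max_le (by linarith) (min_le_left _ _)

/-- Clamping does not increase the distance to a point of [-a, a], and rounding adds at most δ. The
cross term is split by 2dδ ≤ δd² + δ, so the factor tends to 1 and the additive error to 0. -/
theorem sq_clampRound_sub_le {a δ : ℝ} (hδ : 0 < δ) (x : ℝ) {t : ℝ}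
    (ht : t ∈ Set.Icc (-a) a) : (clampRound a δ x - t) ^ 2 ≤ (1 + δ) * (x - t) ^ 2 + (δ + δ ^ 2) := by
  set y := max (-a) (min a x) with hy
  have e1 : clampRound a δ x ≤ y := by
    rw [clampRound, ← hy, mul_comm, ← le_div_iff₀ hδ]; exact Int.floor_le _
  have e2 : y - δ ≤ clampRound a δ x := by
    have := (Int.lt_floor_add_one (y / δ)).le
    rw [div_le_iff₀ hδ] at this
    rw [clampRound, ← hy]; linarith
  have e3 : |y - t| ≤ |x - t| := by
    obtain ⟨h1, h2⟩ := ht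
    rcases le_total a x with h | h
    · rw [hy, min_eq_left h, max_eq_right (by linarith), abs_of_nonneg (by linarith),
        abs_of_nonneg (by linarith)]
      linarith
    · rw [min_eq_right h] at hy
      rcases le_total (-a) x with h' | h'
      · rw [hy, max_eq_right h']
      · rw [hy, max_eq_left h', abs_of_nonpos (by linarith), abs_of_nonpos (by linarith)]
        linarith
  have e4 : |clampRound a δ x - t| ≤ |x - t| + δ := by
    have : |clampRound a δ x - y| ≤ δ := abs_le.2 ⟨by linarith, by linarith⟩
    have h := abs_sub_le (clampRound a δ x) y t
    linarith
  calc (clampRound a δ x - t) ^ 2 = |clampRound a δ x - t| ^ 2 := (sq_abs _).symm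
    _ ≤ (|x - t| + δ) ^ 2 := by gcongr
    _ ≤ (1 + δ) * |x - t| ^ 2 + (δ + δ ^ 2) := by
      nlinarith [mul_nonneg hδ.le (sq_nonneg (|x - t| - 1))]
    _ = _ := by rw [sq_abs]

/-- Clamping and rounding make the estimator finitely valued, so that F is a finite sum and hence
bounded. The loss in risk disappears as δ → 0. -/
theorem one_le_of_risk_le (h1 : 1 / 2 < μ) (h2 : μ ≤ 1) (M : POVM X L2)
    {est : X → EuclideanSpace ℝ (Fin 2)} (hest : Measurable est) {a r : ℝ} (ha : 0 < a)
    (hr : 0 ≤ r)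
    (hrisk : ∀ u ∈ square a, risk (gaussianState μ h1 h2 u) M est u ≤ ENNReal.ofReal r) :
    1 ≤ √((2 * μ - 1) * (1 - thermalRatio μ)) * √r + √r / a := by
  have key : ∀ δ : ℝ, 0 < δ → 1 ≤ √((2 * μ - 1) * (1 - thermalRatio μ)) *
      √((1 + δ) * r + 2 * (δ + δ ^ 2)) + √((1 + δ) * r + 2 * (δ + δ ^ 2)) / a := by
    intro δ hδ
    set g : X → EuclideanSpace ℝ (Fin 2) :=
      fun x => !₂[clampRound a δ (est x 0), clampRound a δ (est x 1)] with hgdef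
    have hc : ∀ i : Fin 2, Measurable fun x => est x i := fun i =>
      (EuclideanSpace.proj (𝕜 := ℝ) i).continuous.measurable.comp hest
    have hg : Measurable g := by
      have h : Measurable fun x =>
          (![clampRound a δ (est x 0), clampRound a δ (est x 1)] : Fin 2 → ℝ) := by
        refine measurable_pi_lambda _ fun i => ?_
        fin_cases i
        · exact (measurable_clampRound a δ).comp (hc 0)
        · exact (measurable_clampRound a δ).comp (hc 1)
      exact (MeasurableEquiv.toLp 2 (Fin 2 → ℝ)).measurable.comp h
    classical
    set T := (Finset.Icc ⌊-a / δ⌋ ⌊a / δ⌋).image fun n : ℤ => δ * (n : ℝ) with hT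
    set S : Finset (EuclideanSpace ℝ (Fin 2)) := (T ×ˢ T).image fun q => !₂[q.1, q.2] with hS
    have hgS : ∀ x, g x ∈ S := fun x => Finset.mem_image.2
      ⟨(clampRound a δ (est x 0), clampRound a δ (est x 1)),
        Finset.mem_product.2 ⟨clampRound_mem ha hδ _, clampRound_mem ha hδ _⟩, rfl⟩
    refine one_le_of_risk_le_of_finite_range h1 h2 M hg hgS ha (by positivity) fun u hu => ?_
    have hpt : ∀ x, ‖g x - u‖ ^ 2 ≤ (1 + δ) * ‖est x - u‖ ^ 2 + 2 * (δ + δ ^ 2) := by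
      intro x
      rw [EuclideanSpace.norm_sq_eq, EuclideanSpace.norm_sq_eq, Fin.sum_univ_two, Fin.sum_univ_two]
      have i0 := sq_clampRound_sub_le hδ (est x 0) (hu 0)
      have i1 := sq_clampRound_sub_le hδ (est x 1) (hu 1)
      simp only [hgdef, PiLp.sub_apply, Real.norm_eq_abs, sq_abs,
        Matrix.cons_val_zero, Matrix.cons_val_one]
      linarith
    have hprob : outcomeMeasure (gaussianState μ h1 h2 u) M Set.univ = 1 := by
      rw [outcomeMeasure_apply _ _ .univ, M.map_univ, mul_one,
        (gaussianState μ h1 h2 u).trace_eq_one]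
      simp
    calc risk (gaussianState μ h1 h2 u) M g u
        ≤ ∫⁻ x, (ENNReal.ofReal (1 + δ) * ENNReal.ofReal (‖est x - u‖ ^ 2) +
            ENNReal.ofReal (2 * (δ + δ ^ 2))) ∂(outcomeMeasure (gaussianState μ h1 h2 u) M) := by
          refine lintegral_mono fun x => ?_
          rw [← ENNReal.ofReal_mul (by positivity),
            ← ENNReal.ofReal_add (by positivity) (by positivity)]
          exact ENNReal.ofReal_le_ofReal (hpt x)
      _ = ENNReal.ofReal (1 + δ) * risk (gaussianState μ h1 h2 u) M est u +
            ENNReal.ofReal (2 * (δ + δ ^ 2)) := by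
          rw [lintegral_add_right _ measurable_const, lintegral_const, hprob, mul_one,
            lintegral_const_mul _ (by fun_prop)]
          rfl
      _ ≤ ENNReal.ofReal (1 + δ) * ENNReal.ofReal r + ENNReal.ofReal (2 * (δ + δ ^ 2)) := by
          gcongr
          exact hrisk u hu
      _ = _ := by
          rw [← ENNReal.ofReal_mul (by positivity),
            ← ENNReal.ofReal_add (by positivity) (by positivity)]
  have hcont : Continuous fun δ : ℝ => √((2 * μ - 1) * (1 - thermalRatio μ)) *
      √((1 + δ) * r + 2 * (δ + δ ^ 2)) + √((1 + δ) * r + 2 * (δ + δ ^ 2)) / a := by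
    fun_prop
  have hlim := (hcont.tendsto 0).mono_left (nhdsWithin_le_nhds (s := Set.Ioi 0))
  have := ge_of_tendsto hlim (by filter_upwards [self_mem_nhdsWithin] with δ hδ using key δ hδ)
  simpa using this

/-- A lower bound for the minimax risk over the square `[-a, a]²`. -/
def squareLowerBound (μ a : ℝ) : ℝ := ((√((2 * μ - 1) * (1 - thermalRatio μ)) + 1 / a) ^ 2)⁻¹

theorem squareLowerBound_le_minimaxRisk (h1 : 1 / 2 < μ) (h2 : μ ≤ 1) {a : ℝ} (ha : 0 < a) :
    ENNReal.ofReal (squareLowerBound μ a) ≤ minimaxRisk (gaussianState μ h1 h2) (square a) := by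
  refine le_iInf fun X => le_iInf fun _ => le_iInf fun M => le_iInf fun est => le_iInf fun hest => ?_
  set R := worstCaseRisk (gaussianState μ h1 h2) (square a) M est with hR
  rcases eq_or_ne R ⊤ with htop | htop
  · rw [htop]; exact le_top
  · rw [← ENNReal.ofReal_toReal htop]
    refine ENNReal.ofReal_le_ofReal ?_
    have h := one_le_of_risk_le h1 h2 M hest ha (r := R.toReal) ENNReal.toReal_nonneg fun u hu => by
      rw [ENNReal.ofReal_toReal htop]
      exact le_iSup₂ (f := fun u _ => risk (gaussianState μ h1 h2 u) M est u) u hu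
    have hp : 0 < 1 - thermalRatio μ := by linarith [thermalRatio_lt_one h1]
    have hs : 0 < 2 * μ - 1 := by linarith
    set K := √((2 * μ - 1) * (1 - thermalRatio μ)) + 1 / a with hK
    have hK0 : 0 < K := by positivity
    have h' : 1 ≤ K * √R.toReal := by
      refine h.trans (le_of_eq ?_)
      rw [hK]; ring
    rw [squareLowerBound, ← hK, inv_le_iff_one_le_mul₀ (by positivity)]
    calc (1 : ℝ) ≤ (K * √R.toReal) ^ 2 := one_le_pow₀ h'
      _ = R.toReal * K ^ 2 := by rw [mul_pow, Real.sq_sqrt ENNReal.toReal_nonneg, mul_comm]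

theorem tendsto_squareLowerBound (h1 : 1 / 2 < μ) :
    Filter.Tendsto (fun a => ENNReal.ofReal (squareLowerBound μ a)) Filter.atTop
      (nhds (ENNReal.ofReal (optimalRisk μ))) := by
  have hp : 0 < 1 - thermalRatio μ := by linarith [thermalRatio_lt_one h1]
  have hs : 0 < 2 * μ - 1 := by linarith
  refine ENNReal.tendsto_ofReal ?_
  have h0 : Filter.Tendsto (fun a : ℝ => 1 / a) Filter.atTop (nhds 0) := by
    simpa using tendsto_inv_atTop_zero (𝕜 := ℝ)
  have h := ((h0.const_add √((2 * μ - 1) * (1 - thermalRatio μ))).pow 2).inv₀ (by positivity)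
  rw [add_zero, Real.sq_sqrt (by positivity)] at h
  exact h

end LowerBound

/-! ### Plancherel's theorem for the Fourier integral. -/

section Plancherel

open FourierTransform

theorem integral_fourier_mul_eq_of_integrable {f : ℝ → ℂ} (hf : Integrable f)
    (φ : SchwartzMap ℝ ℂ) : ∫ x, φ x • 𝓕 f x = ∫ x, 𝓕 φ x • f x := by
  have h := VectorFourier.integral_bilin_fourierIntegral_eq_flip (ContinuousLinearMap.mul ℂ ℂ)
    (L := innerₗ ℝ) (μ := volume) (ν := volume) (f := φ) (g := f) Real.continuous_fourierChar
    continuous_inner φ.integrable hf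
  simp only [ContinuousLinearMap.mul_apply', flip_innerₗ] at h
  exact h.symm

/-- Both transforms have the same integral against every smooth compactly supported function: the L²
one through tempered distributions, the integral one through the multiplication formula. Local
integrability then gives equality almost everywhere. -/
theorem fourier_toLp_ae_eq {f : ℝ → ℂ} (hf : Integrable f) (hf2 : MemLp f 2 volume) :
    (𝓕 (hf2.toLp f) : Lp ℂ 2 (volume : Measure ℝ)) =ᵐ[volume] 𝓕 f := by
  have hc : Continuous (𝓕 f) :=
    VectorFourier.fourierIntegral_continuous Real.continuous_fourierChar
      (innerSL ℝ).continuous₂ hf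
  refine ae_eq_of_integral_contDiff_smul_eq
    ((Lp.memLp (𝓕 (hf2.toLp f))).locallyIntegrable (by norm_num)) hc.locallyIntegrable
    fun g hg hgs => ?_
  have hg' : ContDiff ℝ (⊤ : ℕ∞) fun x => (g x : ℂ) := Complex.ofRealCLM.contDiff.comp hg
  have hgs' : HasCompactSupport fun x => (g x : ℂ) :=
    hgs.comp_left (g := fun r : ℝ => (r : ℂ)) Complex.ofReal_zero
  set φ := hgs'.toSchwartzMap hg' with hφ
  have e : ∀ x, φ x = (g x : ℂ) := fun x => rfl
  have h1 := congrArg (fun T => T φ) (Lp.fourier_toTemperedDistribution_eq (hf2.toLp f))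
  simp only [TemperedDistribution.fourier_apply, Lp.toTemperedDistribution_apply] at h1
  have h2 := integral_fourier_mul_eq_of_integrable hf φ
  have h3 : ∫ x, 𝓕 φ x • (hf2.toLp f) x = ∫ x, 𝓕 φ x • f x :=
    integral_congr_ae (by filter_upwards [hf2.coeFn_toLp] with x hx; rw [hx])
  have h4 : ∫ x, φ x • (𝓕 (hf2.toLp f) : Lp ℂ 2 (volume : Measure ℝ)) x = ∫ x, φ x • 𝓕 f x := by
    rw [h2, ← h3, ← h1]
  simpa only [e, Complex.coe_smul] using h4

/-- **Plancherel's theorem** for functions in `L¹ ∩ L²`. -/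
theorem lintegral_enorm_fourier_sq {f : ℝ → ℂ} (hf : Integrable f) (hf2 : MemLp f 2 volume) :
    ∫⁻ w, ‖𝓕 f w‖ₑ ^ 2 = ∫⁻ x, ‖f x‖ₑ ^ 2 := by
  have key : eLpNorm (𝓕 f) 2 volume = eLpNorm f 2 volume := by
    rw [← eLpNorm_congr_ae (fourier_toLp_ae_eq hf hf2), ← Lp.enorm_def, ← enorm_norm,
      Lp.norm_fourier_eq, enorm_norm, Lp.enorm_def, eLpNorm_congr_ae hf2.coeFn_toLp]
  have h := eLpNorm_nnreal_pow_eq_lintegral (f := 𝓕 f) (μ := volume) (p := 2) (by norm_num)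
  have h' := eLpNorm_nnreal_pow_eq_lintegral (f := f) (μ := volume) (p := 2) (by norm_num)
  simp only [NNReal.coe_ofNat, ENNReal.rpow_ofNat, ENNReal.coe_ofNat] at h h'
  rw [← h, ← h', key]

theorem lintegral_comp_mul_left {φ : ℝ → ℝ≥0∞} (hφ : Measurable φ) {c : ℝ} (hc : c ≠ 0) :
    ∫⁻ x, φ (c * x) = ENNReal.ofReal |c⁻¹| * ∫⁻ x, φ x := by
  have h := lintegral_map (μ := volume) hφ (measurable_const_mul c)
  rw [Real.map_volume_mul_left hc, lintegral_smul_measure] at h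
  exact h.symm

end Plancherel

/-! ### Overlaps of number states with coherent states. -/

section Overlap

/-- Half of the Gaussian bounds the polynomial; the other half makes the exponential integrable. -/
theorem integrable_aeval_mul_exp_quadratic (P : Polynomial ℤ) (z : ℂ) :
    Integrable fun y : ℝ => ((Polynomial.aeval y P * Real.exp (-y ^ 2 / 2) : ℝ) : ℂ) *
      Complex.exp (z * y) := by
  obtain ⟨C, hC⟩ := exists_abs_aeval_mul_exp_le P
  have hi := integrable_cexp_quadratic' (b := -(1 / 4 : ℂ)) (by norm_num) z 0
  have hP := P.continuous_aeval (A := ℝ)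
  have := hi.bdd_mul (c := C)
    (f := fun y : ℝ => ((Polynomial.aeval y P * Real.exp (-y ^ 2 / 4) : ℝ) : ℂ))
    (Continuous.aestronglyMeasurable (by fun_prop)) (Filter.Eventually.of_forall fun y => ?_)
  · refine this.congr (Filter.Eventually.of_forall fun y => ?_)
    have e : Real.exp (-y ^ 2 / 2) = Real.exp (-y ^ 2 / 4) * Real.exp (-y ^ 2 / 4) := by
      rw [← Real.exp_add]; congr 1; ring
    have e' : Complex.exp (-(1 / 4 : ℂ) * y ^ 2 + z * y + 0) =
        (Real.exp (-y ^ 2 / 4) : ℝ) * Complex.exp (z * y) := by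
      rw [Complex.ofReal_exp, ← Complex.exp_add]; congr 1; push_cast; ring
    simp only [e, e']
    push_cast
    ring
  · rw [Complex.norm_real, norm_mul, Real.norm_eq_abs, Real.norm_of_nonneg (Real.exp_pos _).le]
    exact hC y

/-- The exponential generating integral of the Hermite polynomials. -/
theorem integral_hermite_mul_exp (k : ℕ) (z : ℂ) :
    ∫ y : ℝ, ((Polynomial.aeval y (Polynomial.hermite k) * Real.exp (-y ^ 2 / 2) : ℝ) : ℂ) *
      Complex.exp (z * y) = z ^ k * (√(2 * Real.pi) * Complex.exp (z ^ 2 / 2)) := by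
  induction k with
  | zero =>
    have h := integral_cexp_quadratic (b := -(1 / 2 : ℂ)) (by norm_num) z 0
    have e : ∀ y : ℝ, ((Polynomial.aeval y (Polynomial.hermite 0) * Real.exp (-y ^ 2 / 2) : ℝ) : ℂ) *
        Complex.exp (z * y) = Complex.exp (-(1 / 2 : ℂ) * y ^ 2 + z * y + 0) := by
      intro y
      simp only [Polynomial.hermite_zero, map_one, one_mul]
      rw [Complex.ofReal_exp, ← Complex.exp_add]
      congr 1
      push_cast
      ring
    simp only [e]
    rw [h, pow_zero, one_mul]
    congr 1
    · rw [show (Real.pi / -(-(1 / 2 : ℂ)) : ℂ) = ((2 * Real.pi : ℝ) : ℂ) by push_cast; ring,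
        Real.sqrt_eq_rpow, Complex.ofReal_cpow (by positivity)]
      push_cast
      rfl
    · congr 1
      ring
  | succ k ih =>
    have hu : ∀ y : ℝ, HasDerivAt (fun y : ℝ => Complex.exp (z * y)) (z * Complex.exp (z * y)) y := by
      intro y
      have := ((hasDerivAt_id (y : ℂ)).const_mul z).cexp.comp_ofReal
      refine this.congr_deriv ?_
      simp [mul_comm]
    have hv : ∀ y : ℝ, HasDerivAt
        (fun y : ℝ => ((Polynomial.aeval y (Polynomial.hermite k) * Real.exp (-y ^ 2 / 2) : ℝ) : ℂ))
        (-((Polynomial.aeval y (Polynomial.hermite (k + 1)) * Real.exp (-y ^ 2 / 2) : ℝ) : ℂ)) y := by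
      intro y
      have h1 := (Polynomial.hermite k).hasDerivAt_aeval y
      have h2 : HasDerivAt (fun y : ℝ => Real.exp (-y ^ 2 / 2)) (Real.exp (-y ^ 2 / 2) * (-y)) y := by
        refine HasDerivAt.exp ?_
        exact (((hasDerivAt_pow 2 y).fun_neg).div_const 2).congr_deriv (by simp; ring)
      refine (h1.fun_mul h2).ofReal_comp.congr_deriv ?_
      rw [Polynomial.hermite_succ, map_sub, map_mul, Polynomial.aeval_X]
      push_cast
      ring
    have i1 := integrable_aeval_mul_exp_quadratic (Polynomial.hermite (k + 1)) z
    have i2 := integrable_aeval_mul_exp_quadratic (Polynomial.hermite k) z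
    have h := integral_mul_deriv_eq_deriv_mul_of_integrable (fun y _ => hu y) (fun y _ => hv y)
      (i1.neg.congr (Filter.Eventually.of_forall fun y => by
        simp only [Pi.neg_apply, Pi.mul_apply]; ring))
      ((i2.const_mul z).congr (Filter.Eventually.of_forall fun y => by
        simp only [Pi.mul_apply]; ring))
      (i2.congr (Filter.Eventually.of_forall fun y => by simp only [Pi.mul_apply]; ring))
    calc _ = -∫ y : ℝ, Complex.exp (z * y) *
          -((Polynomial.aeval y (Polynomial.hermite (k + 1)) * Real.exp (-y ^ 2 / 2) : ℝ) : ℂ) := by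
          rw [← integral_neg]
          congr 1 with y
          ring
      _ = z * ∫ y : ℝ, ((Polynomial.aeval y (Polynomial.hermite k) *
          Real.exp (-y ^ 2 / 2) : ℝ) : ℂ) * Complex.exp (z * y) := by
          rw [h, neg_neg, ← integral_const_mul]
          congr 1 with y
          ring
      _ = _ := by rw [ih]; ring

/-- The translated vacuum is a Gaussian times a complex exponential, so after y = √2 x the overlap
is the generating integral of Heₖ. Its squared modulus is the Poisson law of parameter ‖z‖². -/
theorem norm_sq_inner_vacuum (k : ℕ) (z : ℂ) :
    ‖⟪numberState k, displacement z (numberState 0)⟫_ℂ‖ ^ 2 =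
      Real.exp (-‖z‖ ^ 2) * (‖z‖ ^ 2) ^ k / k.factorial := by
  have hc0 := hermiteNorm_pos 0
  have hck := hermiteNorm_pos k
  have h22 : √2 * √2 = (2 : ℝ) := Real.mul_self_sqrt (by norm_num)
  set K : ℂ := Complex.exp (-((z.re : ℂ) ^ 2) - z.re * z.im * Complex.I) /
    (hermiteNorm k * hermiteNorm 0) with hK
  have hval : ⟪numberState k, displacement z (numberState 0)⟫_ℂ =
      K * ((√2)⁻¹ * (z ^ k * (√(2 * Real.pi) * Complex.exp (z ^ 2 / 2)))) := by
    rw [L2.inner_def, ← integral_hermite_mul_exp]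
    set φ : ℝ → ℂ := fun y => ((Polynomial.aeval y (Polynomial.hermite k) *
      Real.exp (-y ^ 2 / 2) : ℝ) : ℂ) * Complex.exp (z * y) with hφ
    have hscale := Measure.integral_comp_mul_left φ √2
    rw [abs_of_pos (by positivity), Complex.real_smul] at hscale
    rw [← hscale, ← integral_const_mul]
    refine integral_congr_ae ?_
    have hsh := (measurePreserving_sub_right volume (√2 * z.re)).quasiMeasurePreserving.ae
      (coeFn_numberState 0)
    filter_upwards [coeFn_numberState k, hsh,
      coeFn_weyl (√2 * z.re) (√2 * z.im) (numberState 0)] with t h1 h2 h3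
    rw [h1, displacement_apply, h3, h2]
    have hexp : Real.exp (-(t - √2 * z.re) ^ 2 / 2) * Real.exp (-t ^ 2 / 2) =
        Real.exp (-(√2 * t) ^ 2 / 2) * Real.exp (z.re * (√2 * t)) * Real.exp (-(z.re ^ 2)) := by
      rw [← Real.exp_add, ← Real.exp_add, ← Real.exp_add]
      congr 1
      linear_combination (t ^ 2 / 2 - z.re ^ 2 / 2) * h22
    have hph : weylPhase (√2 * z.re) (√2 * z.im) t =
        Complex.exp (z.im * (√2 * t) * Complex.I) * Complex.exp (-(z.re * z.im * Complex.I)) := by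
      rw [weylPhase, ← Complex.exp_add]
      congr 1
      have : ((√2 : ℝ) : ℂ) * √2 = 2 := by exact_mod_cast h22
      push_cast
      linear_combination (-(z.re * z.im) / 2 * Complex.I) * this
    have hz : Complex.exp (z * ((√2 * t : ℝ) : ℂ)) =
        ((Real.exp (z.re * (√2 * t)) : ℝ) : ℂ) * Complex.exp (z.im * (√2 * t) * Complex.I) := by
      rw [Complex.ofReal_exp, ← Complex.exp_add]
      congr 1
      nth_rw 1 [← Complex.re_add_im z]
      push_cast
      ring
    have hK' : Complex.exp (-((z.re : ℂ) ^ 2) - z.re * z.im * Complex.I) =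
        ((Real.exp (-(z.re ^ 2)) : ℝ) : ℂ) * Complex.exp (-(z.re * z.im * Complex.I)) := by
      rw [Complex.ofReal_exp, ← Complex.exp_add]
      congr 1
      push_cast
      ring
    have a1 : (hermiteNorm 0 : ℂ) ≠ 0 := by exact_mod_cast hc0.ne'
    have a2 : (hermiteNorm k : ℂ) ≠ 0 := by exact_mod_cast hck.ne'
    rw [RCLike.inner_apply, Complex.conj_ofReal, hph, hermiteFun_eq k, hermiteFun_eq 0]
    simp only [hφ, hK, Polynomial.hermite_zero, map_one, one_mul]
    rw [hK', hz]
    -- Once the exponentials are opaque, the integrands differ only by the polynomial relation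
    -- `hexp`.
    generalize Real.exp (-(t - √2 * z.re) ^ 2 / 2) = r1 at hexp ⊢
    generalize Real.exp (-t ^ 2 / 2) = r2 at hexp ⊢
    generalize Real.exp (-(√2 * t) ^ 2 / 2) = r3 at hexp ⊢
    generalize Real.exp (z.re * (√2 * t)) = r4 at hexp ⊢
    generalize Real.exp (-(z.re ^ 2)) = r5 at hexp ⊢
    generalize Complex.exp (z.im * (√2 * t) * Complex.I) = c1
    generalize Complex.exp (-(z.re * z.im * Complex.I)) = c2
    generalize Polynomial.aeval (√2 * t) (Polynomial.hermite k) = P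
    have hexp' : (r1 * r2 : ℂ) = r3 * r4 * r5 := by exact_mod_cast hexp
    push_cast
    field_simp
    linear_combination (c1 * c2 * P) * hexp'
  have n1 : ‖Complex.exp (-((z.re : ℂ) ^ 2) - z.re * z.im * Complex.I)‖ = Real.exp (-(z.re ^ 2)) := by
    rw [Complex.norm_exp]
    congr 1
    rw [← Complex.ofReal_pow, ← Complex.ofReal_mul]
    simp only [Complex.sub_re, Complex.neg_re, Complex.ofReal_re, Complex.mul_re, Complex.ofReal_im,
      Complex.I_re, Complex.I_im]
    ring
  have n2 : ‖Complex.exp (z ^ 2 / 2)‖ = Real.exp ((z.re ^ 2 - z.im ^ 2) / 2) := by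
    rw [Complex.norm_exp]
    congr 1
    rw [Complex.div_ofNat_re, sq, Complex.mul_re]
    ring
  have hnz : ‖z‖ ^ 2 = z.re ^ 2 + z.im ^ 2 := by
    rw [← Complex.normSq_eq_norm_sq, Complex.normSq_apply]; ring
  rw [hval, hK, norm_mul, norm_div, norm_mul, norm_mul, norm_mul, norm_mul, norm_pow, n1, n2,
    Complex.norm_real, Complex.norm_real, Complex.norm_real, Complex.norm_real,
    Real.norm_of_nonneg hc0.le, Real.norm_of_nonneg hck.le, Real.norm_of_nonneg (by positivity),
    Real.norm_of_nonneg (by positivity)]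
  have e : Real.exp (-‖z‖ ^ 2) =
      (Real.exp (-(z.re ^ 2)) * Real.exp ((z.re ^ 2 - z.im ^ 2) / 2)) ^ 2 := by
    rw [← Real.exp_add, ← Real.exp_nat_mul, hnz]
    congr 1
    push_cast
    ring
  have c0 : hermiteNorm 0 ^ 2 = √Real.pi := by
    rw [hermiteNorm, Real.sq_sqrt (by positivity)]; simp
  have ck : hermiteNorm k ^ 2 = √Real.pi * k.factorial := by
    rw [hermiteNorm, Real.sq_sqrt (by positivity)]
  have hpp : √Real.pi * √Real.pi = Real.pi := Real.mul_self_sqrt Real.pi_pos.le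
  have h2p : √(2 * Real.pi) ^ 2 = 2 * Real.pi := Real.sq_sqrt (by positivity)
  have hs2 : √2 ^ 2 = (2 : ℝ) := Real.sq_sqrt (by norm_num)
  have hfac : (k.factorial : ℝ) ≠ 0 := by positivity
  have hsp : √Real.pi ≠ 0 := by positivity
  calc _ = (Real.exp (-(z.re ^ 2)) * Real.exp ((z.re ^ 2 - z.im ^ 2) / 2)) ^ 2 * (‖z‖ ^ 2) ^ k *
        √(2 * Real.pi) ^ 2 / (hermiteNorm k ^ 2 * hermiteNorm 0 ^ 2 * √2 ^ 2) := by
        field_simp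
        ring
    _ = _ := by
        rw [← e, c0, ck, h2p, hs2]
        field_simp
        linear_combination (-(‖z‖ ^ (k * 2))) * hpp

end Overlap

/-! ### Resolution of the identity by coherent states. -/

section Resolution

open FourierTransform

theorem exists_abs_hermiteFun_le (n : ℕ) : ∃ C : ℝ, ∀ x, |hermiteFun n x| ≤ C := by
  obtain ⟨C, h0, hC⟩ := decaysFast_hermiteFun n
  refine ⟨C, fun x => le_trans ?_ (hC x)⟩
  exact le_mul_of_one_le_right (abs_nonneg _) (one_le_pow₀ (by nlinarith [sq_nonneg x]))

/-- The product of a wave function with the vacuum translated by `q`. -/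
def windowed (ψ : L2) (q t : ℝ) : ℂ := (hermiteFun 0 (t - q) : ℂ) * ψ t

theorem memLp_windowed (ψ : L2) (q : ℝ) : MemLp (windowed ψ q) 2 volume := by
  obtain ⟨C, hC⟩ := exists_abs_hermiteFun_le 0
  have hc := continuous_hermiteFun 0
  refine (Lp.memLp ψ).of_le_mul (c := C) ?_ (Filter.Eventually.of_forall fun t => ?_)
  · exact (Continuous.aestronglyMeasurable (by fun_prop)).mul (Lp.aestronglyMeasurable ψ)
  · rw [windowed, norm_mul, Complex.norm_real]
    exact mul_le_mul_of_nonneg_right (hC _) (norm_nonneg _)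

theorem integrable_windowed (ψ : L2) (q : ℝ) : Integrable (windowed ψ q) := by
  have h := (memLp_hermiteFun 0).comp_measurePreserving (measurePreserving_sub_right volume q)
  exact h.integrable_mul (Lp.memLp ψ)

/-- For fixed q the overlap is, up to a phase, a windowed Fourier transform in p. The frequency is
p/(2π) because of the normalisation of `𝓕`; this is the source of the factor 2π in Moyal's identity.
-/
theorem enorm_inner_weyl_vacuum (ψ : L2) (q p : ℝ) :
    ‖⟪weyl q p (numberState 0), ψ⟫_ℂ‖ₑ = ‖𝓕 (windowed ψ q) ((2 * Real.pi)⁻¹ * p)‖ₑ := by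
  have e : ⟪weyl q p (numberState 0), ψ⟫_ℂ =
      Complex.exp ((p * q / 2 : ℝ) * Complex.I) * 𝓕 (windowed ψ q) ((2 * Real.pi)⁻¹ * p) := by
    rw [L2.inner_def, Real.fourier_eq, ← integral_const_mul]
    refine integral_congr_ae ?_
    have hsh := (measurePreserving_sub_right volume q).quasiMeasurePreserving.ae
      (coeFn_numberState 0)
    filter_upwards [coeFn_weyl q p (numberState 0), hsh] with t h1 h2
    have hph : starRingEnd ℂ (weylPhase q p t) = Complex.exp ((p * q / 2 : ℝ) * Complex.I) *
        Complex.exp ((-(p * t) : ℝ) * Complex.I) := by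
      rw [weylPhase, ← Complex.exp_conj, ← Complex.exp_add]
      congr 1
      rw [map_mul, Complex.conj_ofReal, Complex.conj_I]
      push_cast
      ring
    rw [h1, h2, RCLike.inner_apply, map_mul, hph, Complex.conj_ofReal, windowed, Circle.smul_def,
      Real.fourierChar_apply, smul_eq_mul]
    have : (2 * Real.pi * -(inner ℝ t ((2 * Real.pi)⁻¹ * p)) : ℝ) = -(p * t) := by
      have := Real.pi_ne_zero
      simp only [RCLike.inner_apply, conj_trivial]
      field_simp
    rw [this]
    ring
  rw [e, enorm_mul, ← enorm_norm (Complex.exp _), Complex.norm_exp_ofReal_mul_I]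
  simp

theorem lintegral_hermiteFun_zero_sq : ∫⁻ x, ‖(hermiteFun 0 x : ℂ)‖ₑ ^ 2 = 1 := by
  have h := integral_hermiteFun_sq 0
  have e : ∀ x, ‖(hermiteFun 0 x : ℂ)‖ₑ ^ 2 = ENNReal.ofReal (hermiteFun 0 x ^ 2) := fun x => by
    rw [← ofReal_norm, Complex.norm_real, ← ENNReal.ofReal_pow (norm_nonneg _),
      Real.norm_eq_abs, sq_abs]
  simp only [e]
  rw [← ofReal_integral_eq_lintegral_ofReal (integrable_hermiteFun_sq 0)
    (Filter.Eventually.of_forall fun x => sq_nonneg _), h, ENNReal.ofReal_one]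

theorem lintegral_enorm_sq_L2 {α : Type*} [MeasurableSpace α] {ν : Measure α} (ψ : Lp ℂ 2 ν) :
    ∫⁻ t, ‖ψ t‖ₑ ^ 2 ∂ν = ‖ψ‖ₑ ^ 2 := by
  have h := eLpNorm_nnreal_pow_eq_lintegral (f := ψ) (μ := ν) (p := 2) (by norm_num)
  simp only [NNReal.coe_ofNat, ENNReal.rpow_ofNat, ENNReal.coe_ofNat] at h
  rw [Lp.enorm_def, h]

/-- Moyal's identity for the vacuum. -/
theorem lintegral_weyl_vacuum (ψ : L2) :
    ∫⁻ q, ∫⁻ p, ‖⟪weyl q p (numberState 0), ψ⟫_ℂ‖ₑ ^ 2 =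
      ENNReal.ofReal (2 * Real.pi) * ‖ψ‖ₑ ^ 2 := by
  have hψ : Measurable (ψ : ℝ → ℂ) := (Lp.stronglyMeasurable ψ).measurable
  have hh : Measurable fun x => (hermiteFun 0 x : ℂ) :=
    (Complex.continuous_ofReal.comp (continuous_hermiteFun 0)).measurable
  have inner : ∀ q, ∫⁻ p, ‖⟪weyl q p (numberState 0), ψ⟫_ℂ‖ₑ ^ 2 =
      ENNReal.ofReal (2 * Real.pi) * ∫⁻ t, ‖windowed ψ q t‖ₑ ^ 2 := by
    intro q
    have hc : Continuous (𝓕 (windowed ψ q)) :=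
      VectorFourier.fourierIntegral_continuous Real.continuous_fourierChar
        (innerSL ℝ).continuous₂ (integrable_windowed ψ q)
    simp only [enorm_inner_weyl_vacuum]
    rw [lintegral_comp_mul_left (φ := fun w => ‖𝓕 (windowed ψ q) w‖ₑ ^ 2)
      (hc.measurable.enorm.pow_const 2) (inv_ne_zero (by positivity)),
      lintegral_enorm_fourier_sq (integrable_windowed ψ q) (memLp_windowed ψ q), inv_inv,
      abs_of_pos (by positivity)]
  simp only [inner]
  have hm : Measurable fun x : ℝ × ℝ => ‖windowed ψ x.1 x.2‖ₑ ^ 2 := by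
    unfold windowed
    exact ((hh.comp (measurable_snd.sub measurable_fst)).mul
      (hψ.comp measurable_snd)).enorm.pow_const 2
  rw [lintegral_const_mul _ (hm.lintegral_prod_right'), lintegral_lintegral_swap hm.aemeasurable]
  congr 1
  rw [← lintegral_enorm_sq_L2]
  refine lintegral_congr fun t => ?_
  simp only [windowed, enorm_mul, mul_pow]
  have hmt : Measurable fun x : ℝ => ‖(hermiteFun 0 (t - x) : ℂ)‖ₑ ^ 2 :=
    (hh.comp (measurable_const.sub measurable_id : Measurable fun x : ℝ => t - x)).enorm.pow_const 2
  rw [lintegral_mul_const _ hmt,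
    lintegral_sub_left_eq_self (fun x => ‖(hermiteFun 0 x : ℂ)‖ₑ ^ 2) t,
    lintegral_hermiteFun_zero_sq, one_mul]

theorem continuous_alpha : Continuous alpha := by
  unfold alpha; fun_prop

/-- The second coordinate is integrated last: α_u turns it into the position q, and Moyal's identity
integrates the momentum p first. -/
theorem lintegral_euclidean_eq {φ : EuclideanSpace ℝ (Fin 2) → ℝ≥0∞} (hφ : Measurable φ) :
    ∫⁻ u, φ u = ∫⁻ y : ℝ, ∫⁻ x : ℝ, φ !₂[x, y] := by
  have h1 := (PiLp.volume_preserving_toLp (Fin 2)).lintegral_comp hφ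
  have h2 := (volume_preserving_finTwoArrow ℝ).symm.lintegral_comp
    (hφ.comp (MeasurableEquiv.toLp 2 (Fin 2 → ℝ)).measurable)
  rw [← h1]
  refine h2.symm.trans ?_
  rw [Measure.volume_eq_prod, lintegral_prod_symm]
  · rfl
  · exact ((hφ.comp (MeasurableEquiv.toLp 2 (Fin 2 → ℝ)).measurable).comp
      (MeasurableEquiv.finTwoArrow (α := ℝ)).symm.measurable).aemeasurable

variable {μ : ℝ}

/-- The coherent state displaced to the parameter `u`. -/
def coherent (μ : ℝ) (u : EuclideanSpace ℝ (Fin 2)) : L2 :=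
  displacement (√(2 * μ - 1) * alpha u) (numberState 0)

theorem continuous_coherent (μ : ℝ) : Continuous (coherent μ) :=
  (continuous_displacement_numberState 0).comp (continuous_const.mul continuous_alpha)

theorem continuous_weyl_vacuum : Continuous fun x : ℝ × ℝ => weyl x.1 x.2 (numberState 0) := by
  have h : ∀ x : ℝ × ℝ, weyl x.1 x.2 (numberState 0) =
      displacement (((√2)⁻¹ * x.1 : ℝ) + ((√2)⁻¹ * x.2 : ℝ) * Complex.I) (numberState 0) := by
    intro x
    have h2 : √2 ≠ (0 : ℝ) := by positivity
    have e1 : √2 * (((√2)⁻¹ * x.1 : ℝ) + ((√2)⁻¹ * x.2 : ℝ) * Complex.I : ℂ).re = x.1 := by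
      rw [Complex.add_re, Complex.ofReal_re, Complex.re_ofReal_mul, Complex.I_re, mul_zero, add_zero,
        mul_inv_cancel_left₀ h2]
    have e2 : √2 * (((√2)⁻¹ * x.1 : ℝ) + ((√2)⁻¹ * x.2 : ℝ) * Complex.I : ℂ).im = x.2 := by
      rw [Complex.add_im, Complex.ofReal_im, Complex.im_ofReal_mul, Complex.I_im, mul_one, zero_add,
        mul_inv_cancel_left₀ h2]
    rw [displacement_apply, e1, e2]
  simp only [h]
  exact (continuous_displacement_numberState 0).comp (by fun_prop)

theorem lintegral_lintegral_comp_rotate {Φ : ℝ → ℝ → ℝ≥0∞}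
    (hΦ : Measurable fun x : ℝ × ℝ => Φ x.1 x.2) {c : ℝ} (hc : 0 < c) :
    ∫⁻ y, ∫⁻ x, Φ (-c * y) (c * x) = ENNReal.ofReal (c * c)⁻¹ * ∫⁻ q, ∫⁻ p, Φ q p := by
  have hin : ∀ q, ∫⁻ x, Φ q (c * x) = ENNReal.ofReal c⁻¹ * ∫⁻ p, Φ q p := by
    intro q
    have hm : Measurable (Φ q) := hΦ.comp (measurable_const.prodMk measurable_id)
    rw [lintegral_comp_mul_left hm hc.ne', abs_of_pos (by positivity)]
  have hm3 : Measurable fun q => ∫⁻ p, Φ q p :=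
    Measurable.lintegral_prod_right' (f := fun x : ℝ × ℝ => Φ x.1 x.2) hΦ
  simp only [hin]
  rw [lintegral_comp_mul_left (φ := fun q => ENNReal.ofReal c⁻¹ * ∫⁻ p, Φ q p) (hm3.const_mul _)
    (neg_ne_zero.2 hc.ne'), lintegral_const_mul _ hm3, ← mul_assoc,
    ← ENNReal.ofReal_mul (abs_nonneg _), inv_neg, abs_neg, abs_of_pos (by positivity), ← mul_inv]

theorem enorm_inner_coherent_sq (μ : ℝ) (ψ : L2) (x y : ℝ) :
    ‖⟪coherent μ !₂[x, y], ψ⟫_ℂ‖ₑ ^ 2 =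
      ‖⟪weyl (-(√2 * √(2 * μ - 1)) * y) (√2 * √(2 * μ - 1) * x) (numberState 0), ψ⟫_ℂ‖ₑ ^ 2 := by
  have e1 : √2 * ((√(2 * μ - 1) : ℂ) * alpha !₂[x, y]).re = -(√2 * √(2 * μ - 1)) * y := by
    rw [Complex.re_ofReal_mul]; simp [alpha]; ring
  have e2 : √2 * ((√(2 * μ - 1) : ℂ) * alpha !₂[x, y]).im = √2 * √(2 * μ - 1) * x := by
    rw [Complex.im_ofReal_mul]; simp [alpha]; ring
  rw [coherent, displacement_apply, e1, e2]

/-- The resolution of the identity by coherent states. -/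
theorem lintegral_coherent (h1 : 1 / 2 < μ) (ψ : L2) :
    ∫⁻ u, ‖⟪coherent μ u, ψ⟫_ℂ‖ₑ ^ 2 = ENNReal.ofReal (Real.pi / (2 * μ - 1)) * ‖ψ‖ₑ ^ 2 := by
  have hs : 0 < 2 * μ - 1 := by linarith
  have hcc : √2 * √(2 * μ - 1) * (√2 * √(2 * μ - 1)) = 2 * (2 * μ - 1) := by
    rw [mul_mul_mul_comm, Real.mul_self_sqrt (by norm_num), Real.mul_self_sqrt hs.le]
  have hΦm : Measurable fun x : ℝ × ℝ => ‖⟪weyl x.1 x.2 (numberState 0), ψ⟫_ℂ‖ₑ ^ 2 :=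
    ((continuous_weyl_vacuum.inner continuous_const).measurable.enorm).pow_const 2
  have hm : Measurable fun u => ‖⟪coherent μ u, ψ⟫_ℂ‖ₑ ^ 2 :=
    ((continuous_coherent μ).inner continuous_const).measurable.enorm.pow_const 2
  have hmain := lintegral_lintegral_comp_rotate
    (Φ := fun q p => ‖⟪weyl q p (numberState 0), ψ⟫_ℂ‖ₑ ^ 2) hΦm (c := √2 * √(2 * μ - 1))
    (by positivity)
  rw [lintegral_euclidean_eq hm]
  simp only [enorm_inner_coherent_sq]
  rw [hmain, lintegral_weyl_vacuum, hcc, ← mul_assoc, ← ENNReal.ofReal_mul (by positivity)]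
  congr 2
  field_simp

end Resolution

/-! ### The heterodyne measurement. -/

section Heterodyne

variable {μ : ℝ}

theorem inner_heterodyneDensity (μ : ℝ) (u : EuclideanSpace ℝ (Fin 2)) (ψ : L2) :
    ⟪ψ, heterodyneDensity μ u ψ⟫_ℂ =
      (((2 * μ - 1) / Real.pi * ‖⟪coherent μ u, ψ⟫_ℂ‖ ^ 2 : ℝ) : ℂ) := by
  have e : heterodyneDensity μ u ψ =
      (((2 * μ - 1) / Real.pi : ℝ) : ℂ) • (⟪coherent μ u, ψ⟫_ℂ • coherent μ u) := by
    simp only [heterodyneDensity, smul_apply, mul_apply_eq_comp, InnerProductSpace.rankOne_apply,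
      ContinuousLinearMap.adjoint_inner_right, map_smul, coherent]
  rw [e, inner_smul_right, inner_smul_right, ← inner_conj_symm ψ, Complex.mul_conj,
    Complex.normSq_eq_norm_sq]
  push_cast
  ring

/-- The amplitude whose squared modulus is the heterodyne outcome density. -/
def heterodyneAmplitude (μ : ℝ) (ψ : L2) (u : EuclideanSpace ℝ (Fin 2)) : ℂ :=
  (√((2 * μ - 1) / Real.pi) : ℂ) * ⟪coherent μ u, ψ⟫_ℂ

theorem continuous_heterodyneAmplitude (μ : ℝ) (ψ : L2) : Continuous (heterodyneAmplitude μ ψ) :=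
  continuous_const.mul ((continuous_coherent μ).inner continuous_const)

theorem norm_sq_heterodyneAmplitude (h1 : 1 / 2 < μ) (ψ : L2) (u : EuclideanSpace ℝ (Fin 2)) :
    ‖heterodyneAmplitude μ ψ u‖ ^ 2 = (2 * μ - 1) / Real.pi * ‖⟪coherent μ u, ψ⟫_ℂ‖ ^ 2 := by
  have hs : 0 ≤ (2 * μ - 1) / Real.pi := div_nonneg (by linarith) Real.pi_pos.le
  rw [heterodyneAmplitude, norm_mul, mul_pow, Complex.norm_real, Real.norm_eq_abs, sq_abs,
    Real.sq_sqrt hs]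

theorem lintegral_heterodyneAmplitude (h1 : 1 / 2 < μ) (ψ : L2) :
    ∫⁻ u, ‖heterodyneAmplitude μ ψ u‖ₑ ^ 2 = ‖ψ‖ₑ ^ 2 := by
  have hs : 0 < 2 * μ - 1 := by linarith
  have e : ∀ u, ‖heterodyneAmplitude μ ψ u‖ₑ ^ 2 =
      ENNReal.ofReal ((2 * μ - 1) / Real.pi) * ‖⟪coherent μ u, ψ⟫_ℂ‖ₑ ^ 2 := fun u => by
    rw [← ofReal_norm, ← ofReal_norm, ← ENNReal.ofReal_pow (norm_nonneg _),
      ← ENNReal.ofReal_pow (norm_nonneg _), norm_sq_heterodyneAmplitude h1,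
      ENNReal.ofReal_mul (by positivity)]
  have hm : Measurable fun u => ‖⟪coherent μ u, ψ⟫_ℂ‖ₑ ^ 2 :=
    ((continuous_coherent μ).inner continuous_const).measurable.enorm.pow_const 2
  simp only [e]
  rw [lintegral_const_mul _ hm, lintegral_coherent h1, ← mul_assoc,
    ← ENNReal.ofReal_mul (by positivity), div_mul_div_cancel₀' hs.ne', div_self Real.pi_ne_zero,
    ENNReal.ofReal_one, one_mul]

theorem memLp_heterodyneAmplitude (h1 : 1 / 2 < μ) (ψ : L2) :
    MemLp (heterodyneAmplitude μ ψ) 2 volume := by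
  refine ⟨(continuous_heterodyneAmplitude μ ψ).aestronglyMeasurable, ?_⟩
  have h := eLpNorm_nnreal_pow_eq_lintegral (f := heterodyneAmplitude μ ψ)
    (μ := (volume : Measure (EuclideanSpace ℝ (Fin 2)))) (p := 2) (by norm_num)
  simp only [NNReal.coe_ofNat, ENNReal.rpow_ofNat, ENNReal.coe_ofNat] at h
  rw [lintegral_heterodyneAmplitude h1] at h
  refine lt_of_le_of_lt ?_ (enorm_lt_top (x := ψ))
  exact ((ENNReal.pow_right_strictMono two_ne_zero).injective h).le

theorem integrable_norm_sq_heterodyneAmplitude (h1 : 1 / 2 < μ) (ψ : L2) :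
    Integrable fun u => ‖heterodyneAmplitude μ ψ u‖ ^ 2 :=
  (memLp_two_iff_integrable_sq_norm
    (continuous_heterodyneAmplitude μ ψ).aestronglyMeasurable).1 (memLp_heterodyneAmplitude h1 ψ)

theorem integral_norm_sq_heterodyneAmplitude (h1 : 1 / 2 < μ) (ψ : L2) :
    ∫ u, ‖heterodyneAmplitude μ ψ u‖ ^ 2 = ‖ψ‖ ^ 2 := by
  rw [integral_eq_lintegral_of_nonneg_ae (Filter.Eventually.of_forall fun u => by positivity)
    (integrable_norm_sq_heterodyneAmplitude h1 ψ).aestronglyMeasurable]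
  have e : ∀ u, ENNReal.ofReal (‖heterodyneAmplitude μ ψ u‖ ^ 2) =
      ‖heterodyneAmplitude μ ψ u‖ₑ ^ 2 := fun u => by
    rw [ENNReal.ofReal_pow (norm_nonneg _), ofReal_norm]
  simp only [e]
  rw [lintegral_heterodyneAmplitude h1, ENNReal.toReal_pow, toReal_enorm]

/-- The amplitude as a function on the outcome set `B`, linear in the state. -/
def heterodyneTransformLinear (h1 : 1 / 2 < μ) (B : Set (EuclideanSpace ℝ (Fin 2))) :
    L2 →ₗ[ℂ] Lp ℂ 2 (volume.restrict B) where
  toFun ψ := ((memLp_heterodyneAmplitude h1 ψ).restrict B).toLp _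
  map_add' f g := by
    rw [← MemLp.toLp_add]
    congr 1
    ext u
    simp only [heterodyneAmplitude, inner_add_right, mul_add, Pi.add_apply]
  map_smul' c f := by
    rw [RingHom.id_apply, ← MemLp.toLp_const_smul]
    congr 1
    ext u
    simp only [heterodyneAmplitude, inner_smul_right, Pi.smul_apply, smul_eq_mul]
    ring

theorem norm_sq_heterodyneTransformLinear (h1 : 1 / 2 < μ) (B : Set (EuclideanSpace ℝ (Fin 2)))
    (ψ : L2) : ‖heterodyneTransformLinear h1 B ψ‖ ^ 2 =
      ∫ u in B, ‖heterodyneAmplitude μ ψ u‖ ^ 2 := by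
  have h : ⟪heterodyneTransformLinear h1 B ψ, heterodyneTransformLinear h1 B ψ⟫_ℂ =
      ((∫ u in B, ‖heterodyneAmplitude μ ψ u‖ ^ 2 : ℝ) : ℂ) := by
    rw [L2.inner_def, ← integral_complex_ofReal]
    refine integral_congr_ae ?_
    filter_upwards [((memLp_heterodyneAmplitude h1 ψ).restrict B).coeFn_toLp] with u hu
    change ⟪(((memLp_heterodyneAmplitude h1 ψ).restrict B).toLp _) u,
      (((memLp_heterodyneAmplitude h1 ψ).restrict B).toLp _) u⟫_ℂ = _
    rw [hu, inner_self_eq_norm_sq_to_K]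
    push_cast
    rfl
  rw [inner_self_eq_norm_sq_to_K] at h
  exact Complex.ofReal_injective (by simpa using h)

/-- The amplitude as a bounded operator into the square-integrable functions on `B`. -/
def heterodyneTransform (h1 : 1 / 2 < μ) (B : Set (EuclideanSpace ℝ (Fin 2))) :
    L2 →L[ℂ] Lp ℂ 2 (volume.restrict B) :=
  (heterodyneTransformLinear h1 B).mkContinuous 1 fun ψ => by
    rw [one_mul]
    refine le_of_sq_le_sq ?_ (norm_nonneg _)
    rw [norm_sq_heterodyneTransformLinear, ← integral_norm_sq_heterodyneAmplitude h1]
    exact setIntegral_le_integral (integrable_norm_sq_heterodyneAmplitude h1 ψ)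
      (Filter.Eventually.of_forall fun u => by positivity)

/-- The heterodyne effect of the outcome set `B`. -/
def heterodyneEffect (h1 : 1 / 2 < μ) (B : Set (EuclideanSpace ℝ (Fin 2))) : L2 →L[ℂ] L2 :=
  (ContinuousLinearMap.adjoint (heterodyneTransform h1 B)).comp (heterodyneTransform h1 B)

/-- Writing the effect as T*T makes positivity automatic and realises the weak integral as the
squared norm of Tψ in L²(B). -/
theorem inner_heterodyneEffect (h1 : 1 / 2 < μ) (B : Set (EuclideanSpace ℝ (Fin 2))) (ψ : L2) :
    ⟪ψ, heterodyneEffect h1 B ψ⟫_ℂ = ((∫ u in B, ‖heterodyneAmplitude μ ψ u‖ ^ 2 : ℝ) : ℂ) := by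
  rw [heterodyneEffect, ContinuousLinearMap.comp_apply, ContinuousLinearMap.adjoint_inner_right,
    inner_self_eq_norm_sq_to_K, ← norm_sq_heterodyneTransformLinear h1]
  push_cast
  rfl

/-- The heterodyne measurement. -/
def heterodyne (h1 : 1 / 2 < μ) : POVM (EuclideanSpace ℝ (Fin 2)) L2 where
  toFun := heterodyneEffect h1
  isPositive B _ := ContinuousLinearMap.isPositive_adjoint_comp_self _
  map_univ := by
    have key : ∀ ψ : L2, ⟪ψ, heterodyneEffect h1 Set.univ ψ⟫_ℂ = ⟪ψ, ψ⟫_ℂ := by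
      intro ψ
      rw [inner_heterodyneEffect, setIntegral_univ, integral_norm_sq_heterodyneAmplitude h1,
        inner_self_eq_norm_sq_to_K]
      push_cast
      rfl
    have := (ext_inner_map (heterodyneEffect h1 Set.univ : L2 →ₗ[ℂ] L2)
      ((1 : L2 →L[ℂ] L2) : L2 →ₗ[ℂ] L2)).1 fun ψ => by
        have e := congrArg (starRingEnd ℂ) (key ψ)
        rw [inner_conj_symm, inner_conj_symm] at e
        exact e
    exact ContinuousLinearMap.coe_injective this
  hasSum_iUnion B hB hd ψ := by
    simp only [inner_heterodyneEffect]
    exact Complex.hasSum_ofReal.2 (hasSum_integral_iUnion hB hd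
      (integrable_norm_sq_heterodyneAmplitude h1 ψ).integrableOn)

theorem isHeterodyne_heterodyne (h1 : 1 / 2 < μ) : IsHeterodyne μ (heterodyne h1) := by
  intro B _ ψ
  simp only [inner_heterodyneDensity, ← norm_sq_heterodyneAmplitude h1]
  refine ⟨(integrable_norm_sq_heterodyneAmplitude h1 ψ).integrableOn.ofReal, ?_⟩
  rw [integral_complex_ofReal]
  exact inner_heterodyneEffect h1 B ψ

end Heterodyne

/-! ### Outcome law and risk of the heterodyne measurement. -/

section HeterodyneRisk

variable {μ : ℝ}

theorem norm_sq_inner_coherent (h1 : 1 / 2 < μ) (u v : EuclideanSpace ℝ (Fin 2)) (k : ℕ) :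
    ‖⟪coherent μ v, displacement (√(2 * μ - 1) * alpha u) (numberState k)⟫_ℂ‖ ^ 2 =
      Real.exp (-((2 * μ - 1) * ‖v - u‖ ^ 2)) * ((2 * μ - 1) * ‖v - u‖ ^ 2) ^ k / k.factorial := by
  set z : ℂ := √(2 * μ - 1) * alpha u with hz
  obtain ⟨c, hc, h⟩ := exists_phase_displacement_add z (√(2 * μ - 1) * alpha v - z)
  have e : coherent μ v = c • displacement z
      (displacement (√(2 * μ - 1) * alpha v - z) (numberState 0)) := by
    rw [← h, coherent, add_sub_cancel]
  rw [e, inner_smul_left, inner_displacement_displacement, norm_mul, RCLike.norm_conj, hc, one_mul,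
    norm_inner_symm, norm_sq_inner_vacuum, hz, norm_sq_sqrt_mul_alpha_sub h1]

/-- The density of the heterodyne outcome in the state with parameter `u`. -/
def heterodyneOutcomeDensity (μ : ℝ) (u v : EuclideanSpace ℝ (Fin 2)) : ℝ :=
  (optimalRisk μ * Real.pi)⁻¹ * Real.exp (-(optimalRisk μ)⁻¹ * ‖v - u‖ ^ 2)

/-- A geometric mixture of Poisson weights: with x = (2μ-1)‖v-u‖², ∑ pᵏxᵏ/k! = exp(px) leaves
exp(-(1-p)x), a Gaussian with exponent ‖v-u‖²/C, where C = `optimalRisk μ`. -/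
theorem hasSum_heterodyneOutcomeDensity (h1 : 1 / 2 < μ) (u v : EuclideanSpace ℝ (Fin 2)) :
    HasSum (fun k => thermalWeight μ k *
      ‖heterodyneAmplitude μ (displacement (√(2 * μ - 1) * alpha u) (numberState k)) v‖ ^ 2)
      (heterodyneOutcomeDensity μ u v) := by
  set x : ℝ := (2 * μ - 1) * ‖v - u‖ ^ 2 with hx
  have h := (NormedSpace.expSeries_div_hasSum_exp (𝔸 := ℝ) (thermalRatio μ * x)).mul_left
    ((2 * μ - 1) / Real.pi * (1 - thermalRatio μ) * Real.exp (-x))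
  rw [← Real.exp_eq_exp_ℝ, mul_assoc _ (Real.exp (-x)) (Real.exp _), ← Real.exp_add] at h
  have e : heterodyneOutcomeDensity μ u v = (2 * μ - 1) / Real.pi * (1 - thermalRatio μ) *
      Real.exp (-x + thermalRatio μ * x) := by
    rw [heterodyneOutcomeDensity, optimalRisk, mul_inv, inv_inv]
    congr 1
    · ring
    · congr 1
      rw [hx]
      ring
  rw [e]
  refine h.congr_fun fun k => ?_
  have hw : thermalWeight μ k = (1 - thermalRatio μ) * thermalRatio μ ^ k := rfl
  rw [norm_sq_heterodyneAmplitude h1, norm_sq_inner_coherent h1, ← hx, hw, mul_pow (thermalRatio μ) x]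
  ring

/-- All terms are nonnegative, so the sum over levels can be exchanged with the integral over B. -/
theorem outcomeMeasure_heterodyne (h1 : 1 / 2 < μ) (h2 : μ ≤ 1) (u : EuclideanSpace ℝ (Fin 2)) :
    outcomeMeasure (gaussianState μ h1 h2 u) (heterodyne h1) =
      volume.withDensity fun v => ENNReal.ofReal (heterodyneOutcomeDensity μ u v) := by
  ext B hB
  rw [outcomeMeasure_apply _ _ hB, withDensity_apply _ hB]
  have h := hasSum_trace_gaussianOp h1 h2 u ((heterodyne h1).toFun B)
  have hin : ∀ ψ : L2, ⟪ψ, (heterodyne h1).toFun B ψ⟫_ℂ =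
      ((∫ u in B, ‖heterodyneAmplitude μ ψ u‖ ^ 2 : ℝ) : ℂ) := inner_heterodyneEffect h1 B
  simp only [hin, ← Complex.ofReal_mul] at h
  have hre := h.mapL Complex.reCLM
  simp only [Complex.reCLM_apply, Complex.ofReal_re] at hre
  have hpos : ∀ k, 0 ≤ thermalWeight μ k * ∫ v in B,
      ‖heterodyneAmplitude μ (displacement (√(2 * μ - 1) * alpha u) (numberState k)) v‖ ^ 2 :=
    fun k => mul_nonneg (thermalWeight_nonneg h1 h2 k) (integral_nonneg fun v => by positivity)
  change ENNReal.ofReal (trace (gaussianOp μ u * (heterodyne h1).toFun B)).re = _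
  rw [← hre.tsum_eq, ENNReal.ofReal_tsum_of_nonneg hpos hre.summable]
  have e : ∀ v, ENNReal.ofReal (heterodyneOutcomeDensity μ u v) =
      ∑' k, ENNReal.ofReal (thermalWeight μ k *
        ‖heterodyneAmplitude μ (displacement (√(2 * μ - 1) * alpha u) (numberState k)) v‖ ^ 2) := by
    intro v
    have hv := hasSum_heterodyneOutcomeDensity h1 u v
    rw [← hv.tsum_eq, ENNReal.ofReal_tsum_of_nonneg
      (fun k => mul_nonneg (thermalWeight_nonneg h1 h2 k) (by positivity)) hv.summable]
  simp only [e]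
  rw [lintegral_tsum fun k => (((integrable_norm_sq_heterodyneAmplitude h1 _).const_mul
    _).integrableOn.aestronglyMeasurable.aemeasurable.ennreal_ofReal)]
  congr 1
  ext k
  rw [← integral_const_mul, ofReal_integral_eq_lintegral_ofReal
    ((integrable_norm_sq_heterodyneAmplitude h1 _).const_mul _).integrableOn
    (Filter.Eventually.of_forall fun v => mul_nonneg (thermalWeight_nonneg h1 h2 k) (by positivity))]

theorem lintegral_norm_sq_mul_exp {b : ℝ} (hb : 0 < b) :
    ∫⁻ v : EuclideanSpace ℝ (Fin 2), ENNReal.ofReal (‖v‖ ^ 2 * Real.exp (-b * ‖v‖ ^ 2)) =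
      ENNReal.ofReal (Real.pi / b ^ 2) := by
  have hmp := Complex.orthonormalBasisOneI.repr.measurePreserving
  rw [← hmp.lintegral_comp (by fun_prop)]
  simp only [LinearIsometryEquiv.norm_map]
  have h := Complex.integral_rpow_mul_exp_neg_mul_rpow (p := 2) (q := 2) (b := b) (by norm_num)
    (by norm_num) hb
  have hg : Real.Gamma ((2 + 2) / 2) = 1 := by
    rw [show ((2 : ℝ) + 2) / 2 = 1 + 1 by norm_num, Real.Gamma_add_one one_ne_zero, Real.Gamma_one,
      mul_one]
  have hb2 : b ^ (-(2 + 2) / 2 : ℝ) = (b ^ 2)⁻¹ := by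
    rw [show (-(2 + 2) / 2 : ℝ) = -(2 : ℕ) by norm_num, Real.rpow_neg hb.le, Real.rpow_natCast]
  rw [hg, hb2] at h
  simp only [Real.rpow_ofNat] at h
  have e : 2 * Real.pi / 2 * (b ^ 2)⁻¹ * 1 = Real.pi / b ^ 2 := by ring
  rw [e] at h
  rw [← h, ofReal_integral_eq_lintegral_ofReal]
  -- Integrability comes for free: the integral of a non-integrable function is 0 by convention, but
  -- the value found is positive.
  · by_contra hni
    rw [integral_undef hni] at h
    exact (by positivity : Real.pi / b ^ 2 ≠ 0) h.symm
  · exact Filter.Eventually.of_forall fun v => by positivity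

/-- By translation invariance the risk does not depend on u. With b = 1/C and prefactor 1/(Cπ), the
second moment is (π/b²)/(Cπ) = C. -/
theorem risk_heterodyne (h1 : 1 / 2 < μ) (h2 : μ ≤ 1) (u : EuclideanSpace ℝ (Fin 2)) :
    risk (gaussianState μ h1 h2 u) (heterodyne h1) id u = ENNReal.ofReal (optimalRisk μ) := by
  have hC := optimalRisk_pos h1
  have hm : Measurable fun v => ENNReal.ofReal (heterodyneOutcomeDensity μ u v) := by
    unfold heterodyneOutcomeDensity
    exact Measurable.ennreal_ofReal (Continuous.measurable (by fun_prop))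
  rw [risk, outcomeMeasure_heterodyne, lintegral_withDensity_eq_lintegral_mul _ hm
    (by fun_prop)]
  have e : ∀ v : EuclideanSpace ℝ (Fin 2),
      ((fun v => ENNReal.ofReal (heterodyneOutcomeDensity μ u v)) *
        fun v => ENNReal.ofReal (‖id v - u‖ ^ 2)) v =
      (fun w => ENNReal.ofReal (optimalRisk μ * Real.pi)⁻¹ *
        ENNReal.ofReal (‖w‖ ^ 2 * Real.exp (-(optimalRisk μ)⁻¹ * ‖w‖ ^ 2))) (v - u) := by
    intro v
    simp only [Pi.mul_apply, id]
    rw [← ENNReal.ofReal_mul (by rw [heterodyneOutcomeDensity]; positivity),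
      ← ENNReal.ofReal_mul (by positivity), heterodyneOutcomeDensity]
    congr 1
    ring
  refine (lintegral_congr e).trans ((lintegral_sub_right_eq_self (fun w =>
    ENNReal.ofReal (optimalRisk μ * Real.pi)⁻¹ *
      ENNReal.ofReal (‖w‖ ^ 2 * Real.exp (-(optimalRisk μ)⁻¹ * ‖w‖ ^ 2))) u).trans ?_)
  rw [lintegral_const_mul _ (by fun_prop),
    lintegral_norm_sq_mul_exp (inv_pos.2 hC), ← ENNReal.ofReal_mul (by positivity)]
  congr 1
  field_simp

end HeterodyneRisk

/-! ### Assembly: squeezing the minimax risks. -/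

theorem minimaxRisk_mono {d : ℕ} {H : Type*} [NormedAddCommGroup H] [InnerProductSpace ℂ H]
    [CompleteSpace H] (ρ : EuclideanSpace ℝ (Fin d) → DensityOperator H)
    {K K' : Set (EuclideanSpace ℝ (Fin d))} (h : K ⊆ K') : minimaxRisk ρ K ≤ minimaxRisk ρ K' :=
  iInf_mono fun _ => iInf_mono fun _ => iInf_mono fun _ => iInf_mono fun _ => iInf_mono fun _ =>
    biSup_mono fun _ hu => h hu

theorem worstCaseRisk_heterodyne {μ : ℝ} (h1 : 1 / 2 < μ) (h2 : μ ≤ 1) :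
    worstCaseRisk (gaussianState μ h1 h2) Set.univ (heterodyne h1) id =
      ENNReal.ofReal (optimalRisk μ) := by
  simp only [worstCaseRisk, risk_heterodyne, Set.mem_univ, iSup_pos, ciSup_const]

theorem minimaxRisk_univ_le {μ : ℝ} (h1 : 1 / 2 < μ) (h2 : μ ≤ 1) :
    minimaxRisk (gaussianState μ h1 h2) Set.univ ≤ ENNReal.ofReal (optimalRisk μ) := by
  rw [← worstCaseRisk_heterodyne h1 h2]
  exact iInf_le_of_le (EuclideanSpace ℝ (Fin 2)) <| iInf_le_of_le inferInstance <|
    iInf_le_of_le (heterodyne h1) <| iInf_le_of_le id <| iInf_le_of_le measurable_id le_rfl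

theorem tendsto_minimaxRisk_square {μ : ℝ} (h1 : 1 / 2 < μ) (h2 : μ ≤ 1) :
    Filter.Tendsto (fun a => minimaxRisk (gaussianState μ h1 h2) (square a)) Filter.atTop
      (nhds (ENNReal.ofReal (optimalRisk μ))) := by
  refine tendsto_of_tendsto_of_tendsto_of_le_of_le' (tendsto_squareLowerBound h1) tendsto_const_nhds
    ?_ (Filter.Eventually.of_forall fun a =>
      (minimaxRisk_mono _ (Set.subset_univ _)).trans (minimaxRisk_univ_le h1 h2))
  filter_upwards [Filter.eventually_gt_atTop 0] with a ha
  exact squareLowerBound_le_minimaxRisk h1 h2 ha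

/-- The risks over squares tend to C and never exceed the risk over the plane, so the latter is at
least C; heterodyne gives the converse. -/
theorem minimaxRisk_univ {μ : ℝ} (h1 : 1 / 2 < μ) (h2 : μ ≤ 1) :
    minimaxRisk (gaussianState μ h1 h2) Set.univ = ENNReal.ofReal (optimalRisk μ) :=
  le_antisymm (minimaxRisk_univ_le h1 h2) <|
    le_of_tendsto' (tendsto_minimaxRisk_square h1 h2) fun _ => minimaxRisk_mono _ (Set.subset_univ _)

end QStat

end

theorem mainTheorem6 (μ : ℝ) (hμ : 1 / 2 < μ) (hμ' : μ ≤ 1) :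
    Filter.Tendsto (fun a : ℝ => QStat.minimaxRisk (QStat.gaussianState μ hμ hμ') (QStat.square a))
      Filter.atTop
      (nhds (QStat.minimaxRisk (QStat.gaussianState μ hμ hμ') Set.univ)) ∧
    (∃ M : QStat.POVM (EuclideanSpace ℝ (Fin 2)) QStat.L2, QStat.IsHeterodyne μ M ∧
      QStat.worstCaseRisk (QStat.gaussianState μ hμ hμ') Set.univ M id =
        QStat.minimaxRisk (QStat.gaussianState μ hμ hμ') Set.univ ∧
      ∀ u : EuclideanSpace ℝ (Fin 2), QStat.risk (QStat.gaussianState μ hμ hμ' u) M id u =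
        QStat.minimaxRisk (QStat.gaussianState μ hμ hμ') Set.univ) ∧
    QStat.minimaxRisk (QStat.gaussianState μ hμ hμ') Set.univ ≠ ⊤ ∧
    ∀ u : EuclideanSpace ℝ (Fin 2),
      QStat.minimaxRisk (QStat.gaussianState μ hμ hμ') Set.univ =
        QStat.holevoBound (QStat.gaussianState μ hμ hμ') u := by
  rw [QStat.minimaxRisk_univ]
  exact ⟨QStat.tendsto_minimaxRisk_square hμ hμ',
    ⟨QStat.heterodyne hμ, QStat.isHeterodyne_heterodyne hμ, QStat.worstCaseRisk_heterodyne hμ hμ',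
      QStat.risk_heterodyne hμ hμ'⟩, ENNReal.ofReal_ne_top,
    fun u => (QStat.holevoBound_eq_optimalRisk hμ hμ' u).symm⟩
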